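/- **Setting.** Let $U=\{-1,1\}$ and let $\Omega$ be the space of environments $\omega=(\pi(x,x+z))_{x\in\mathbb Z,\,z\in U}$ with $\pi(x,x+z)\ge 0$, $\pi(x,x+1)+\pi(x,x-1)=1$, with the product $\sigma$-algebra. Let $T_y$ be the shift, $(T_y\omega)_x=\omega_{x+y}$, and let $\mathbb P$ be a probability measure on $\Omega$ that is stationary and ergodic under the shifts. Let $P_x^\omega$ be the law of the Markov chain $(X_n)_{n\ge0}$ on $\mathbb Z$ that starts at $x$ and has transition probabilities $\pi$, with expectation $E_x^\omega$. Assume that $\pi(0,\pm1)>0$ $\mathbb P$-a.s. and $\int|\log\pi(0,\pm1)|^{1+\alpha}\,d\mathbb P<\infty$ for some $\alpha>0$. For a probability measure $\mu$ on $\Omega\times U$ let $(\mu)^1$ be its marginal on $\Omega$, $(\mu)^2$ its image under $(\omega,z)\mapsto T_z\omega$, and $\xi_\mu=\int z\,d\mu(\omega,z)$. Let $M$ be the set of those $\mu$ with $(\mu)^1=(\mu)^2\ll\mathbb P$ and $\frac{d\mu(\omega,z)}{d(\mu)^1(\omega)}>0$ $\mathbb P$-a.s. for $z=\pm1$. Put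 $$\mathfrak I_q(\mu)=\int\sum_{z\in U}d\mu(\omega,z)\log\frac{d\mu(\omega,z)}{d(\mu)^1(\omega)\,\pi(0,z)}\quad(\mu\in M),\qquad \mathfrak I_q(\mu)=\infty\quad(\mu\notin M).$$ Let $\mathcal K$ be the class of measurable $F:\Omega\times U\to\mathbb R$ such that, for $z=\pm1$, $F(\cdot,z)\in\bigcup_{\beta>0}L^{1+\beta}(\mathbb P)$ and $\int F(\cdot,z)\,d\mathbb P=0$, and such that, for $\mathbb P$-a.e. $\omega$, $\sum_{k=0}^{n-1}F(T_{x_k}\omega,x_{k+1}-x_k)=0$ for all $n$ and all nearest-neighbour paths with $x_0=x_n$. A measure $\mu$ *fits the Ansatz at $\xi$ with $(\theta,F,r)$*, where $\theta,r\in\mathbb R$ and $F\in\mathcal K$, if $\mu\in M$, $\xi_\mu=\xi$ and $d\mu(\omega,z)=d(\mu)^1(\omega)\,\pi(0,z)\,e^{\theta z+F(\omega,z)+r}$. For $s\in\{1,-1\}$ let $t^{(s)}=\inf\{k\ge0:sX_k\ge1\}$, $\zeta_s(r,\omega)=E_0^\omega[e^{rt^{(s)}};\,t^{(s)}<\infty]$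 and $\lambda_s(r)=\int\log\zeta_s(r,\omega)\,d\mathbb P$. **Theorem.** For each $s$ there is $r_c^{(s)}\ge0$ such that $\mathbb P$-a.s. $\zeta_s(r,\omega)<\infty$ for $r<r_c^{(s)}$ and $\zeta_s(r,\omega)=\infty$ for $r>r_c^{(s)}$. For $r<r_c^{(s)}$, $\log\zeta_s(r,\cdot)$ is $\mathbb P$-integrable and $\lambda_s$ is differentiable at $r$. The limits $$\xi_c=\lim_{r\uparrow r_c^{(1)}}\frac1{\lambda_1'(r)},\qquad \xi_c'=-\lim_{r\uparrow r_c^{(-1)}}\frac1{\lambda_{-1}'(r)}$$ exist and satisfy $-1<\xi_c'\le0\le\xi_c<1$. Let $\xi\in(\xi_c,1)$ and $s=1$, or $\xi\in(-1,\xi_c')$ and $s=-1$. Then there is exactly one $r=r(\xi)<r_c^{(s)}$ with $\lambda_s'(r)=1/|\xi|$. With this $r$, there is a measure $\mu_\xi$ that fits the Ansatz at $\xi$ with $\theta=-s\lambda_s(r)$, this $r$, and $$F(\omega,s)=\lambda_s(r)-\log\zeta_s(r,\omega),\qquad F(\omega,-s)=\log\zeta_s(r,T_{-s}\omega)-\lambda_s(r).$$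 It is the unique minimizer of $\mathfrak I_q$ over $\{\mu:\xi_\mu=\xi\}$, and $$\inf_{\mu:\,\xi_\mu=\xi}\mathfrak I_q(\mu)=\mathfrak I_q(\mu_\xi)=r(\xi)-|\xi|\,\lambda_s(r(\xi)).$$ Moreover the quenched rate function takes this value: if $I_q:\mathbb R\to[0,\infty]$ is such that, for $\mathbb P$-a.e. $\omega$, the laws of $X_n/n$ under $P_0^\omega$ satisfy the large deviation principle with rate function $I_q$, then $I_q(\xi)=r(\xi)-|\xi|\,\lambda_s(r(\xi))$. -/

import Mathlib

open MeasureTheory ProbabilityTheory Filter Set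
open scoped ENNReal Topology

noncomputable section

namespace RWRE

/-! ### Nearest-neighbour environments on the integers

The set of steps `U = {-1, 1}` is the unit group `ℤˣ` of the integers. -/

/-- The environment at one site: a probability vector on the steps `-1` and `1`. -/
abbrev SiteEnv : Type := {p : ℤˣ → ℝ // (∀ z, 0 ≤ p z) ∧ ∑ z, p z = 1}

/-- An environment `ω = (ω_x)_{x ∈ ℤ}`; this type carries the product `σ`-algebra. -/
abbrev Env : Type := ℤ → SiteEnv

/-- The transition probability `π(x, x + z)` in the environment `ω`. -/
def trans (ω : Env) (x : ℤ) (z : ℤˣ) : ℝ := (ω x).1 z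

/-- The shift `(T_y ω)_x = ω_{x + y}`. -/
def shift (y : ℤ) (ω : Env) : Env := fun x => ω (x + y)

/-! ### The quenched law of the walk -/

/-- The law of the next position of the walk that is at `x`, in the environment `ω`. -/
def stepLaw (ω : Env) (x : ℤ) : Measure ℤ :=
  ∑ z : ℤˣ, ENNReal.ofReal (trans ω x z) • Measure.dirac (x + (z : ℤ))

instance stepLaw_isProbabilityMeasure (ω : Env) (x : ℤ) : IsProbabilityMeasure (stepLaw ω x) := by
  refine ⟨?_⟩
  have h := (ω x).2
  simp only [stepLaw, Measure.coe_finsetSum, Finset.sum_apply, Measure.smul_apply, measure_univ,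
    smul_eq_mul, mul_one]
  rw [← ENNReal.ofReal_sum_of_nonneg (f := fun z => trans ω x z) (fun z _ => h.1 z)]
  simp only [trans, h.2, ENNReal.ofReal_one]

/-- The transition kernel of the walk in the environment `ω`. -/
def stepKernel (ω : Env) : Kernel ℤ ℤ := Kernel.ofFunOfCountable (stepLaw ω)

instance stepKernel_isMarkovKernel (ω : Env) : IsMarkovKernel (stepKernel ω) :=
  ⟨fun x => stepLaw_isProbabilityMeasure ω x⟩

/-- The kernel that gives `X_{n+1}` from the history `(X_0, …, X_n)`. -/
def historyKernel (ω : Env) (n : ℕ) : Kernel ((i : Finset.Iic n) → ℤ) ℤ :=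
  (stepKernel ω).comap (fun h => h ⟨n, Finset.mem_Iic.2 le_rfl⟩) (measurable_pi_apply _)

instance historyKernel_isMarkovKernel (ω : Env) (n : ℕ) : IsMarkovKernel (historyKernel ω n) := by
  unfold historyKernel; infer_instance

/-- The quenched law `P_x^ω` on the space of paths `(X_n)_{n ≥ 0}`: the law of the Markov chain
that starts at `x` and has the transition probabilities given by `ω`. -/
def quenchedLaw (ω : Env) (x : ℤ) : Measure (ℕ → ℤ) :=
  Kernel.traj (X := fun _ => ℤ) (historyKernel ω) 0 (fun _ => x)

/-! ### The large deviation principle -/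

/-- The sequence `(Q_n)_{n ≥ 1}` of measures satisfies the large deviation principle with the rate
function `I`. -/
def SatisfiesLDP (Q : ℕ → Measure ℝ) (I : ℝ → ℝ≥0∞) : Prop :=
  LowerSemicontinuous I ∧
  ∀ G : Set ℝ, MeasurableSet G →
    -(⨅ x ∈ interior G, (I x : EReal)) ≤
        liminf (fun n : ℕ => (((n : ℝ)⁻¹ : ℝ) : EReal) * ENNReal.log (Q n G)) atTop ∧
    limsup (fun n : ℕ => (((n : ℝ)⁻¹ : ℝ) : EReal) * ENNReal.log (Q n G)) atTop ≤
        -(⨅ x ∈ closure G, (I x : EReal))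

/-- `I` is the (deterministic) rate function of the quenched large deviation principle for the mean
velocity: for `P`-a.e. `ω`, the laws of `X_n / n` under `P_0^ω` satisfy the large deviation
principle with the rate function `I`. -/
def IsQuenchedRateFunction (P : Measure Env) (I : ℝ → ℝ≥0∞) : Prop :=
  ∀ᵐ ω ∂P, SatisfiesLDP
    (fun n => (quenchedLaw ω 0).map (fun X : ℕ → ℤ => (X n : ℝ) / (n : ℝ))) I

/-! ### Pair measures and the variational formula -/

/-- The measure `A ↦ μ (A × {z})` on environments. -/
def component (μ : Measure (Env × ℤˣ)) (z : ℤˣ) : Measure Env :=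
  (μ.restrict {p | p.2 = z}).fst

/-- The second marginal `(μ)²`, the image of `μ` under `(ω, z) ↦ T_z ω`.
The first marginal `(μ)¹` is `μ.fst`. -/
def sndMarginal (μ : Measure (Env × ℤˣ)) : Measure Env :=
  μ.map (fun p => shift (p.2 : ℤ) p.1)

/-- The density `dμ(ω, z) / d(μ)¹(ω)`. -/
def stepDensity (μ : Measure (Env × ℤˣ)) (z : ℤˣ) (ω : Env) : ℝ≥0∞ :=
  (component μ z).rnDeriv μ.fst ω

/-- The class of probability measures `μ` on `Ω × U` with `(μ)¹ = (μ)² ≪ P` and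
`dμ(ω, z) / d(μ)¹(ω) > 0` `P`-a.s. for each step `z`. -/
structure IsStationaryPair (P : Measure Env) (μ : Measure (Env × ℤˣ)) : Prop where
  prob : IsProbabilityMeasure μ
  stationary : μ.fst = sndMarginal μ
  ac : μ.fst ≪ P
  pos : ∀ z, ∀ᵐ ω ∂P, 0 < stepDensity μ z ω

/-- The set `A_ξ` of the probability measures on `Ω × U` with mean velocity `ξ`. -/
def velocitySet (ξ : ℝ) : Set (Measure (Env × ℤˣ)) :=
  {μ | IsProbabilityMeasure μ ∧ ∫ p, (((p.2 : ℤˣ) : ℤ) : ℝ) ∂μ = ξ}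

open Classical in
/-- The functional
`μ ↦ ∫ ∑_z dμ(ω, z) log (dμ(ω, z) / (d(μ)¹(ω) π(0, z)))` on the stationary pair measures, and `∞`
elsewhere. For a fixed `ω` with `π(0, ±1) > 0` the sum over `z` is a relative entropy of probability
vectors, hence nonnegative, so that the integral is one of a nonnegative function. -/
def pairRate (P : Measure Env) (μ : Measure (Env × ℤˣ)) : ℝ≥0∞ :=
  if IsStationaryPair P μ then
    ∫⁻ ω, ENNReal.ofReal (∑ z : ℤˣ, (stepDensity μ z ω).toReal *
      Real.log ((stepDensity μ z ω).toReal / trans ω 0 z)) ∂μ.fst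
  else ∞

/-- The infimum of the functional `pairRate` over `A_ξ`. -/
def variationalRate (P : Measure Env) (ξ : ℝ) : ℝ≥0∞ :=
  ⨅ μ ∈ velocitySet ξ, pairRate P μ

/-! ### The Ansatz -/

/-- The class of measurable functions on `Ω × U` that satisfy the moment, mean zero and closed loop
conditions (in dimension one). -/
structure InClassK (P : Measure Env) (F : Env → ℤˣ → ℝ) : Prop where
  meas : ∀ z, Measurable (fun ω => F ω z)
  moment : ∀ z, ∃ α : ℝ, 0 < α ∧ MemLp (fun ω => F ω z) (ENNReal.ofReal (1 + α)) P
  mean_zero : ∀ z, ∫ ω, F ω z ∂P = 0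
  closed_loop : ∀ᵐ ω ∂P, ∀ (n : ℕ) (x : ℕ → ℤ) (z : ℕ → ℤˣ),
    (∀ k < n, x (k + 1) = x k + (z k : ℤ)) → x n = x 0 →
      ∑ k ∈ Finset.range n, F (shift (x k) ω) (z k) = 0

/-- `μ` fits the Ansatz at the velocity `ξ`, with the parameters `θ`, `F` and `r`: it is a stationary
pair measure in `A_ξ`, `F` is in the class `K`, and
`dμ(ω, z) = d(μ)¹(ω) π(0, z) exp (θ z + F(ω, z) + r)`. -/
structure FitsAnsatz (P : Measure Env) (ξ θ : ℝ) (F : Env → ℤˣ → ℝ) (r : ℝ)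
    (μ : Measure (Env × ℤˣ)) : Prop where
  mem : μ ∈ velocitySet ξ
  stationaryPair : IsStationaryPair P μ
  classK : InClassK P F
  form : ∀ z : ℤˣ, component μ z = μ.fst.withDensity (fun ω =>
    ENNReal.ofReal (trans ω 0 z * Real.exp (θ * ((z : ℤ) : ℝ) + F ω z + r)))

/-! ### Passage times

The direction `s` is `1` for the passage time `t_1 = inf {k ≥ 0 : X_k ≥ 1}` and `-1` for
`t'_{-1} = inf {k ≥ 0 : X_k ≤ -1}`. -/

/-- The event that the passage time in the direction `s` is finite. -/
def passes (s : ℤˣ) : Set (ℕ → ℤ) := {X | ∃ k, 1 ≤ (s : ℤ) * X k}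

/-- The passage time in the direction `s`, on the event `passes s`. -/
def passageTime (s : ℤˣ) (X : ℕ → ℤ) : ℕ := sInf {k | 1 ≤ (s : ℤ) * X k}

/-- `ζ(r, ω) = E_0^ω [exp (r t), t < ∞]` for the passage time `t` in the direction `s`. -/
def zeta (s : ℤˣ) (r : ℝ) (ω : Env) : ℝ≥0∞ :=
  ∫⁻ X in passes s, ENNReal.ofReal (Real.exp (r * passageTime s X)) ∂(quenchedLaw ω 0)

/-- `log ζ(r, ω)`, as a real number (used where `0 < ζ(r, ω) < ∞`). -/
def logZeta (s : ℤˣ) (r : ℝ) (ω : Env) : ℝ := Real.log (zeta s r ω).toReal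

/-- `λ(r) = 𝔼 [log ζ(r, ·)]`. -/
def lyap (P : Measure Env) (s : ℤˣ) (r : ℝ) : ℝ := ∫ ω, logZeta s r ω ∂P

/-- `F(ω, s) = λ(r) - log ζ(r, ω)` and `F(ω, -s) = log ζ(r, T_{-s} ω) - λ(r)`. -/
def corrector (P : Measure Env) (s : ℤˣ) (r : ℝ) (ω : Env) (z : ℤˣ) : ℝ :=
  if z = s then lyap P s r - logZeta s r ω
  else logZeta s r (shift (-(s : ℤ)) ω) - lyap P s r

/-- `r_c` is the critical exponent in the direction `s`: almost surely, `ζ(r, ω)` is finite for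
`r < r_c` and infinite for `r > r_c`. -/
structure IsCriticalExponent (P : Measure Env) (s : ℤˣ) (rc : ℝ) : Prop where
  finite_below : ∀ r < rc, ∀ᵐ ω ∂P, zeta s r ω < ∞
  infinite_above : ∀ r > rc, ∀ᵐ ω ∂P, zeta s r ω = ∞

end RWRE

end

/-! The proof is a Doob transform built from passage times. By the strong Markov property, `ζ =
ζ_s(r, ·)` satisfies the first-step equation `ζ = e^r (π(0,s) + π(0,-s) (ζ ∘ T_{-s}) ζ)`
(`zeta_eq`). Divided by `ζ`, it says that `π(0,s) e^{r - log ζ}` and `π(0,-s) e^{r + log ζ ∘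
T_{-s}}` are the transition probabilities of a new walk, the tilted walk (`tilt`). Up to centring by
`λ`, the exponents are the `θ z + F + r` of the Ansatz. That both probabilities are at most one
bounds `|log ζ|` by `|log π|` terms, which gives finiteness of `r_c`, integrability of `log ζ` and
the moment condition on `F`.

As a function of `r`, `log ζ` is a cumulant generating function. Its derivative `τ` (`meanPassage`)
is the mean passage time of the tilted walk, and `λ' = ∫ τ`. The first-step equation for `τ` yields
`τ > 1` and strict monotonicity in `r`. A linear lower bound on `λ` shows that `λ'` comes
arbitrarily close to `1`, so `λ'(r) = 1/|ξ|` is uniquely solvable.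

The environment seen from the tilted walk has an invariant density `φ` of flux one, obtained as a
Neumann series. This series is adjoint to the one that is dominated by `τ`, so `∫ φ` is finite, and
a coboundary argument gives `∫ φ = ∫ τ`. Normalizing by `|ξ|` produces a probability density with
velocity `ξ` (`exists_fitsAnsatz`).

For minimality, stationarity and ergodicity force every stationary pair measure to have a constant
flux, equal to its velocity up to sign (`IsStationaryPair.ae_flux_eq`). Hence the entropy relative
to `π` equals the entropy relative to the tilted walk plus `r - |ξ| λ(r)`, up to a coboundary of
mean zero (`IsStationaryPair.integral_entropy`). The tilted entropy is nonnegative and vanishes only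
at the tilted step probabilities. Two densities with these probabilities and the same flux differ by
a solution without flux, whose modulus is a coboundary; so they agree
(`ae_eq_zero_of_flux_eq_zero`).

For the rate function, let `V` be the potential of `log ζ`. Then `exp (r n - V(X_n))` has quenched
mean one, and the ergodic theorem gives `V(x) ≈ s x λ(r)`. This yields the upper bound on the
probability of velocities near `ξ` directly, and the lower bound after showing that the tilted path
measure concentrates at `ξ`, by comparison with nearby values of `r`. -/

noncomputable section

namespace RWRE

section

/-! ### Running maxima of Birkhoff sums -/

section BirkhoffMax

variable {Ω : Type*} {T : Ω → Ω}

/-- The running maximum `max_{k ≤ n} S_k` of the Birkhoff sums of `f`. -/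
def birkhoffMax (T : Ω → Ω) (f : Ω → ℝ) : ℕ → Ω → ℝ
  | 0, _ => 0
  | n + 1, ω => max 0 (f ω + birkhoffMax T f n (T ω))

lemma birkhoffMax_nonneg (f : Ω → ℝ) (n : ℕ) (ω : Ω) : 0 ≤ birkhoffMax T f n ω := by
  cases n with
  | zero => exact le_rfl
  | succ n => exact le_max_left _ _

lemma birkhoffMax_le_succ (f : Ω → ℝ) (n : ℕ) (ω : Ω) :
    birkhoffMax T f n ω ≤ birkhoffMax T f (n + 1) ω := by
  induction n generalizing ω with
  | zero => exact birkhoffMax_nonneg f 1 ω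
  | succ n ih => exact max_le_max_left _ (by linarith [ih (T ω)])

lemma birkhoffSum_le_birkhoffMax (f : Ω → ℝ) (n : ℕ) (ω : Ω) :
    birkhoffSum T f n ω ≤ birkhoffMax T f n ω := by
  induction n generalizing ω with
  | zero => simp [birkhoffMax]
  | succ n ih =>
    rw [birkhoffSum_succ']
    exact le_max_of_le_right (by linarith [ih (T ω)])

end BirkhoffMax

/-! ### Coboundaries and the pointwise ergodic theorem -/

section Ergodic

variable {Ω : Type*} [MeasurableSpace Ω] {μ : Measure Ω} {T : Ω → Ω}

lemma MeasurePreserving.integral_comp_of_aestronglyMeasurable (hT : MeasurePreserving T μ μ)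
    {f : Ω → ℝ} (hf : AEStronglyMeasurable f μ) : ∫ ω, f (T ω) ∂μ = ∫ ω, f ω ∂μ := by
  have h := integral_map (μ := μ) hT.aemeasurable (f := f) (by rwa [hT.map_eq])
  rw [hT.map_eq] at h
  exact h.symm

/-- A coboundary whose positive part is integrable is integrable and has mean zero. -/
lemma integrable_coboundary_of_posPart [IsFiniteMeasure μ] (hT : MeasurePreserving T μ μ) {u : Ω → ℝ}
    (hu : AEMeasurable u μ) (hpos : Integrable (fun ω => max (u (T ω) - u ω) 0) μ) :
    Integrable (fun ω => u (T ω) - u ω) μ ∧ ∫ ω, (u (T ω) - u ω) ∂μ = 0 := by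
  have huT : AEMeasurable (fun ω => u (T ω)) μ := hu.comp_quasiMeasurePreserving hT.quasiMeasurePreserving
  -- Since `u` need not be integrable, it is clamped to `[-M, M]`; the coboundary of the clamped
  -- function has mean zero. Clamping is 1-Lipschitz and monotone, so it enlarges neither the
  -- modulus nor the positive part of an increment.
  set v : ℕ → Ω → ℝ := fun M ω => max (-(M : ℝ)) (min (u ω) M) with hv
  have hvm : ∀ M, AEMeasurable (v M) μ := fun M =>
    aemeasurable_const.max (hu.min aemeasurable_const)
  have hvb : ∀ M ω, |v M ω| ≤ M := by
    intro M ω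
    have : (0 : ℝ) ≤ M := Nat.cast_nonneg M
    rw [abs_le]
    exact ⟨le_max_left _ _, max_le (by linarith) (min_le_right _ _)⟩
  have hvi : ∀ M, Integrable (v M) μ := fun M =>
    Integrable.of_bound (hvm M).aestronglyMeasurable M (ae_of_all _ fun ω => hvb M ω)
  have hvTi : ∀ M, Integrable (fun ω => v M (T ω)) μ := fun M =>
    hT.integrable_comp_of_integrable (hvi M)
  have hzero : ∀ M, ∫ ω, (v M (T ω) - v M ω) ∂μ = 0 := by
    intro M
    rw [integral_sub (hvTi M) (hvi M),
      MeasurePreserving.integral_comp_of_aestronglyMeasurable hT (hvm M).aestronglyMeasurable,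
      sub_self]
  have hclamp : ∀ (M : ℕ) (a b : ℝ), |max (-(M : ℝ)) (min a M) - max (-(M : ℝ)) (min b M)| ≤ |a - b| := by
    intro M a b
    refine (abs_max_sub_max_le_max _ _ _ _).trans ?_
    simp only [sub_self, abs_zero]
    refine max_le (abs_nonneg _) ((abs_min_sub_min_le_max _ _ _ _).trans ?_)
    simp
  have hclamp' : ∀ (M : ℕ) (a b : ℝ),
      max (max (-(M : ℝ)) (min a M) - max (-(M : ℝ)) (min b M)) 0 ≤ max (a - b) 0 := by
    intro M a b
    rcases le_total b a with h | h
    · exact max_le_max_right 0 ((le_abs_self _).trans ((hclamp M a b).trans (abs_of_nonneg (sub_nonneg.2 h)).le))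
    · have : max (-(M : ℝ)) (min a M) ≤ max (-(M : ℝ)) (min b M) :=
        max_le_max_left _ (min_le_min_right _ h)
      rw [max_eq_right (by linarith)]
      exact le_max_right _ _
  have hlim : ∀ ω, Tendsto (fun M : ℕ => v M ω) atTop (𝓝 (u ω)) := by
    intro ω
    refine tendsto_const_nhds.congr' ?_
    filter_upwards [eventually_ge_atTop ⌈|u ω|⌉₊] with M hM
    have h1 : |u ω| ≤ M := (Nat.le_ceil _).trans (by exact_mod_cast hM)
    rw [abs_le] at h1
    simp only [hv]
    rw [min_eq_left h1.2, max_eq_right h1.1]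
  have hdm : AEStronglyMeasurable (fun ω => u (T ω) - u ω) μ := (huT.sub hu).aestronglyMeasurable
  have hlimd : ∀ ω, Tendsto (fun M : ℕ => v M (T ω) - v M ω) atTop (𝓝 (u (T ω) - u ω)) :=
    fun ω => (hlim _).sub (hlim _)
  have hL1 : ∀ M, ∫⁻ ω, ‖v M (T ω) - v M ω‖ₑ ∂μ ≤
      ENNReal.ofReal (2 * ∫ ω, max (u (T ω) - u ω) 0 ∂μ) := by
    intro M
    have hi : Integrable (fun ω => v M (T ω) - v M ω) μ := (hvTi M).sub (hvi M)
    rw [← ofReal_integral_norm_eq_lintegral_enorm hi]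
    refine ENNReal.ofReal_le_ofReal ?_
    have hp : Integrable (fun ω => max (v M (T ω) - v M ω) 0) μ := hi.pos_part
    -- As `|x| = 2 max x 0 - x` and the mean vanishes, the positive part alone bounds the `L¹` norm,
    -- uniformly in `M`. Fatou's lemma then gives integrability of the coboundary of `u`.
    have : ∫ ω, ‖v M (T ω) - v M ω‖ ∂μ
        = 2 * ∫ ω, max (v M (T ω) - v M ω) 0 ∂μ - ∫ ω, (v M (T ω) - v M ω) ∂μ := by
      rw [← integral_const_mul, ← integral_sub (hp.const_mul 2) hi]
      congr 1; funext ω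
      rw [Real.norm_eq_abs]
      rcases le_total 0 (v M (T ω) - v M ω) with h | h
      · rw [abs_of_nonneg h, max_eq_left h]; ring
      · rw [abs_of_nonpos h, max_eq_right h]; ring
    rw [this, hzero, sub_zero]
    have := integral_mono hp hpos (fun ω => hclamp' M (u (T ω)) (u ω))
    linarith
  have hint : Integrable (fun ω => u (T ω) - u ω) μ := by
    refine ⟨hdm, ?_⟩
    have hF : ∫⁻ ω, ‖u (T ω) - u ω‖ₑ ∂μ ≤
        liminf (fun M => ∫⁻ ω, ‖v M (T ω) - v M ω‖ₑ ∂μ) atTop := by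
      rw [lintegral_congr fun ω => ((hlimd ω).enorm.liminf_eq).symm]
      exact lintegral_liminf_le' fun M =>
        ((hvTi M).sub (hvi M)).aestronglyMeasurable.aemeasurable.enorm
    refine (hF.trans ?_).trans_lt (ENNReal.ofReal_lt_top (r := 2 * ∫ ω, max (u (T ω) - u ω) 0 ∂μ))
    exact (liminf_le_liminf (Eventually.of_forall hL1)).trans_eq (by simp)
  refine ⟨hint, ?_⟩
  have := tendsto_integral_of_dominated_convergence (F := fun M ω => v M (T ω) - v M ω)
    (fun ω => |u (T ω) - u ω|)
    (fun M => ((hvTi M).sub (hvi M)).aestronglyMeasurable) hint.abs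
    (fun M => ae_of_all _ fun ω => hclamp M (u (T ω)) (u ω)) (ae_of_all _ hlimd)
  simp only [hzero] at this
  exact (tendsto_nhds_unique this tendsto_const_nhds)

lemma integral_coboundary_eq_zero [IsFiniteMeasure μ] (hT : MeasurePreserving T μ μ) {u : Ω → ℝ}
    (hu : AEMeasurable u μ) (hi : Integrable (fun ω => u (T ω) - u ω) μ) :
    ∫ ω, (u (T ω) - u ω) ∂μ = 0 :=
  (integrable_coboundary_of_posPart hT hu hi.pos_part).2

lemma integrable_birkhoffMax (hT : MeasurePreserving T μ μ) {f : Ω → ℝ} (hf : Integrable f μ)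
    (n : ℕ) : Integrable (birkhoffMax T f n) μ := by
  induction n with
  | zero => exact integrable_zero _ _ _
  | succ n ih =>
    have h : Integrable (fun ω => f ω + birkhoffMax T f n (T ω)) μ :=
      hf.add (hT.integrable_comp_of_integrable ih)
    exact h.pos_part.congr (ae_of_all _ fun ω => max_comm _ _)

lemma measurable_birkhoffMax (hT : Measurable T) {f : Ω → ℝ} (hf : Measurable f)
    (n : ℕ) : Measurable (birkhoffMax T f n) := by
  induction n with
  | zero => exact measurable_const
  | succ n ih => exact measurable_const.max (hf.add (ih.comp hT))

/-- Boundedness of the maxima `M_n` is an invariant event, so it has probability zero or one. If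
`M_n → ∞` almost surely, then `M_{n+1} - M_n ∘ T = max (-M_n ∘ T) f` tends to `f`, dominated by
`|f|`. Its integral is `∫ (M_{n+1} - M_n) ≥ 0`, which contradicts the negative mean of `f`. -/
lemma ae_bddAbove_birkhoffMax [IsProbabilityMeasure μ] (hT : Ergodic T μ) {f : Ω → ℝ} (hfm : Measurable f)
    (hf : Integrable f μ) (hneg : ∫ ω, f ω ∂μ < 0) :
    ∀ᵐ ω ∂μ, BddAbove (range fun n => birkhoffMax T f n ω) := by
  set A : Set Ω := {ω | BddAbove (range fun n => birkhoffMax T f n ω)} with hA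
  have hAm : MeasurableSet A := measurableSet_bddAbove_range
    (fun n => measurable_birkhoffMax hT.measurable hfm n)
  have hinv : T ⁻¹' A = A := by
    ext ω
    simp only [hA, mem_preimage, mem_ofPred_eq]
    constructor
    · rintro ⟨C, hC⟩
      refine ⟨max 0 (f ω + C), ?_⟩
      rintro _ ⟨n, rfl⟩
      cases n with
      | zero => exact le_max_left _ _
      | succ n => exact max_le_max_left _ (by linarith [hC ⟨n, rfl⟩])
    · rintro ⟨C, hC⟩
      refine ⟨C - f ω, ?_⟩
      rintro _ ⟨n, rfl⟩
      have h := hC ⟨n + 1, rfl⟩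
      have h2 : f ω + birkhoffMax T f n (T ω) ≤ birkhoffMax T f (n + 1) ω := le_max_right _ _
      simp only at h ⊢
      linarith
  rcases hT.toPreErgodic.ae_mem_or_ae_notMem hAm hinv with h | h
  · exact h
  exfalso
  have hlim : Tendsto (fun n => ∫ ω, (birkhoffMax T f (n + 1) ω - birkhoffMax T f n (T ω)) ∂μ)
      atTop (𝓝 (∫ ω, f ω ∂μ)) := by
    refine tendsto_integral_of_dominated_convergence (fun ω => |f ω|)
      (fun n => ((integrable_birkhoffMax hT.toMeasurePreserving hf _).sub
        (hT.toMeasurePreserving.integrable_comp_of_integrable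
          (integrable_birkhoffMax hT.toMeasurePreserving hf n))).aestronglyMeasurable)
      hf.abs (fun n => ae_of_all _ fun ω => ?_) ?_
    · have h0 := birkhoffMax_nonneg (T := T) f n (T ω)
      simp only [birkhoffMax, Real.norm_eq_abs]
      rcases le_total 0 (f ω + birkhoffMax T f n (T ω)) with h1 | h1
      · rw [max_eq_right h1]; simp
      · rw [max_eq_left h1, abs_of_nonpos (by linarith), abs_of_nonpos (by linarith)]; linarith
    · filter_upwards [hT.quasiMeasurePreserving.tendsto_ae.eventually h] with ω hω
      refine tendsto_const_nhds.congr' ?_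
      have : ∃ n, - f ω < birkhoffMax T f n (T ω) := by
        by_contra! hc
        exact hω ⟨-f ω, by rintro _ ⟨n, rfl⟩; exact hc n⟩
      obtain ⟨n, hn⟩ := this
      filter_upwards [eventually_ge_atTop n] with m hm
      have := monotone_nat_of_le_succ (fun k => birkhoffMax_le_succ (T := T) f k (T ω)) hm
      simp only [birkhoffMax]
      rw [max_eq_right (by linarith)]
      ring
  have hge : ∀ n, 0 ≤ ∫ ω, (birkhoffMax T f (n + 1) ω - birkhoffMax T f n (T ω)) ∂μ := by
    intro n
    have hi := integrable_birkhoffMax hT.toMeasurePreserving hf (T := T)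
    have hiT : Integrable (fun ω => birkhoffMax T f n (T ω)) μ :=
      hT.toMeasurePreserving.integrable_comp_of_integrable (hi n)
    rw [integral_sub (hi _) hiT,
      MeasurePreserving.integral_comp_of_aestronglyMeasurable hT.toMeasurePreserving
        (hi n).aestronglyMeasurable]
    exact sub_nonneg.2 (integral_mono (hi n) (hi (n + 1)) (fun ω => birkhoffMax_le_succ f n ω))
  linarith [ge_of_tendsto' hlim hge]

/-- The maxima of `f - c` are bounded for each constant `c` above the mean; countably many such `c`
suffice for all `ε`. -/
lemma ae_birkhoffSum_le [IsProbabilityMeasure μ] (hT : Ergodic T μ) {f : Ω → ℝ} (hfm : Measurable f)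
    (hf : Integrable f μ) :
    ∀ᵐ ω ∂μ, ∀ ε > 0, ∃ C, ∀ n : ℕ, birkhoffSum T f n ω ≤ n * (∫ x, f x ∂μ + ε) + C := by
  have key : ∀ k : ℕ, ∀ᵐ ω ∂μ, ∃ C, ∀ n : ℕ,
      birkhoffSum T f n ω ≤ n * (∫ x, f x ∂μ + 1 / ((k : ℝ) + 1)) + C := by
    intro k
    set c : ℝ := ∫ x, f x ∂μ + 1 / ((k : ℝ) + 1) with hc
    have hcpos : (0 : ℝ) < 1 / ((k : ℝ) + 1) := by positivity
    have hneg : ∫ ω, (f ω - c) ∂μ < 0 := by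
      rw [integral_sub hf (integrable_const _)]; simp only [integral_const, probReal_univ, one_smul]
      linarith
    filter_upwards [ae_bddAbove_birkhoffMax hT (f := fun ω => f ω - c) (hfm.sub_const c)
      (hf.sub (integrable_const c)) hneg] with ω hω
    obtain ⟨C, hC⟩ := hω
    refine ⟨C, fun n => ?_⟩
    have h1 := (birkhoffSum_le_birkhoffMax (T := T) (fun ω => f ω - c) n ω).trans (hC ⟨n, rfl⟩)
    have h2 : birkhoffSum T (fun ω => f ω - c) n ω = birkhoffSum T f n ω - n * c := by
      simp [birkhoffSum, Finset.sum_sub_distrib]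
    linarith
  filter_upwards [ae_all_iff.2 key] with ω hω ε hε
  obtain ⟨k, hk⟩ := exists_nat_one_div_lt hε
  obtain ⟨C, hC⟩ := hω k
  refine ⟨C, fun n => (hC n).trans ?_⟩
  gcongr

/-- The pointwise ergodic theorem. -/
lemma ae_abs_birkhoffSum_sub_le [IsProbabilityMeasure μ] (hT : Ergodic T μ) {f : Ω → ℝ} (hfm : Measurable f)
    (hf : Integrable f μ) :
    ∀ᵐ ω ∂μ, ∀ ε > 0, ∃ C, ∀ n : ℕ,
      |birkhoffSum T f n ω - n * ∫ x, f x ∂μ| ≤ n * ε + C := by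
  filter_upwards [ae_birkhoffSum_le hT hfm hf, ae_birkhoffSum_le hT hfm.neg hf.neg] with ω h1 h2 ε hε
  obtain ⟨C, hC⟩ := h1 ε hε
  obtain ⟨D, hD⟩ := h2 ε hε
  refine ⟨max C D, fun n => ?_⟩
  have h3 := hC n
  have h4 := hD n
  have h5 : birkhoffSum T (-f) n ω = - birkhoffSum T f n ω := by simp [birkhoffSum]
  have h6 : ∫ x, (-f) x ∂μ = - ∫ x, f x ∂μ := integral_neg f
  rw [h5, h6] at h4
  rw [abs_le]
  constructor <;> nlinarith [le_max_left C D, le_max_right C D]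

end Ergodic

end

section

/-! ### The quenched law -/

instance quenchedLaw_isProbabilityMeasure (ω : Env) (x : ℤ) :
    IsProbabilityMeasure (quenchedLaw ω x) := by
  unfold quenchedLaw; infer_instance

lemma sum_units (s : ℤˣ) {M : Type*} [AddCommMonoid M] (f : ℤˣ → M) : ∑ z, f z = f s + f (-s) := by
  have : (Finset.univ : Finset ℤˣ) = {s, -s} := by
    rcases Int.units_eq_one_or s with rfl | rfl <;> decide
  rw [this, Finset.sum_pair]
  rcases Int.units_eq_one_or s with rfl | rfl <;> decide

lemma trans_nonneg (ω : Env) (x : ℤ) (z : ℤˣ) : 0 ≤ trans ω x z := (ω x).2.1 z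

lemma trans_add_trans_neg (ω : Env) (x : ℤ) (s : ℤˣ) : trans ω x s + trans ω x (-s) = 1 := by
  have := (ω x).2.2
  rwa [sum_units s] at this

lemma sum_ofReal_trans (ω : Env) (x : ℤ) : ∑ z, ENNReal.ofReal (trans ω x z) = 1 := by
  rw [sum_units 1, ← ENNReal.ofReal_add (trans_nonneg _ _ _) (trans_nonneg _ _ _),
    trans_add_trans_neg, ENNReal.ofReal_one]

lemma lintegral_stepLaw (ω : Env) (x : ℤ) (h : ℤ → ℝ≥0∞) :
    ∫⁻ y, h y ∂(stepLaw ω x) = ∑ z : ℤˣ, ENNReal.ofReal (trans ω x z) * h (x + z) := by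
  simp [stepLaw]

/-- The Markov property at one step. -/
lemma lintegral_quenchedLaw_mul_succ (ω : Env) (x : ℤ) (n : ℕ)
    (g : ((i : Finset.Iic n) → ℤ) → ℝ≥0∞) (h : ℤ → ℝ≥0∞) :
    ∫⁻ X, g (Preorder.frestrictLe n X) * h (X (n + 1)) ∂(quenchedLaw ω x) =
      ∫⁻ X, g (Preorder.frestrictLe n X) *
        ∑ z : ℤˣ, ENNReal.ofReal (trans ω (X n) z) * h (X n + z) ∂(quenchedLaw ω x) := by
  have hg : Measurable g := Measurable.of_discrete
  have hh : Measurable h := Measurable.of_discrete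
  have hm1 : Measurable (fun X : ℕ → ℤ => (Preorder.frestrictLe (π := fun _ => ℤ) n X, X (n + 1))) :=
    (Preorder.measurable_frestrictLe n).prodMk (measurable_pi_apply _)
  -- By the Ionescu-Tulcea construction, the joint law of the history up to `n` and of `X_{n+1}` is
  -- the composition-product of the law of the history with the history kernel.
  have e1 := Kernel.partialTraj_compProd_eq_map_traj (κ := historyKernel ω) (Nat.zero_le n)
    (x₀ := fun _ : Finset.Iic 0 => (x : ℤ)) (X := fun _ => ℤ)
  have e2 := Kernel.traj_map_frestrictLe_apply (κ := historyKernel ω) 0 n (X := fun _ => ℤ) (fun _ => (x : ℤ))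
  have lhs : ∫⁻ X, g (Preorder.frestrictLe n X) * h (X (n + 1)) ∂(quenchedLaw ω x) =
      ∫⁻ p, g p.1 * h p.2 ∂((quenchedLaw ω x).map
        (fun X => (Preorder.frestrictLe (π := fun _ => ℤ) n X, X (n + 1)))) := by
    rw [lintegral_map (by fun_prop) hm1]
  rw [lhs]
  unfold quenchedLaw
  rw [← e1, Measure.lintegral_compProd (by fun_prop), ← e2,
    lintegral_map (Measurable.of_discrete) (Preorder.measurable_frestrictLe n)]
  refine lintegral_congr fun X => ?_
  dsimp only
  rw [lintegral_const_mul _ hh]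
  congr 1
  exact lintegral_stepLaw ω (X n) h

lemma lintegral_quenchedLaw_succ (ω : Env) (x : ℤ) (n : ℕ) (h : ℤ → ℝ≥0∞) :
    ∫⁻ X, h (X (n + 1)) ∂(quenchedLaw ω x) =
      ∫⁻ X, ∑ z : ℤˣ, ENNReal.ofReal (trans ω (X n) z) * h (X n + z) ∂(quenchedLaw ω x) := by
  simpa using lintegral_quenchedLaw_mul_succ ω x n (fun _ => 1) h

lemma ae_quenchedLaw_zero (ω : Env) (x : ℤ) : ∀ᵐ X ∂(quenchedLaw ω x), X 0 = x := by
  have e2 := Kernel.traj_map_frestrictLe_apply (κ := historyKernel ω) 0 0 (X := fun _ => ℤ) (fun _ => (x : ℤ))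
  rw [Kernel.partialTraj_self, Kernel.id_apply] at e2
  have h : ∀ᵐ y ∂((quenchedLaw ω x).map (Preorder.frestrictLe (π := fun _ => ℤ) 0)),
      y ⟨0, Finset.mem_Iic.2 le_rfl⟩ = x := by
    unfold quenchedLaw
    rw [e2, ae_dirac_iff (measurableSet_eq_fun (by fun_prop) (by fun_prop))]
  exact ae_of_ae_map (Preorder.measurable_frestrictLe 0).aemeasurable h

lemma lintegral_quenchedLaw_zero (ω : Env) (x : ℤ) (h : ℤ → ℝ≥0∞) :
    ∫⁻ X, h (X 0) ∂(quenchedLaw ω x) = h x := by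
  rw [lintegral_congr_ae ((ae_quenchedLaw_zero ω x).mono fun X hX => by rw [hX])]
  simp

lemma ae_quenchedLaw_abs_le (ω : Env) (n : ℕ) : ∀ᵐ X ∂(quenchedLaw ω 0), |X n| ≤ (n : ℤ) := by
  -- The event `|X n| > n` is encoded by its indicator, whose integral the one-step Markov property
  -- propagates from `n` to `n + 1`.
  have key : ∀ n : ℕ, ∫⁻ X, (if |X n| ≤ (n : ℤ) then 0 else 1 : ℝ≥0∞) ∂(quenchedLaw ω 0) = 0 := by
    intro n
    induction n with
    | zero =>
      have := lintegral_quenchedLaw_zero ω 0 (fun y => if |y| ≤ ((0 : ℕ) : ℤ) then 0 else 1)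
      simpa using this
    | succ n ih =>
      have := lintegral_quenchedLaw_succ ω 0 n (fun y => if |y| ≤ ((n + 1 : ℕ) : ℤ) then 0 else 1)
      rw [this]
      refine le_antisymm (le_trans (lintegral_mono fun X => ?_) ih.le) (zero_le)
      split_ifs with hX
      · refine (Finset.sum_eq_zero fun z _ => ?_).le
        have h1 : |X n + (z : ℤ)| ≤ ((n + 1 : ℕ) : ℤ) := by
          refine (abs_add_le _ _).trans ?_
          rcases Int.units_eq_one_or z with rfl | rfl <;> simp <;> omega
        simp only [if_pos h1, mul_zero]
      · calc _ ≤ ∑ z, ENNReal.ofReal (trans ω (X n) z) := by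
              refine Finset.sum_le_sum fun z _ => ?_
              split_ifs <;> simp
          _ = 1 := sum_ofReal_trans _ _
  have h := key n
  have hm : Measurable fun X : ℕ → ℤ => if |X n| ≤ (n : ℤ) then (0 : ℝ≥0∞) else 1 :=
    Measurable.comp (g := fun y : ℤ => if |y| ≤ (n : ℤ) then (0 : ℝ≥0∞) else 1)
      Measurable.of_discrete (measurable_pi_apply n)
  rw [lintegral_eq_zero_iff hm] at h
  filter_upwards [h] with X hX
  by_contra hc
  simp [hc] at hX

/-! ### Truncated passage functionals -/

/-- `E_x [exp (r t_b), t_b ≤ N]` for the passage time `t_b = inf {k : s X_k ≥ b}`, computed by the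
first-step recursion. -/
def truncPassage (s : ℤˣ) (r : ℝ) (ω : Env) : ℕ → ℤ → ℤ → ℝ≥0∞
  | 0, b, x => if b ≤ (s : ℤ) * x then 1 else 0
  | N + 1, b, x => if b ≤ (s : ℤ) * x then 1 else
      ENNReal.ofReal (Real.exp r) *
        ∑ z : ℤˣ, ENNReal.ofReal (trans ω x z) * truncPassage s r ω N b (x + z)

variable {s : ℤˣ} {r : ℝ} {ω : Env}

lemma units_mul_self (s : ℤˣ) : (s : ℤ) * (s : ℤ) = 1 := by
  rcases Int.units_eq_one_or s with rfl | rfl <;> rfl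

lemma truncPassage_of_le {b x : ℤ} (h : b ≤ (s : ℤ) * x) (N : ℕ) :
    truncPassage s r ω N b x = 1 := by
  cases N <;> simp [truncPassage, h]

lemma truncPassage_zero_of_lt {b x : ℤ} (h : (s : ℤ) * x < b) :
    truncPassage s r ω 0 b x = 0 := by
  simp [truncPassage, not_le.2 h]

lemma truncPassage_succ_of_lt {b x : ℤ} (h : (s : ℤ) * x < b) (N : ℕ) :
    truncPassage s r ω (N + 1) b x = ENNReal.ofReal (Real.exp r) *
        ∑ z : ℤˣ, ENNReal.ofReal (trans ω x z) * truncPassage s r ω N b (x + z) := by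
  simp [truncPassage, not_le.2 h]

lemma truncPassage_mono : Monotone (fun N => truncPassage s r ω N) := by
  refine monotone_nat_of_le_succ fun N => ?_
  induction N with
  | zero =>
    intro b x
    rcases le_or_gt b ((s : ℤ) * x) with h | h
    · rw [truncPassage_of_le h, truncPassage_of_le h]
    · rw [truncPassage_zero_of_lt h]; exact zero_le
  | succ N ih =>
    intro b x
    rcases le_or_gt b ((s : ℤ) * x) with h | h
    · rw [truncPassage_of_le h, truncPassage_of_le h]
    · rw [truncPassage_succ_of_lt h, truncPassage_succ_of_lt h]
      gcongr with z
      exact ih b (x + z)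

lemma truncPassage_shift (y : ℤ) (N : ℕ) (b x : ℤ) :
    truncPassage s r (shift y ω) N b x = truncPassage s r ω N (b + s * y) (x + y) := by
  induction N generalizing x with
  | zero => simp [truncPassage, mul_add]
  | succ N ih =>
    simp only [truncPassage, mul_add, add_le_add_iff_right, ih]
    congr 3
    funext z
    rw [add_right_comm]; rfl

/-- Passing `b + 1` from `x` with `s x ≤ b` goes through the point `s b`. -/
lemma truncPassage_le_mul (b : ℤ) (N : ℕ) {x : ℤ} (hx : (s : ℤ) * x ≤ b) :
    truncPassage s r ω N (b + 1) x ≤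
      truncPassage s r ω N b x * truncPassage s r ω N (b + 1) (s * b) := by
  induction N generalizing x with
  | zero => rw [truncPassage_zero_of_lt (by omega)]; exact zero_le
  | succ N ih =>
    rcases hx.eq_or_lt with h | h
    · have : x = s * b := by rw [← h, ← mul_assoc, units_mul_self, one_mul]
      rw [truncPassage_of_le h.ge, one_mul, this]
    · rw [truncPassage_succ_of_lt (by omega), truncPassage_succ_of_lt h, mul_assoc, Finset.sum_mul]
      refine mul_le_mul_right (Finset.sum_le_sum fun z _ => ?_) _
      rw [mul_assoc]
      refine mul_le_mul_right ?_ _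
      have hz : (s : ℤ) * (x + z) ≤ b := by
        rcases Int.units_eq_one_or s with rfl | rfl <;>
        rcases Int.units_eq_one_or z with rfl | rfl <;> simp at h ⊢ <;> omega
      refine (ih hz).trans ?_
      gcongr
      exact truncPassage_mono (Nat.le_succ N) _ _

/-- The converse of `truncPassage_le_mul`: a budget of `M` steps to reach level `b` and `N` more to
reach `b + 1` fit into `M + N` steps. In the limit the two inequalities give the strong Markov
property at the passage of `b`. -/
lemma mul_truncPassage_le (b : ℤ) (M N : ℕ) {x : ℤ} (hx : (s : ℤ) * x ≤ b) :
    truncPassage s r ω M b x * truncPassage s r ω N (b + 1) (s * b) ≤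
      truncPassage s r ω (M + N) (b + 1) x := by
  induction M generalizing x with
  | zero =>
    rcases hx.eq_or_lt with h | h
    · have : x = s * b := by rw [← h, ← mul_assoc, units_mul_self, one_mul]
      rw [truncPassage_of_le h.ge, one_mul, this, Nat.zero_add]
    · rw [truncPassage_zero_of_lt h, zero_mul]; exact zero_le
  | succ M ih =>
    rcases hx.eq_or_lt with h | h
    · have : x = s * b := by rw [← h, ← mul_assoc, units_mul_self, one_mul]
      rw [truncPassage_of_le h.ge, one_mul, this]
      exact truncPassage_mono (by omega) _ _
    · rw [Nat.add_right_comm, truncPassage_succ_of_lt (b := b + 1) (by omega),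
        truncPassage_succ_of_lt h, mul_assoc, Finset.sum_mul]
      refine mul_le_mul_right (Finset.sum_le_sum fun z _ => ?_) _
      rw [mul_assoc]
      refine mul_le_mul_right ?_ _
      refine ih ?_
      rcases Int.units_eq_one_or s with rfl | rfl <;>
      rcases Int.units_eq_one_or z with rfl | rfl <;> simp at h ⊢ <;> omega

/-! ### Identification of `ζ` -/

/-- The event that the passage time in the direction `s` equals `n`. -/
def passesAt (s : ℤˣ) (n : ℕ) : Set (ℕ → ℤ) :=
  {X | (∀ k < n, (s : ℤ) * X k < 1) ∧ 1 ≤ (s : ℤ) * X n}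

lemma measurableSet_passesAt (s : ℤˣ) (n : ℕ) : MeasurableSet (passesAt s n) := by
  have : passesAt s n = (⋂ k ∈ Finset.range n, (fun X : ℕ → ℤ => X k) ⁻¹' {y | (s : ℤ) * y < 1}) ∩
      (fun X : ℕ → ℤ => X n) ⁻¹' {y | 1 ≤ (s : ℤ) * y} := by
    ext X; simp [passesAt]
  rw [this]
  exact (Finset.measurableSet_biInter _ fun k _ => measurable_pi_apply k (.of_discrete)).inter
    (measurable_pi_apply n (.of_discrete))

lemma passageTime_of_mem {n : ℕ} {X : ℕ → ℤ} (h : X ∈ passesAt s n) : passageTime s X = n := by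
  refine le_antisymm (Nat.sInf_le h.2) (le_csInf ⟨n, h.2⟩ fun k hk => ?_)
  by_contra! hlt
  have := h.1 k hlt
  have hk' : 1 ≤ (s : ℤ) * X k := hk
  omega

lemma passes_eq_iUnion (s : ℤˣ) : passes s = ⋃ n, passesAt s n := by
  ext X
  simp only [passes, passesAt, mem_ofPred_eq, mem_iUnion]
  constructor
  · intro h
    classical
    refine ⟨Nat.find h, fun k hk => ?_, Nat.find_spec h⟩
    have := Nat.find_min h hk
    omega
  · rintro ⟨n, hn⟩
    exact ⟨n, hn.2⟩

lemma measurableSet_passes (s : ℤˣ) : MeasurableSet (passes s) := by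
  rw [passes_eq_iUnion]; exact MeasurableSet.iUnion fun n => measurableSet_passesAt s n

lemma pairwise_disjoint_passesAt (s : ℤˣ) : Pairwise (Function.onFun Disjoint (passesAt s)) := by
  intro m n hmn
  refine Set.disjoint_left.2 fun X hm hn => hmn ?_
  rw [← passageTime_of_mem hm, passageTime_of_mem hn]

lemma zeta_eq_tsum (s : ℤˣ) (r : ℝ) (ω : Env) :
    zeta s r ω = ∑' n : ℕ, ENNReal.ofReal (Real.exp (r * n)) * quenchedLaw ω 0 (passesAt s n) := by
  unfold zeta
  rw [passes_eq_iUnion, lintegral_iUnion (measurableSet_passesAt s) (pairwise_disjoint_passesAt s)]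
  congr 1; funext n
  rw [setLIntegral_congr_fun (g := fun _ => ENNReal.ofReal (Real.exp (r * n)))
    (measurableSet_passesAt s n) (fun X hX => by simp only [passageTime_of_mem hX]),
    setLIntegral_const]

/-- The indicator of the paths that do not pass before the time `n`. -/
def notBefore (s : ℤˣ) (n : ℕ) (X : ℕ → ℤ) : ℝ≥0∞ :=
  ∏ k ∈ Finset.range n, if (s : ℤ) * X k < 1 then 1 else 0

lemma notBefore_mul_passesAt (s : ℤˣ) (n : ℕ) (X : ℕ → ℤ) :
    notBefore s n X * (if 1 ≤ (s : ℤ) * X n then 1 else 0) =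
      (passesAt s n).indicator (fun _ => 1) X := by
  by_cases h : ∀ k < n, (s : ℤ) * X k < 1
  · have : notBefore s n X = 1 := Finset.prod_eq_one fun k hk => if_pos (h k (Finset.mem_range.1 hk))
    rw [this, one_mul]
    by_cases h2 : 1 ≤ (s : ℤ) * X n
    · rw [if_pos h2, indicator_of_mem (show X ∈ passesAt s n from ⟨h, h2⟩)]
    · rw [if_neg h2, indicator_of_notMem (fun hX => h2 hX.2)]
  · rw [indicator_of_notMem (fun hX => h hX.1)]
    push Not at h
    obtain ⟨k, hk, hk2⟩ := h
    have : notBefore s n X = 0 :=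
      Finset.prod_eq_zero (Finset.mem_range.2 hk) (if_neg (by omega))
    rw [this, zero_mul]

/-- A path that has not passed before `n` either passes at `n` and contributes the first term, or
takes one more step at the cost `e^r`. In the second case the Markov property turns the sum over
steps into a function of `X_{n+1}`. -/
lemma lintegral_notBefore_succ (s : ℤˣ) (r : ℝ) (ω : Env) (n N : ℕ) :
    ∫⁻ X, notBefore s n X * truncPassage s r ω (N + 1) 1 (X n) ∂(quenchedLaw ω 0) =
      quenchedLaw ω 0 (passesAt s n) + ENNReal.ofReal (Real.exp r) *
        ∫⁻ X, notBefore s (n + 1) X * truncPassage s r ω N 1 (X (n + 1)) ∂(quenchedLaw ω 0) := by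
  have hM := lintegral_quenchedLaw_mul_succ ω 0 n
    (fun y => ∏ k : Finset.Iic n, if (s : ℤ) * y k < 1 then 1 else 0) (truncPassage s r ω N 1)
  have hprod : ∀ X : ℕ → ℤ, (∏ k : Finset.Iic n,
      if (s : ℤ) * (Preorder.frestrictLe (π := fun _ => ℤ) n X) k < 1 then (1 : ℝ≥0∞) else 0)
        = notBefore s (n + 1) X := by
    intro X
    unfold notBefore
    rw [← Finset.prod_coe_sort (Finset.range (n + 1))]
    refine Fintype.prod_equiv (Equiv.subtypeEquivRight fun k => by simp) _ _ ?_
    intro k; rfl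
  simp only [hprod] at hM
  rw [hM]
  have hmeas : ∀ m, Measurable (notBefore s m) := fun m =>
    Finset.measurable_fun_prod _ fun k _ => (Measurable.of_discrete
      (f := fun y : ℤ => if (s : ℤ) * y < 1 then (1 : ℝ≥0∞) else 0)).comp (measurable_pi_apply k)
  have hf : ∀ f : ℤ → ℝ≥0∞, Measurable (fun X : ℕ → ℤ => f (X n)) := fun f =>
    (Measurable.of_discrete (f := f)).comp (measurable_pi_apply n)
  rw [← lintegral_indicator_one (measurableSet_passesAt s n),
    ← lintegral_const_mul (f := fun X => notBefore s (n + 1) X * ∑ z : ℤˣ,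
      ENNReal.ofReal (trans ω (X n) z) * truncPassage s r ω N 1 (X n + z)) _ ((hmeas _).mul
      (hf fun y => ∑ z : ℤˣ, ENNReal.ofReal (trans ω y z) * truncPassage s r ω N 1 (y + z))),
    ← lintegral_add_left (measurable_one.indicator (measurableSet_passesAt s n))]
  refine lintegral_congr fun X => ?_
  have h0 := notBefore_mul_passesAt s n X
  have h1 : notBefore s (n + 1) X = notBefore s n X * if (s : ℤ) * X n < 1 then 1 else 0 := by
    unfold notBefore; rw [Finset.prod_range_succ]
  change _ = (passesAt s n).indicator (fun _ => 1) X + _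
  rw [← h0, h1]
  rcases le_or_gt 1 ((s : ℤ) * X n) with h | h
  · rw [truncPassage_of_le h, if_pos h, if_neg (not_lt.2 h)]; simp
  · rw [truncPassage_succ_of_lt h, if_neg (not_le.2 h), if_pos h]; ring

/-- Each iteration of `lintegral_notBefore_succ` trades one unit of the time budget `N` for one
term. At `n = 0` this gives the partial sums of the series for `ζ`. -/
lemma lintegral_notBefore_eq_sum (s : ℤˣ) (r : ℝ) (ω : Env) (n N : ℕ) :
    ∫⁻ X, notBefore s n X * truncPassage s r ω N 1 (X n) ∂(quenchedLaw ω 0) =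
      ∑ k ∈ Finset.range (N + 1),
        ENNReal.ofReal (Real.exp (r * k)) * quenchedLaw ω 0 (passesAt s (n + k)) := by
  induction N generalizing n with
  | zero =>
    simp only [truncPassage, notBefore_mul_passesAt]
    have h := lintegral_indicator_one (μ := quenchedLaw ω 0) (measurableSet_passesAt s n)
    simp only [Pi.one_def] at h
    simpa using h
  | succ N ih =>
    rw [lintegral_notBefore_succ, ih, Finset.sum_range_succ' _ (N + 1), add_comm, Finset.mul_sum]
    congr 1
    · refine Finset.sum_congr rfl fun k _ => ?_
      rw [← mul_assoc, ← ENNReal.ofReal_mul (Real.exp_pos _).le, ← Real.exp_add]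
      rw [show n + 1 + k = n + (k + 1) by omega]
      congr 3
      push_cast; ring
    · simp

/-- This replaces the path integral by the first-step recursion; measurability in `ω`, covariance
under shifts and the product formula are then proved by induction on the recursion. -/
lemma zeta_eq_iSup (s : ℤˣ) (r : ℝ) (ω : Env) :
    zeta s r ω = ⨆ N, truncPassage s r ω N 1 0 := by
  have h : ∀ N, truncPassage s r ω N 1 0 = ∑ k ∈ Finset.range (N + 1),
      ENNReal.ofReal (Real.exp (r * k)) * quenchedLaw ω 0 (passesAt s k) := by
    intro N
    have := lintegral_notBefore_eq_sum s r ω 0 N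
    simp only [notBefore, Finset.range_zero, Finset.prod_empty, one_mul, zero_add] at this
    rw [← this, lintegral_quenchedLaw_zero ω 0 (truncPassage s r ω N 1)]
  rw [zeta_eq_tsum, ENNReal.tsum_eq_iSup_nat]
  simp only [h]
  refine le_antisymm (iSup_le fun N => le_iSup_of_le N ?_) (iSup_le fun N => le_iSup_of_le (N + 1) le_rfl)
  exact Finset.sum_le_sum_of_subset (Finset.range_subset_range.2 (Nat.le_succ N))

lemma zeta_shift (y : ℤ) : zeta s r (shift y ω) = ⨆ N, truncPassage s r ω N (1 + s * y) y := by
  simp [zeta_eq_iSup, truncPassage_shift]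

/-- The first-step decomposition of `ζ`. -/
lemma zeta_eq (s : ℤˣ) (r : ℝ) (ω : Env) :
    zeta s r ω = ENNReal.ofReal (Real.exp r) * (ENNReal.ofReal (trans ω 0 s) +
      ENNReal.ofReal (trans ω 0 (-s)) * (zeta s r (shift (-(s : ℤ)) ω) * zeta s r ω)) := by
  have hmono : ∀ b x, Monotone fun N => truncPassage s r ω N b x :=
    fun b x _ _ h => truncPassage_mono h b x
  -- Passing level `1` from `-s` means reaching `0` first and then passing from `0`.
  have hprod : zeta s r (shift (-(s : ℤ)) ω) * zeta s r ω =
      ⨆ N, truncPassage s r ω N 1 (-(s : ℤ)) := by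
    rw [zeta_shift, zeta_eq_iSup, mul_neg, units_mul_self]
    have h0 : (s : ℤ) * (-(s : ℤ)) ≤ 0 := by rw [mul_neg, units_mul_self]; norm_num
    refine le_antisymm ?_ ?_
    · rw [ENNReal.iSup_mul]
      refine iSup_le fun M => ?_
      rw [ENNReal.mul_iSup]
      refine iSup_le fun N => ?_
      have := mul_truncPassage_le (s := s) (r := r) (ω := ω) 0 M N h0
      simp only [zero_add, mul_zero] at this
      exact le_iSup_of_le (M + N) this
    · refine iSup_le fun N => ?_
      have := truncPassage_le_mul (s := s) (r := r) (ω := ω) 0 N h0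
      simp only [zero_add, mul_zero] at this
      exact this.trans (mul_le_mul' (le_iSup (fun N => truncPassage s r ω N _ _) N)
        (le_iSup (fun N => truncPassage s r ω N _ _) N))
  have hsucc : zeta s r ω = ⨆ N, truncPassage s r ω (N + 1) 1 0 := by
    rw [zeta_eq_iSup]
    exact ((hmono 1 0).iSup_nat_add 1).symm
  rw [hprod, ENNReal.mul_iSup, ENNReal.add_iSup, ENNReal.mul_iSup, hsucc]
  congr 1; funext N
  rw [truncPassage_succ_of_lt (by simp), sum_units s, truncPassage_of_le (by simp)]
  simp

lemma measurable_trans (x : ℤ) (z : ℤˣ) : Measurable (fun ω : Env => trans ω x z) := by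
  unfold trans
  exact (measurable_pi_apply z).comp (measurable_subtype_coe.comp (measurable_pi_apply x))

lemma measurable_truncPassage (s : ℤˣ) (r : ℝ) (N : ℕ) (b x : ℤ) :
    Measurable (fun ω => truncPassage s r ω N b x) := by
  induction N generalizing x with
  | zero => exact measurable_const
  | succ N ih =>
    simp only [truncPassage]
    split_ifs
    · exact measurable_const
    · exact measurable_const.mul (Finset.measurable_fun_sum _ fun z _ =>
        (measurable_trans x z).ennreal_ofReal.mul (ih _))

lemma measurable_zeta (s : ℤˣ) (r : ℝ) : Measurable (zeta s r) := by
  have : zeta s r = fun ω => ⨆ N, truncPassage s r ω N 1 0 := funext fun ω => zeta_eq_iSup s r ω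
  rw [this]
  exact Measurable.iSup fun N => measurable_truncPassage s r N 1 0

lemma measurable_logZeta (s : ℤˣ) (r : ℝ) : Measurable (logZeta s r) :=
  Real.measurable_log.comp (measurable_zeta s r).ennreal_toReal

lemma zeta_mono (s : ℤˣ) (ω : Env) : Monotone (fun r => zeta s r ω) := by
  intro r r' h
  refine lintegral_mono fun X => ENNReal.ofReal_le_ofReal (Real.exp_le_exp.2 ?_)
  gcongr

lemma measurable_shift (y : ℤ) : Measurable (shift y) :=
  measurable_pi_lambda _ fun x => measurable_pi_apply (x + y)

lemma shift_shift (x y : ℤ) (ω : Env) : shift x (shift y ω) = shift (x + y) ω := by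
  funext k; simp only [shift, add_assoc]

lemma shift_zero (ω : Env) : shift 0 ω = ω := by funext k; simp [shift]

end

section

/-! ### Shifts -/

/-- The shift by `y` as a measurable equivalence. -/
def shiftEquiv (y : ℤ) : Env ≃ᵐ Env where
  toFun := shift y
  invFun := shift (-y)
  left_inv ω := by rw [shift_shift, neg_add_cancel, shift_zero]
  right_inv ω := by rw [shift_shift, add_neg_cancel, shift_zero]
  measurable_toFun := measurable_shift y
  measurable_invFun := measurable_shift (-y)

section

variable {P : Measure Env}

lemma ergodic_shift (hP : Ergodic (shift 1) P) (s : ℤˣ) : Ergodic (shift s) P := by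
  rcases Int.units_eq_one_or s with rfl | rfl
  · exact hP
  · exact Ergodic.symm (e := shiftEquiv 1) hP

lemma measurePreserving_shift (hP : MeasurePreserving (shift 1) P P) (y : ℤ) :
    MeasurePreserving (shift y) P P := by
  have hneg : MeasurePreserving (shift (-1)) P P := MeasurePreserving.symm (shiftEquiv 1) hP
  have h0 : shift 0 = id := funext shift_zero
  have hcomp : ∀ x y : ℤ, shift (x + y) = shift x ∘ shift y := fun x y =>
    funext fun ω => (shift_shift x y ω).symm
  induction y with
  | zero => rw [h0]; exact MeasurePreserving.id P
  | succ n ih => rw [hcomp]; exact ih.comp hP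
  | pred n ih => rw [sub_eq_add_neg, hcomp]; exact ih.comp hneg

end

/-! ### Finiteness of `ζ` -/

variable {s : ℤˣ} {r c : ℝ} {ω : Env}

lemma ofReal_exp_mul_trans_le_zeta (s : ℤˣ) (r : ℝ) (ω : Env) :
    ENNReal.ofReal (Real.exp r) * ENNReal.ofReal (trans ω 0 s) ≤ zeta s r ω := by
  conv_rhs => rw [zeta_eq]
  gcongr
  exact le_self_add

lemma zeta_pos (h : 0 < trans ω 0 s) : 0 < zeta s r ω :=
  (ENNReal.mul_pos (ENNReal.ofReal_pos.2 (Real.exp_pos r)).ne' (ENNReal.ofReal_pos.2 h).ne').trans_le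
    (ofReal_exp_mul_trans_le_zeta s r ω)

/-- A first step backwards has positive probability, so an infinite `ζ` at `T_{-s} ω` makes the
first-step equation infinite at `ω`. The event `ζ = ∞` is thus invariant in one direction, which
suffices for a zero-one law. -/
lemma zeta_shift_neg_lt_top (hs : 0 < trans ω 0 s) (hs' : 0 < trans ω 0 (-s))
    (h : zeta s r ω < ∞) : zeta s r (shift (-(s : ℤ)) ω) < ∞ := by
  by_contra hc
  rw [not_lt, top_le_iff] at hc
  rw [zeta_eq, hc, ENNReal.top_mul (zeta_pos hs).ne', ENNReal.mul_top (ENNReal.ofReal_pos.2 hs').ne',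
    add_top, ENNReal.mul_top (ENNReal.ofReal_pos.2 (Real.exp_pos r)).ne'] at h
  exact lt_irrefl _ h

lemma zeta_zero_le_one (s : ℤˣ) (ω : Env) : zeta s 0 ω ≤ 1 := by
  unfold zeta
  simp only [zero_mul, Real.exp_zero, ENNReal.ofReal_one, lintegral_one, Measure.restrict_apply_univ]
  exact prob_le_one

/-- The environments that are elliptic and have finite exponential passage moments below `c`, seen
from every site. -/
def Regular (s : ℤˣ) (c : ℝ) (ω : Env) : Prop :=
  ∀ k : ℤ, (∀ z, 0 < trans ω k z) ∧ ∀ r < c, zeta s r (shift k ω) < ∞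

lemma Regular.comp_shift (h : Regular s c ω) (y : ℤ) : Regular s c (shift y ω) := by
  intro k
  refine ⟨fun z => (h (k + y)).1 z, fun r hr => ?_⟩
  rw [shift_shift]
  exact (h (k + y)).2 r hr

lemma Regular.trans_pos (h : Regular s c ω) (z : ℤˣ) : 0 < trans ω 0 z := (h 0).1 z

lemma Regular.zeta_lt_top (h : Regular s c ω) (hr : r < c) : zeta s r ω < ∞ := by
  simpa [shift_zero] using (h 0).2 r hr

lemma Regular.toReal_zeta_pos (h : Regular s c ω) (hr : r < c) : 0 < (zeta s r ω).toReal :=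
  ENNReal.toReal_pos (zeta_pos (h.trans_pos s)).ne' (h.zeta_lt_top hr).ne

lemma Regular.exp_logZeta (h : Regular s c ω) (hr : r < c) :
    Real.exp (logZeta s r ω) = (zeta s r ω).toReal := Real.exp_log (h.toReal_zeta_pos hr)

/-! ### The tilted walk -/

/-- The transition probabilities `π(0, z) exp (θ z + F(ω, z) + r)` of the tilted walk. -/
def tilt (s : ℤˣ) (r : ℝ) (ω : Env) (z : ℤˣ) : ℝ :=
  trans ω 0 z * Real.exp (r + if z = s then -logZeta s r ω else logZeta s r (shift (-(s : ℤ)) ω))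

lemma neg_units_ne (s : ℤˣ) : -s ≠ s := by
  rcases Int.units_eq_one_or s with rfl | rfl <;> decide

lemma tilt_self (s : ℤˣ) (r : ℝ) (ω : Env) :
    tilt s r ω s = trans ω 0 s * Real.exp (r - logZeta s r ω) := by
  simp [tilt, sub_eq_add_neg]

lemma tilt_neg (s : ℤˣ) (r : ℝ) (ω : Env) :
    tilt s r ω (-s) = trans ω 0 (-s) * Real.exp (r + logZeta s r (shift (-(s : ℤ)) ω)) := by
  simp [tilt]

lemma Regular.tilt_pos (h : Regular s c ω) (r : ℝ) (z : ℤˣ) : 0 < tilt s r ω z :=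
  mul_pos (h.trans_pos z) (Real.exp_pos _)

lemma Regular.toReal_zeta_eq (h : Regular s c ω) (hr : r < c) :
    (zeta s r ω).toReal = Real.exp r * (trans ω 0 s + trans ω 0 (-s) *
      ((zeta s r (shift (-(s : ℤ)) ω)).toReal * (zeta s r ω).toReal)) := by
  have h1 := (h.zeta_lt_top hr).ne
  have h2 := ((h.comp_shift (-(s : ℤ))).zeta_lt_top hr).ne
  have h3 : ENNReal.ofReal (trans ω 0 (-s)) * (zeta s r (shift (-(s : ℤ)) ω) * zeta s r ω) ≠ ∞ :=
    ENNReal.mul_ne_top ENNReal.ofReal_ne_top (ENNReal.mul_ne_top h2 h1)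
  conv_lhs => rw [zeta_eq]
  rw [ENNReal.toReal_mul, ENNReal.toReal_add ENNReal.ofReal_ne_top h3, ENNReal.toReal_mul,
    ENNReal.toReal_mul, ENNReal.toReal_ofReal (Real.exp_pos r).le,
    ENNReal.toReal_ofReal (trans_nonneg _ _ _), ENNReal.toReal_ofReal (trans_nonneg _ _ _)]

/-- The tilted transition probabilities add up to one. -/
lemma Regular.tilt_add (h : Regular s c ω) (hr : r < c) : tilt s r ω s + tilt s r ω (-s) = 1 := by
  have hz := h.toReal_zeta_pos hr
  rw [tilt_self, tilt_neg, Real.exp_sub, Real.exp_add, h.exp_logZeta hr,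
    (h.comp_shift (-(s : ℤ))).exp_logZeta hr]
  -- The claim is the first-step equation for `ζ` divided by `ζ`.
  have := h.toReal_zeta_eq hr
  field_simp
  linarith

/-- Each tilted probability is at most one; taking logarithms, the step `s` bounds `log ζ` from
below and the step `-s` bounds it from above at the neighbouring site. No moment of `ζ` itself
enters. -/
lemma Regular.logZeta_ge (h : Regular s c ω) (hr : r < c) :
    r + Real.log (trans ω 0 s) ≤ logZeta s r ω := by
  have h1 : tilt s r ω s ≤ 1 := by linarith [h.tilt_add hr, h.tilt_pos r (-s)]
  rw [tilt_self, ← Real.log_le_log_iff (mul_pos (h.trans_pos s) (Real.exp_pos _)) one_pos,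
    Real.log_mul (h.trans_pos s).ne' (Real.exp_pos _).ne', Real.log_exp, Real.log_one] at h1
  linarith

lemma Regular.logZeta_shift_neg_le (h : Regular s c ω) (hr : r < c) :
    logZeta s r (shift (-(s : ℤ)) ω) ≤ -r - Real.log (trans ω 0 (-s)) := by
  have h1 : tilt s r ω (-s) ≤ 1 := by linarith [h.tilt_add hr, h.tilt_pos r s]
  rw [tilt_neg, ← Real.log_le_log_iff (mul_pos (h.trans_pos (-s)) (Real.exp_pos _)) one_pos,
    Real.log_mul (h.trans_pos (-s)).ne' (Real.exp_pos _).ne', Real.log_exp, Real.log_one] at h1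
  linarith

lemma Regular.logZeta_le (h : Regular s c ω) (hr : r < c) :
    logZeta s r ω ≤ -r - Real.log (trans (shift (s : ℤ) ω) 0 (-s)) := by
  have := (h.comp_shift (s : ℤ)).logZeta_shift_neg_le hr
  rwa [shift_shift, neg_add_cancel, shift_zero] at this

lemma Regular.abs_logZeta_le (h : Regular s c ω) (hr : r < c) :
    |logZeta s r ω| ≤ |r| + |Real.log (trans ω 0 s)| +
      |Real.log (trans (shift (s : ℤ) ω) 0 (-s))| := by
  have h1 := h.logZeta_ge hr
  have h2 := h.logZeta_le hr
  rw [abs_le]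
  constructor
  · linarith [neg_abs_le r, neg_abs_le (Real.log (trans ω 0 s)),
      abs_nonneg (Real.log (trans (shift (s : ℤ) ω) 0 (-s)))]
  · linarith [neg_abs_le r, abs_nonneg (Real.log (trans ω 0 s)),
      neg_abs_le (Real.log (trans (shift (s : ℤ) ω) 0 (-s)))]

/-! ### The critical exponent -/

section Critical

variable {P : Measure Env}

/-- The critical exponent of the passage times in the direction `s`. -/
def critExp (P : Measure Env) (s : ℤˣ) : ℝ := sSup {r | ∀ᵐ ω ∂P, zeta s r ω < ∞}

lemma ae_forall_trans_pos (hP : Ergodic (shift 1) P) (hell : ∀ z : ℤˣ, ∀ᵐ ω ∂P, 0 < trans ω 0 z) :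
    ∀ᵐ ω ∂P, ∀ (k : ℤ) (z : ℤˣ), 0 < trans ω k z := by
  rw [ae_all_iff]; intro k
  rw [ae_all_iff]; intro z
  have := (measurePreserving_shift hP.toMeasurePreserving k).quasiMeasurePreserving.tendsto_ae.eventually
    (hell z)
  filter_upwards [this] with ω hω
  simpa [trans, shift] using hω

lemma ae_regular (hP : Ergodic (shift 1) P) (hell : ∀ z : ℤˣ, ∀ᵐ ω ∂P, 0 < trans ω 0 z)
    (hfin : ∀ r < c, ∀ᵐ ω ∂P, zeta s r ω < ∞) : ∀ᵐ ω ∂P, Regular s c ω := by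
  obtain ⟨u, -, hu, hulim⟩ := exists_seq_strictMono_tendsto c
  have h1 : ∀ᵐ ω ∂P, ∀ (k : ℤ) (n : ℕ), zeta s (u n) (shift k ω) < ∞ := by
    rw [ae_all_iff]; intro k
    rw [ae_all_iff]; intro n
    exact (measurePreserving_shift hP.toMeasurePreserving k).quasiMeasurePreserving.tendsto_ae.eventually
      (hfin _ (hu n))
  filter_upwards [ae_forall_trans_pos hP hell, h1] with ω h2 h3 k
  refine ⟨h2 k, fun r hr => ?_⟩
  obtain ⟨n, hn⟩ := (hulim.eventually (lt_mem_nhds hr)).exists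
  exact (zeta_mono s _ hn.le).trans_lt (h3 k n)

variable [IsProbabilityMeasure P]

/-- A zero-one law: `ζ = ∞` at `T_{-s} ω` implies the same at `ω`, and an ergodic shift admits only
trivial events of this kind. -/
lemma ae_zeta_lt_top_or_eq_top (hP : Ergodic (shift 1) P)
    (hell : ∀ z : ℤˣ, ∀ᵐ ω ∂P, 0 < trans ω 0 z) (s : ℤˣ) (r : ℝ) :
    (∀ᵐ ω ∂P, zeta s r ω < ∞) ∨ ∀ᵐ ω ∂P, zeta s r ω = ∞ := by
  have hm : MeasurableSet {ω | zeta s r ω = ∞} := measurable_zeta s r (measurableSet_singleton ∞)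
  have hE := ergodic_shift hP (-s)
  rw [Units.val_neg] at hE
  have hsub : shift (-(s : ℤ)) ⁻¹' {ω | zeta s r ω = ∞} ≤ᵐ[P] {ω | zeta s r ω = ∞} := by
    filter_upwards [hell s, hell (-s)] with ω h1 h2 h3
    by_contra hc
    exact (zeta_shift_neg_lt_top h1 h2 (lt_top_iff_ne_top.2 hc)).ne h3
  rcases hE.ae_empty_or_univ_of_preimage_ae_le hm.nullMeasurableSet hsub with h | h
  · left
    filter_upwards [h.mem_iff] with ω hω
    exact lt_top_iff_ne_top.2 fun hc => (hω.1 hc).elim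
  · right
    filter_upwards [h.mem_iff] with ω hω
    exact hω.2 trivial

/-- The lower bound on `log ζ` grows with the exponent and the upper bound falls, so they are
compatible only up to a finite exponent. This is what makes the critical exponent finite. -/
lemma two_mul_le_of_ae_zeta_lt_top (hP : Ergodic (shift 1) P)
    (hell : ∀ z : ℤˣ, ∀ᵐ ω ∂P, 0 < trans ω 0 z)
    (hlog : ∀ z : ℤˣ, Integrable (fun ω => Real.log (trans ω 0 z)) P)
    (h : ∀ᵐ ω ∂P, zeta s r ω < ∞) (hc : c < r) :
    2 * c ≤ -(∫ ω, Real.log (trans ω 0 (-s)) ∂P) - ∫ ω, Real.log (trans ω 0 s) ∂P := by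
  have hreg : ∀ᵐ ω ∂P, Regular s r ω := ae_regular hP hell fun r' hr' =>
    h.mono fun ω hω => (zeta_mono s ω hr'.le).trans_lt hω
  have hmp := measurePreserving_shift hP.toMeasurePreserving (-(s : ℤ))
  have hi : Integrable (fun ω => Real.log (trans (shift (-(s : ℤ)) ω) 0 s)) P :=
    hmp.integrable_comp_of_integrable (hlog s)
  have hle : ∀ᵐ ω ∂P, 2 * c ≤ -Real.log (trans ω 0 (-s)) -
      Real.log (trans (shift (-(s : ℤ)) ω) 0 s) := by
    filter_upwards [hreg] with ω hω
    linarith [hω.logZeta_shift_neg_le hc, (hω.comp_shift (-(s : ℤ))).logZeta_ge hc]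
  have := integral_mono_ae (integrable_const (2 * c)) ((hlog (-s)).neg.sub hi) hle
  rw [integral_const, probReal_univ, one_smul] at this
  refine this.trans_eq ?_
  have h2 : ∫ ω, Real.log (trans (shift (-(s : ℤ)) ω) 0 s) ∂P = ∫ ω, Real.log (trans ω 0 s) ∂P :=
    MeasurePreserving.integral_comp_of_aestronglyMeasurable hmp (hlog s).aestronglyMeasurable
  rw [← h2, ← integral_neg]
  exact integral_sub (hlog (-s)).neg hi

lemma isCriticalExponent_critExp (hP : Ergodic (shift 1) P)
    (hell : ∀ z : ℤˣ, ∀ᵐ ω ∂P, 0 < trans ω 0 z)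
    (hlog : ∀ z : ℤˣ, Integrable (fun ω => Real.log (trans ω 0 z)) P) (s : ℤˣ) :
    0 ≤ critExp P s ∧ IsCriticalExponent P s (critExp P s) := by
  have h0 : (0 : ℝ) ∈ {r | ∀ᵐ ω ∂P, zeta s r ω < ∞} :=
    ae_of_all _ fun ω => (zeta_zero_le_one s ω).trans_lt ENNReal.one_lt_top
  have hb : BddAbove {r | ∀ᵐ ω ∂P, zeta s r ω < ∞} := by
    -- The preceding bound holds only strictly below an exponent with finite `ζ`; it is applied at
    -- `r - 1`, and the final `1` pays for this.
    refine ⟨(-(∫ ω, Real.log (trans ω 0 (-s)) ∂P) - ∫ ω, Real.log (trans ω 0 s) ∂P) / 2 + 1, ?_⟩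
    intro r hr
    have := two_mul_le_of_ae_zeta_lt_top (c := r - 1) hP hell hlog hr (by linarith)
    linarith
  refine ⟨le_csSup hb h0, ⟨fun r hr => ?_, fun r hr => ?_⟩⟩
  · obtain ⟨r', hr', hlt⟩ := exists_lt_of_lt_csSup ⟨0, h0⟩ hr
    exact Eventually.mono hr' fun ω hω => (zeta_mono s ω hlt.le).trans_lt hω
  · rcases ae_zeta_lt_top_or_eq_top hP hell s r with h | h
    · exact absurd (le_csSup hb h) (not_le.2 hr)
    · exact h

end Critical

end

section

/-! ### `log ζ` as a function of the exponent -/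

variable {s : ℤˣ} {r c : ℝ} {ω : Env}

lemma measurable_passageTime (s : ℤˣ) : Measurable (passageTime s) := by
  refine measurable_to_countable' fun n => ?_
  -- Paths that never pass have the default value `sInf ∅ = 0`, so they join the fibre over `0`.
  have : passageTime s ⁻¹' {n} = passesAt s n ∪ (if n = 0 then (passes s)ᶜ else ∅) := by
    ext X
    simp only [mem_preimage, mem_singleton_iff, mem_union]
    by_cases hX : X ∈ passes s
    · have hX' := hX
      rw [passes_eq_iUnion, mem_iUnion] at hX'
      obtain ⟨m, hm⟩ := hX'
      rw [passageTime_of_mem hm]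
      constructor
      · rintro rfl; exact Or.inl hm
      · rintro (h | h)
        · rw [← passageTime_of_mem hm, passageTime_of_mem h]
        · split_ifs at h
          · exact absurd hX h
          · exact h.elim
    · have h0 : passageTime s X = 0 := by
        have : {k | 1 ≤ (s : ℤ) * X k} = ∅ := by
          by_contra hne
          obtain ⟨k, hk⟩ := Set.nonempty_iff_ne_empty.2 hne
          exact hX ⟨k, hk⟩
        rw [passageTime, this, Nat.sInf_empty]
      have h1 : X ∉ passesAt s n := fun h => hX (by rw [passes_eq_iUnion]; exact mem_iUnion.2 ⟨n, h⟩)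
      rw [h0]
      by_cases hn : n = 0
      · simp [hn, hX]
      · simp [hn, h1, Ne.symm hn]
  rw [this]
  refine (measurableSet_passesAt s n).union ?_
  split_ifs
  · exact (measurableSet_passes s).compl
  · exact MeasurableSet.empty

/-- The passage time as a real random variable. -/
def passageTimeReal (s : ℤˣ) (X : ℕ → ℤ) : ℝ := passageTime s X

lemma measurable_passageTimeReal (s : ℤˣ) : Measurable (passageTimeReal s) :=
  Measurable.of_discrete.comp (measurable_passageTime s)

/-- The underlying measure is restricted to the paths that pass and may have mass below one. The
theory of cumulant generating functions still applies, and gives analyticity and convexity in `r`.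
-/
lemma logZeta_eq_cgf (s : ℤˣ) (ω : Env) :
    (fun r => logZeta s r ω) = cgf (passageTimeReal s) ((quenchedLaw ω 0).restrict (passes s)) := by
  funext r
  rw [cgf, mgf, integral_eq_lintegral_of_nonneg_ae (ae_of_all _ fun X => (Real.exp_pos _).le)
    (Real.measurable_exp.comp ((measurable_passageTimeReal s).const_mul r)).aestronglyMeasurable]
  rfl

lemma Regular.mem_interior_integrableExpSet (h : Regular s c ω) (hr : r < c) : r ∈ interior
    (integrableExpSet (passageTimeReal s) ((quenchedLaw ω 0).restrict (passes s))) := by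
  refine mem_interior.2 ⟨Iio c, fun r' hr' => ?_, isOpen_Iio, hr⟩
  refine ⟨(Real.measurable_exp.comp
    ((measurable_passageTimeReal s).const_mul r')).aestronglyMeasurable, ?_⟩
  rw [hasFiniteIntegral_iff_ofReal (ae_of_all _ fun X => (Real.exp_pos _).le)]
  exact h.zeta_lt_top hr'

/-- The mean passage time of the tilted walk, as the logarithmic derivative of `ζ`. -/
def meanPassage (s : ℤˣ) (r : ℝ) (ω : Env) : ℝ := deriv (fun r => logZeta s r ω) r

lemma Regular.hasDerivAt_logZeta (h : Regular s c ω) (hr : r < c) :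
    HasDerivAt (fun r => logZeta s r ω) (meanPassage s r ω) r := by
  refine DifferentiableAt.hasDerivAt ?_
  rw [logZeta_eq_cgf]
  exact (analyticAt_cgf (h.mem_interior_integrableExpSet hr)).differentiableAt

/-- The second derivative of a cumulant generating function is a variance under the tilted measure.
-/
lemma Regular.monotoneOn_meanPassage (h : Regular s c ω) :
    MonotoneOn (fun r => meanPassage s r ω) (Iio c) := by
  have hd : ∀ r < c, DifferentiableAt ℝ (fun r => meanPassage s r ω) r := by
    intro r hr
    unfold meanPassage
    rw [logZeta_eq_cgf]
    exact (analyticAt_cgf (h.mem_interior_integrableExpSet hr)).deriv.differentiableAt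
  refine monotoneOn_of_deriv_nonneg (convex_Iio c)
    (fun r hr => (hd r hr).continuousAt.continuousWithinAt)
    (fun r hr => (hd r (by simpa using hr)).differentiableWithinAt) fun r hr => ?_
  rw [interior_Iio] at hr
  have h2 := iteratedDeriv_two_cgf_eq_integral (h.mem_interior_integrableExpSet hr)
  have h3 : deriv (fun r => meanPassage s r ω) r =
      iteratedDeriv 2 (cgf (passageTimeReal s) ((quenchedLaw ω 0).restrict (passes s))) r := by
    rw [iteratedDeriv_succ, iteratedDeriv_one, ← logZeta_eq_cgf]; rfl
  rw [h3, h2]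
  exact div_nonneg (integral_nonneg fun X => by positivity) mgf_nonneg

lemma Regular.meanPassage_nonneg (h : Regular s c ω) (hr : r < c) : 0 ≤ meanPassage s r ω := by
  rw [meanPassage, logZeta_eq_cgf, deriv_cgf (h.mem_interior_integrableExpSet hr)]
  refine div_nonneg (integral_nonneg fun X => ?_) mgf_nonneg
  exact mul_nonneg (Nat.cast_nonneg _) (Real.exp_pos _).le

/-- By convexity, the derivative is at most any difference quotient further to the right. Such a
quotient is integrable in `ω`, and serves as the dominating function for `λ'`. -/
lemma Regular.meanPassage_le_slope (h : Regular s c ω) {r₁ r₂ : ℝ} (hr : r ≤ r₁) (h12 : r₁ < r₂)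
    (h2 : r₂ < c) : meanPassage s r ω ≤ (logZeta s r₂ ω - logZeta s r₁ ω) / (r₂ - r₁) := by
  refine (h.monotoneOn_meanPassage (hr.trans_lt (h12.trans h2)) (h12.trans h2) hr).trans ?_
  rw [le_div_iff₀ (sub_pos.2 h12)]
  refine Convex.mul_sub_le_image_sub_of_le_deriv (f := fun r => logZeta s r ω) (convex_Icc r₁ r₂)
    (fun x hx => (h.hasDerivAt_logZeta (hx.2.trans_lt h2)).continuousAt.continuousWithinAt)
    (fun x hx => ?_) (fun x hx => ?_) r₁ (left_mem_Icc.2 h12.le) r₂ (right_mem_Icc.2 h12.le) h12.le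
  · rw [interior_Icc] at hx
    exact (h.hasDerivAt_logZeta (hx.2.trans h2)).differentiableAt.differentiableWithinAt
  · rw [interior_Icc] at hx
    exact h.monotoneOn_meanPassage (h12.trans h2) (hx.2.trans h2) hx.1.le

/-- The first-step equation for the mean passage time of the tilted walk. -/
lemma Regular.meanPassage_eq (h : Regular s c ω) (hr : r < c) :
    tilt s r ω s * meanPassage s r ω =
      1 + tilt s r ω (-s) * meanPassage s r (shift (-(s : ℤ)) ω) := by
  have h1 := h.hasDerivAt_logZeta hr
  have h2 := (h.comp_shift (-(s : ℤ))).hasDerivAt_logZeta hr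
  -- The equation for the mean is the derivative in `r` of the identity that the tilted
  -- probabilities add up to one.
  have hs : HasDerivAt (fun r => tilt s r ω s + tilt s r ω (-s)) 0 r := by
    refine (hasDerivAt_const r (1 : ℝ)).congr_of_eventuallyEq ?_
    filter_upwards [Iio_mem_nhds hr] with x hx using h.tilt_add hx
  have hs' : HasDerivAt (fun r => tilt s r ω s + tilt s r ω (-s))
      (tilt s r ω s * (1 - meanPassage s r ω) +
        tilt s r ω (-s) * (1 + meanPassage s r (shift (-(s : ℤ)) ω))) r := by
    simp only [tilt_self, tilt_neg, mul_assoc]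
    exact (((hasDerivAt_id r).sub h1).exp.const_mul _).add (((hasDerivAt_id r).add h2).exp.const_mul _)
  have := hs.unique hs'
  linarith [h.tilt_add hr]

/-- In the first-step equation `a τ = 1 + b (τ ∘ T_{-s})`, the right side is at least `1` while `a =
1 - b < 1`. -/
lemma Regular.one_lt_meanPassage (h : Regular s c ω) (hr : r < c) : 1 < meanPassage s r ω := by
  have h1 := h.meanPassage_eq hr
  have h2 := (h.comp_shift (-(s : ℤ))).meanPassage_nonneg hr
  have h3 := h.tilt_pos r (-s)
  have h4 := h.tilt_add hr
  have h5 := h.tilt_pos r s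
  by_contra! hc
  nlinarith [mul_nonneg h3.le h2]

lemma Regular.logZeta_mono (h : Regular s c ω) {r₁ r₂ : ℝ} (h12 : r₁ ≤ r₂) (h2 : r₂ < c) :
    logZeta s r₁ ω ≤ logZeta s r₂ ω :=
  Real.log_le_log (h.toReal_zeta_pos (h12.trans_lt h2))
    (ENNReal.toReal_mono (h.zeta_lt_top h2).ne (zeta_mono s ω h12))

/-- Convexity gives only weak monotonicity. As `r` grows, the tilted probability of the step `-s`
strictly increases and that of `s` strictly decreases, and the first-step equation makes `τ`
strictly increase. -/
lemma Regular.meanPassage_lt (h : Regular s c ω) {r₁ r₂ : ℝ} (h12 : r₁ < r₂) (h2 : r₂ < c) :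
    meanPassage s r₁ ω < meanPassage s r₂ ω := by
  have hs := h.comp_shift (-(s : ℤ))
  have e1 := h.meanPassage_eq (h12.trans h2)
  have e2 := h.meanPassage_eq h2
  have a1 := h.tilt_add (h12.trans h2)
  have a2 := h.tilt_add h2
  have p1 := h.tilt_pos r₁ (-s)
  have p2 := h.tilt_pos r₂ s
  have hτ := hs.meanPassage_nonneg (h12.trans h2)
  have hmono : meanPassage s r₁ (shift (-(s : ℤ)) ω) ≤ meanPassage s r₂ (shift (-(s : ℤ)) ω) :=
    hs.monotoneOn_meanPassage (h12.trans h2) h2 h12.le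
  have hτ1 := h.one_lt_meanPassage (h12.trans h2)
  have hb : tilt s r₁ ω (-s) < tilt s r₂ ω (-s) := by
    rw [tilt_neg, tilt_neg]
    refine mul_lt_mul_of_pos_left (Real.exp_lt_exp.2 ?_) (h.trans_pos _)
    linarith [hs.logZeta_mono h12.le h2]
  by_contra! hc
  have k1 : tilt s r₂ ω s * meanPassage s r₂ ω ≤ tilt s r₂ ω s * meanPassage s r₁ ω :=
    mul_le_mul_of_nonneg_left hc p2.le
  have k2 : tilt s r₂ ω s * meanPassage s r₁ ω < tilt s r₁ ω s * meanPassage s r₁ ω :=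
    mul_lt_mul_of_pos_right (by linarith) (by linarith)
  have k3 : tilt s r₁ ω (-s) * meanPassage s r₁ (shift (-(s : ℤ)) ω) ≤
      tilt s r₂ ω (-s) * meanPassage s r₂ (shift (-(s : ℤ)) ω) :=
    mul_le_mul hb.le hmono hτ (p1.le.trans hb.le)
  linarith

/-! ### The Lyapunov exponent -/

section Lyap

variable {P : Measure Env} [IsProbabilityMeasure P]

lemma integrable_logZeta (hP : Ergodic (shift 1) P)
    (hlog : ∀ z : ℤˣ, Integrable (fun ω => Real.log (trans ω 0 z)) P)
    (hreg : ∀ᵐ ω ∂P, Regular s c ω) (hr : r < c) : Integrable (logZeta s r) P := by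
  have hb : Integrable (fun ω => |r| + |Real.log (trans ω 0 s)| +
      |Real.log (trans (shift (s : ℤ) ω) 0 (-s))|) P :=
    ((integrable_const _).add (hlog s).abs).add
      ((measurePreserving_shift hP.toMeasurePreserving s).integrable_comp_of_integrable (hlog (-s)).abs)
  refine hb.mono' (measurable_logZeta s r).aestronglyMeasurable ?_
  filter_upwards [hreg] with ω hω using hω.abs_logZeta_le hr

/-- Differentiation under the integral. For `r < r₁ < r₂ < c`, the slope of `log ζ` between `r₁` and
`r₂` dominates all derivatives at exponents below `r₁`. -/
lemma hasDerivAt_lyap (hP : Ergodic (shift 1) P)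
    (hlog : ∀ z : ℤˣ, Integrable (fun ω => Real.log (trans ω 0 z)) P)
    (hreg : ∀ᵐ ω ∂P, Regular s c ω) (hr : r < c) :
    Integrable (meanPassage s r) P ∧ HasDerivAt (lyap P s) (∫ ω, meanPassage s r ω ∂P) r := by
  obtain ⟨r₁, h1, h1c⟩ := exists_between hr
  obtain ⟨r₂, h12, h2c⟩ := exists_between h1c
  have hi := fun {x : ℝ} (hx : x < c) => integrable_logZeta hP hlog hreg hx
  have hm : AEStronglyMeasurable (meanPassage s r) P := by
    -- As `meanPassage` is a pointwise derivative, its measurability in `ω` comes from a sequence of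
    -- difference quotients.
    refine aestronglyMeasurable_of_tendsto_ae atTop
      (f := fun (n : ℕ) ω => slope (fun x => logZeta s x ω) r (r + 1 / ((n : ℝ) + 1))) (fun n => ?_) ?_
    · simp only [slope_def_field]
      exact (((measurable_logZeta s _).sub (measurable_logZeta s r)).div_const _).aestronglyMeasurable
    · filter_upwards [hreg] with ω hω
      refine (hasDerivAt_iff_tendsto_slope.1 (hω.hasDerivAt_logZeta hr)).comp ?_
      refine tendsto_nhdsWithin_iff.2 ⟨?_, Eventually.of_forall fun n => ?_⟩
      · simpa using (tendsto_const_nhds (x := r)).add (tendsto_one_div_add_atTop_nhds_zero_nat (𝕜 := ℝ))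
      · have : (0 : ℝ) < 1 / ((n : ℝ) + 1) := by positivity
        simp only [mem_compl_iff, mem_singleton_iff]
        linarith
  refine hasDerivAt_integral_of_dominated_loc_of_deriv_le (F := fun x ω => logZeta s x ω)
    (F' := fun x ω => meanPassage s x ω) (s := Iio r₁)
    (bound := fun ω => (logZeta s r₂ ω - logZeta s r₁ ω) / (r₂ - r₁)) (Iio_mem_nhds h1)
    (Eventually.of_forall fun x => (measurable_logZeta s x).aestronglyMeasurable) (hi hr) hm ?_
    (((hi h2c).sub (hi h1c)).div_const _) ?_
  · filter_upwards [hreg] with ω hω x hx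
    rw [Real.norm_of_nonneg (hω.meanPassage_nonneg ((mem_Iio.1 hx).trans h1c))]
    exact hω.meanPassage_le_slope (mem_Iio.1 hx).le h12 h2c
  · filter_upwards [hreg] with ω hω x hx
    exact hω.hasDerivAt_logZeta ((mem_Iio.1 hx).trans h1c)

lemma integral_lt_integral_of_ae_lt {Ω : Type*} [MeasurableSpace Ω] {μ : Measure Ω}
    [IsProbabilityMeasure μ] {f g : Ω → ℝ} (hf : Integrable f μ) (hg : Integrable g μ)
    (h : ∀ᵐ ω ∂μ, f ω < g ω) : ∫ ω, f ω ∂μ < ∫ ω, g ω ∂μ := by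
  rw [← sub_pos, ← integral_sub hg hf, integral_pos_iff_support_of_nonneg_ae
    (h.mono fun ω hω => sub_nonneg.2 hω.le) (hg.sub hf)]
  have : Function.support (fun ω => g ω - f ω) =ᵐ[μ] univ := by
    refine eventuallyEq_univ.2 ?_
    filter_upwards [h] with ω hω using (sub_pos.2 hω).ne'
  rw [measure_congr this, measure_univ]
  exact one_pos

lemma one_lt_deriv_lyap (hP : Ergodic (shift 1) P)
    (hlog : ∀ z : ℤˣ, Integrable (fun ω => Real.log (trans ω 0 z)) P)
    (hreg : ∀ᵐ ω ∂P, Regular s c ω) (hr : r < c) : 1 < deriv (lyap P s) r := by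
  obtain ⟨hi, hd⟩ := hasDerivAt_lyap hP hlog hreg hr
  rw [hd.deriv]
  have := integral_lt_integral_of_ae_lt (integrable_const (1 : ℝ)) hi
    (hreg.mono fun ω hω => hω.one_lt_meanPassage hr)
  simpa using this

lemma strictMonoOn_deriv_lyap (hP : Ergodic (shift 1) P)
    (hlog : ∀ z : ℤˣ, Integrable (fun ω => Real.log (trans ω 0 z)) P)
    (hreg : ∀ᵐ ω ∂P, Regular s c ω) : StrictMonoOn (deriv (lyap P s)) (Iio c) := by
  intro r₁ h1 r₂ h2 h12
  obtain ⟨hi1, hd1⟩ := hasDerivAt_lyap hP hlog hreg h1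
  obtain ⟨hi2, hd2⟩ := hasDerivAt_lyap hP hlog hreg h2
  rw [hd1.deriv, hd2.deriv]
  exact integral_lt_integral_of_ae_lt hi1 hi2 (hreg.mono fun ω hω => hω.meanPassage_lt h12 h2)

/-- Since `λ(r) ≥ r + C`, going to the left `λ` cannot fall at a rate bounded below by some `m > 1`.
-/
lemma exists_deriv_lyap_lt (hP : Ergodic (shift 1) P)
    (hlog : ∀ z : ℤˣ, Integrable (fun ω => Real.log (trans ω 0 z)) P)
    (hreg : ∀ᵐ ω ∂P, Regular s c ω) {m : ℝ} (hm : 1 < m) : ∃ r < c, deriv (lyap P s) r < m := by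
  by_contra! hc
  set C := ∫ ω, Real.log (trans ω 0 s) ∂P
  have hlow : ∀ r < c, r + C ≤ lyap P s r := by
    intro r hr
    have := integral_mono_ae ((integrable_const r).add (hlog s)) (integrable_logZeta hP hlog hreg hr)
      (hreg.mono fun ω hω => hω.logZeta_ge hr)
    rw [integral_add' (integrable_const r) (hlog s)] at this
    rw [integral_const, probReal_univ, one_smul] at this
    exact this
  set r₀ := c - 1
  have h0 : r₀ < c := by simp [r₀]
  have hslope : ∀ r ≤ r₀, m * (r₀ - r) ≤ lyap P s r₀ - lyap P s r := by
    intro r hr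
    refine Convex.mul_sub_le_image_sub_of_le_deriv (convex_Iio c)
      (fun x hx => (hasDerivAt_lyap hP hlog hreg hx).2.continuousAt.continuousWithinAt)
      (fun x hx => ?_) (fun x hx => ?_) r (hr.trans_lt h0) r₀ h0 hr
    · rw [interior_Iio] at hx
      exact (hasDerivAt_lyap hP hlog hreg hx).2.differentiableAt.differentiableWithinAt
    · rw [interior_Iio] at hx
      exact hc x hx
  -- Over the distance `K / (m - 1)` to the left of `r₀`, the fall at rate `m` exceeds the fall at
  -- rate `1` by exactly `K`, which is more than the available margin `λ(r₀) - C - r₀`.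
  set K := |lyap P s r₀ - C - r₀| + 1
  have hK : 0 < K := by positivity
  have hm' : 0 < m - 1 := by linarith
  have hle : r₀ - K / (m - 1) ≤ r₀ := by
    have : 0 < K / (m - 1) := by positivity
    linarith
  have e1 := hslope _ hle
  have e2 := hlow _ (hle.trans_lt h0)
  have e3 : m * (K / (m - 1)) = K + K / (m - 1) := by field_simp; ring
  have e4 : m * (r₀ - (r₀ - K / (m - 1))) = m * (K / (m - 1)) := by ring
  rw [e4, e3] at e1
  have e5 := le_abs_self (lyap P s r₀ - C - r₀)
  simp only [K] at *
  linarith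

/-- The derivative of the Lyapunov exponent has an inverse that decreases to a limit in `[0, 1)`. -/
lemma exists_tendsto_inv_deriv_lyap (hP : Ergodic (shift 1) P)
    (hlog : ∀ z : ℤˣ, Integrable (fun ω => Real.log (trans ω 0 z)) P)
    (hreg : ∀ᵐ ω ∂P, Regular s c ω) : ∃ L : ℝ, 0 ≤ L ∧ L < 1 ∧
      Tendsto (fun r => (deriv (lyap P s) r)⁻¹) (𝓝[<] c) (𝓝 L) := by
  have hone := fun {r : ℝ} (hr : r < c) => one_lt_deriv_lyap hP hlog hreg hr
  have hanti : AntitoneOn (fun r => (deriv (lyap P s) r)⁻¹) (Iio c) := by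
    intro r₁ h1 r₂ h2 h12
    exact inv_anti₀ (zero_lt_one.trans (hone h1)) ((strictMonoOn_deriv_lyap hP hlog hreg).monotoneOn h1 h2 h12)
  have hb : BddBelow ((fun r => (deriv (lyap P s) r)⁻¹) '' Iio c) :=
    ⟨0, by rintro _ ⟨r, hr, rfl⟩; exact (inv_pos.2 (zero_lt_one.trans (hone hr))).le⟩
  have ht := hanti.tendsto_nhdsLT hb
  refine ⟨_, ?_, ?_, ht⟩
  · exact le_csInf ⟨_, mem_image_of_mem _ (show c - 1 < c by linarith)⟩
      (by rintro _ ⟨r, hr, rfl⟩; exact (inv_pos.2 (zero_lt_one.trans (hone hr))).le)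
  · refine (csInf_le hb (mem_image_of_mem _ (show c - 1 < c by linarith))).trans_lt ?_
    exact inv_lt_one_of_one_lt₀ (hone (by linarith))

lemma existsUnique_hasDerivAt_lyap (hP : Ergodic (shift 1) P)
    (hlog : ∀ z : ℤˣ, Integrable (fun ω => Real.log (trans ω 0 z)) P)
    (hreg : ∀ᵐ ω ∂P, Regular s c ω) {L x : ℝ} (hL : 0 ≤ L)
    (ht : Tendsto (fun r => (deriv (lyap P s) r)⁻¹) (𝓝[<] c) (𝓝 L)) (hx : x ∈ Ioo L 1) :
    ∃ r, (r < c ∧ HasDerivAt (lyap P s) x⁻¹ r) ∧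
      ∀ r' < c, HasDerivAt (lyap P s) x⁻¹ r' → r' = r := by
  have hx0 : 0 < x := hL.trans_lt hx.1
  have hmono := strictMonoOn_deriv_lyap hP hlog hreg
  have hd : ∀ r < c, HasDerivAt (lyap P s) (deriv (lyap P s) r) r := fun r hr =>
    (hasDerivAt_lyap hP hlog hreg hr).2.differentiableAt.hasDerivAt
  obtain ⟨a, hac, ha⟩ := exists_deriv_lyap_lt hP hlog hreg (one_lt_inv₀ hx0 |>.2 hx.2)
  obtain ⟨b, hb, hbc⟩ := ((ht.eventually (gt_mem_nhds hx.1)).and self_mem_nhdsWithin).exists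
  have hbc' : b < c := hbc
  have hb' : x⁻¹ < deriv (lyap P s) b :=
    (inv_lt_comm₀ (zero_lt_one.trans (one_lt_deriv_lyap hP hlog hreg hbc')) hx0).1 hb
  have hab : a ≤ b := by
    by_contra! hlt
    linarith [hmono hbc' hac hlt]
  -- Darboux's theorem: derivatives have the intermediate value property, so continuity of `λ'` is
  -- not needed.
  obtain ⟨r, hr, hrx⟩ := exists_hasDerivWithinAt_eq_of_gt_of_lt hab
    (fun y hy => (hd y (hy.2.trans_lt hbc')).hasDerivWithinAt) ha hb'
  have hrc : r < c := hr.2.trans hbc'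
  refine ⟨r, ⟨hrc, hrx ▸ hd r hrc⟩, fun r' hr' h' => ?_⟩
  exact hmono.injOn hr' hrc (h'.deriv.trans hrx.symm)

end Lyap

end

section

/-! ### Two-sided sums -/

/-- The function on the integers that vanishes at `0` and has the increments `a`. -/
def primitive (a : ℤ → ℝ) : ℤ → ℝ
  | Int.ofNat n => ∑ k ∈ Finset.range n, a k
  | Int.negSucc n => -∑ k ∈ Finset.range (n + 1), a (-(k + 1))

lemma primitive_natCast (a : ℤ → ℝ) (n : ℕ) : primitive a n = ∑ k ∈ Finset.range n, a k := rfl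

lemma primitive_neg_natCast (a : ℤ → ℝ) (n : ℕ) :
    primitive a (-n) = -∑ k ∈ Finset.range n, a (-(k + 1)) := by
  cases n with
  | zero => simpa using primitive_natCast a 0
  | succ n => rfl

lemma primitive_zero (a : ℤ → ℝ) : primitive a 0 = 0 := by simpa using primitive_natCast a 0

lemma primitive_add_one (a : ℤ → ℝ) (y : ℤ) : primitive a (y + 1) = primitive a y + a y := by
  obtain ⟨n, rfl | rfl⟩ := y.eq_nat_or_neg
  · have := primitive_natCast a (n + 1)
    push_cast at this
    rw [this, Finset.sum_range_succ, primitive_natCast]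
  · cases n with
    | zero => simpa [primitive_zero] using primitive_natCast a 1
    | succ n =>
      have h1 : -((n + 1 : ℕ) : ℤ) + 1 = -(n : ℤ) := by push_cast; ring
      rw [h1, primitive_neg_natCast, primitive_neg_natCast, Finset.sum_range_succ]
      push_cast
      ring

/-! ### The potential of `log ζ` and the tilted path measure -/

variable {s : ℤˣ} {r c : ℝ} {ω : Env}

/-- The potential of the field `log ζ`, oriented in the direction `s`. -/
def pot (s : ℤˣ) (r : ℝ) (ω : Env) (x : ℤ) : ℝ :=
  primitive (fun k => logZeta s r (shift (s * k) ω)) (s * x)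

lemma pot_zero (s : ℤˣ) (r : ℝ) (ω : Env) : pot s r ω 0 = 0 := by simp [pot, primitive_zero]

lemma pot_add_self (s : ℤˣ) (r : ℝ) (ω : Env) (x : ℤ) :
    pot s r ω (x + s) = pot s r ω x + logZeta s r (shift x ω) := by
  rw [pot, mul_add, units_mul_self, primitive_add_one, ← mul_assoc, units_mul_self, one_mul]
  rfl

lemma pot_add_neg (s : ℤˣ) (r : ℝ) (ω : Env) (x : ℤ) :
    pot s r ω (x + ((-s : ℤˣ) : ℤ)) = pot s r ω x - logZeta s r (shift (-(s : ℤ)) (shift x ω)) := by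
  have := pot_add_self s r ω (x + ((-s : ℤˣ) : ℤ))
  rw [Units.val_neg, neg_add_cancel_right] at this
  rw [Units.val_neg, this, shift_shift, add_comm x]
  ring

/-- `exp (-pot)` is harmonic for the transition probabilities weighted by `e ^ r`. -/
lemma Regular.sum_trans_mul_exp_pot (h : Regular s c ω) (hr : r < c) (x : ℤ) :
    ∑ z : ℤˣ, trans ω x z * Real.exp (-pot s r ω (x + z)) = Real.exp (-r) * Real.exp (-pot s r ω x) := by
  have h1 := (h.comp_shift x).tilt_add hr
  have ht : ∀ z, trans (shift x ω) 0 z = trans ω x z := fun z => by simp [trans, shift]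
  rw [tilt_self, tilt_neg, ht, ht] at h1
  rw [sum_units s, pot_add_self, pot_add_neg]
  have e1 : Real.exp (-(pot s r ω x + logZeta s r (shift x ω))) =
      Real.exp (-r) * Real.exp (-pot s r ω x) * Real.exp (r - logZeta s r (shift x ω)) := by
    rw [← Real.exp_add, ← Real.exp_add]; congr 1; ring
  have e2 : Real.exp (-(pot s r ω x - logZeta s r (shift (-(s : ℤ)) (shift x ω)))) =
      Real.exp (-r) * Real.exp (-pot s r ω x) *
        Real.exp (r + logZeta s r (shift (-(s : ℤ)) (shift x ω))) := by
    rw [← Real.exp_add, ← Real.exp_add]; congr 1; ring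
  rw [e1, e2]
  linear_combination Real.exp (-r) * Real.exp (-pot s r ω x) * h1

/-- The density of the tilted path measure at time `n`. -/
def tiltWeight (s : ℤˣ) (r : ℝ) (ω : Env) (n : ℕ) (x : ℤ) : ℝ≥0∞ :=
  ENNReal.ofReal (Real.exp (r * n - pot s r ω x))

lemma measurable_tiltWeight (s : ℤˣ) (r : ℝ) (ω : Env) (n : ℕ) :
    Measurable fun X : ℕ → ℤ => tiltWeight s r ω n (X n) :=
  Measurable.comp (g := tiltWeight s r ω n) .of_discrete (measurable_pi_apply n)

/-- One step multiplies the mean of `exp (-pot)` by `e^{-r}`, which the factor `e^{r n}`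
compensates: the weights form a martingale of mean one. -/
lemma Regular.lintegral_tiltWeight (h : Regular s c ω) (hr : r < c) (n : ℕ) :
    ∫⁻ X, tiltWeight s r ω n (X n) ∂(quenchedLaw ω 0) = 1 := by
  induction n with
  | zero => rw [lintegral_quenchedLaw_zero ω 0 (tiltWeight s r ω 0)]; simp [tiltWeight, pot_zero]
  | succ n ih =>
    rw [lintegral_quenchedLaw_succ ω 0 n (tiltWeight s r ω (n + 1)), ← ih]
    refine lintegral_congr fun X => ?_
    simp only [tiltWeight]
    simp_rw [← ENNReal.ofReal_mul (trans_nonneg ω (X n) _)]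
    rw [← ENNReal.ofReal_sum_of_nonneg fun z _ =>
      mul_nonneg (trans_nonneg ω (X n) z) (Real.exp_pos _).le]
    congr 1
    have := h.sum_trans_mul_exp_pot hr (X n)
    have e : ∀ y : ℤ, Real.exp (r * ((n + 1 : ℕ) : ℝ) - pot s r ω y) =
        Real.exp (r * n + r) * Real.exp (-pot s r ω y) := by
      intro y; rw [← Real.exp_add]; push_cast; congr 1; ring
    simp_rw [e, mul_left_comm _ (Real.exp (r * n + r))]
    rw [← Finset.mul_sum, this, ← Real.exp_add, ← Real.exp_add]
    congr 1; ring

section Ergodic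

variable {P : Measure Env}

lemma iterate_shift (y : ℤ) (k : ℕ) : (shift y)^[k] = shift (y * k) := by
  induction k with
  | zero => simp only [Function.iterate_zero, Nat.cast_zero, mul_zero]; exact (funext shift_zero).symm
  | succ k ih =>
    rw [Function.iterate_succ', ih]
    funext ω
    simp only [Function.comp_apply, shift_shift]
    congr 1; push_cast; ring

/-- The two-sided ergodic theorem for the potential. -/
lemma ae_abs_pot_sub_le [IsProbabilityMeasure P] (hP : Ergodic (shift 1) P) (hi : Integrable (logZeta s r) P) :
    ∀ᵐ ω ∂P, ∀ ε > 0, ∃ C, ∀ x : ℤ,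
      |pot s r ω x - (s : ℤ) * x * lyap P s r| ≤ |(x : ℝ)| * ε + C := by
  have hE := ergodic_shift hP s
  have hE' := ergodic_shift hP (-s)
  rw [Units.val_neg] at hE'
  have hmp := hE'.toMeasurePreserving
  have hi' : Integrable (fun ω => logZeta s r (shift (-(s : ℤ)) ω)) P :=
    hmp.integrable_comp_of_integrable hi
  have hint : ∫ ω, logZeta s r (shift (-(s : ℤ)) ω) ∂P = lyap P s r :=
    MeasurePreserving.integral_comp_of_aestronglyMeasurable hmp hi.aestronglyMeasurable
  -- The negative half-line is covered by Birkhoff sums of the inverse shift. The first increment to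
  -- the left of `0` sits at `-1`, hence the additional shift of the function.
  filter_upwards [ae_abs_birkhoffSum_sub_le hE (measurable_logZeta s r) hi,
    ae_abs_birkhoffSum_sub_le hE' ((measurable_logZeta s r).comp (measurable_shift _)) hi']
    with ω h1 h2 ε hε
  obtain ⟨C₁, hC₁⟩ := h1 ε hε
  obtain ⟨C₂, hC₂⟩ := h2 ε hε
  refine ⟨max C₁ C₂, fun x => ?_⟩
  have habs : |(((s : ℤ) * x : ℤ) : ℝ)| = |(x : ℝ)| := by
    rcases Int.units_eq_one_or s with rfl | rfl <;> simp
  obtain ⟨n, hn | hn⟩ := ((s : ℤ) * x).eq_nat_or_neg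
  · have hp : pot s r ω x = birkhoffSum (shift s) (logZeta s r) n ω := by
      rw [pot, hn, primitive_natCast, birkhoffSum]
      simp only [iterate_shift]
    have hx : ((s : ℤ) : ℝ) * x = n := by exact_mod_cast hn
    have hx' : |(x : ℝ)| = n := by rw [← habs, hn]; simp
    rw [hp, hx, hx']
    exact (hC₁ n).trans (by gcongr; exact le_max_left _ _)
  · have hp : pot s r ω x =
        -birkhoffSum (shift (-(s : ℤ))) (fun ω => logZeta s r (shift (-(s : ℤ)) ω)) n ω := by
      rw [pot, hn, primitive_neg_natCast, birkhoffSum]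
      simp only [iterate_shift, shift_shift]
      refine congrArg Neg.neg (Finset.sum_congr rfl fun k _ => ?_)
      rw [show -(s : ℤ) + -(s : ℤ) * k = (s : ℤ) * -((k : ℤ) + 1) by ring]
    have hx : ((s : ℤ) : ℝ) * x = -n := by exact_mod_cast hn
    have hx' : |(x : ℝ)| = n := by rw [← habs, hn]; simp
    have h := hC₂ n
    rw [show ∫ ω, (logZeta s r ∘ shift (-(s : ℤ))) ω ∂P = lyap P s r from hint] at h
    rw [hp, hx, hx', neg_mul, ← neg_sub_neg, abs_sub_comm, neg_neg, neg_neg]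
    refine h.trans ?_
    gcongr
    exact le_max_right _ _

/-! ### Large deviation bounds -/

/-- The paths whose mean velocity at time `n` is in the `δ`-neighbourhood of `ξ`. -/
def nearVelocity (ξ δ : ℝ) (n : ℕ) : Set (ℕ → ℤ) := {X | |(X n : ℝ) / n - ξ| < δ}

lemma measurableSet_nearVelocity (ξ δ : ℝ) (n : ℕ) : MeasurableSet (nearVelocity ξ δ n) := by
  have : nearVelocity ξ δ n = (fun X : ℕ → ℤ => X n) ⁻¹' {y : ℤ | |(y : ℝ) / n - ξ| < δ} := rfl
  rw [this]
  exact measurable_pi_apply n .of_discrete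

lemma abs_mul_sub_le_of_mem_nearVelocity {ξ δ : ℝ} {n : ℕ} (hn : 0 < n) {X : ℕ → ℤ}
    (hs : (s : ℤ) * ξ = |ξ|) (hX : X ∈ nearVelocity ξ δ n) :
    |((s : ℤ) : ℝ) * X n - (n * |ξ|)| ≤ n * δ := by
  have hn' : (0 : ℝ) < n := by exact_mod_cast hn
  have h1 : ((s : ℤ) : ℝ) * X n - n * |ξ| = n * ((s : ℤ) * ((X n : ℝ) / n - ξ)) := by
    rw [← hs]; field_simp
  have h2 : |((s : ℤ) : ℝ)| = 1 := by rcases Int.units_eq_one_or s with rfl | rfl <;> simp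
  rw [h1, abs_mul, abs_mul, h2, one_mul, abs_of_pos hn']
  exact mul_le_mul_of_nonneg_left hX.le hn'.le

lemma abs_pot_sub_le_of_mem_nearVelocity {ξ δ ε C : ℝ} {n : ℕ} (hn : 0 < n) {X : ℕ → ℤ}
    (hs : (s : ℤ) * ξ = |ξ|) (hX : X ∈ nearVelocity ξ δ n) (hXn : |X n| ≤ (n : ℤ)) (hε : 0 ≤ ε)
    (hC : ∀ x : ℤ, |pot s r ω x - (s : ℤ) * x * lyap P s r| ≤ |(x : ℝ)| * ε + C) :
    |pot s r ω (X n) - n * (|ξ| * lyap P s r)| ≤ n * (δ * |lyap P s r| + ε) + C := by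
  have h1 := hC (X n)
  have h2 := abs_mul_sub_le_of_mem_nearVelocity hn hs hX
  have h3 : |(X n : ℝ)| ≤ n := by exact_mod_cast hXn
  have e : pot s r ω (X n) - n * (|ξ| * lyap P s r) =
      (pot s r ω (X n) - (s : ℤ) * X n * lyap P s r) +
        (((s : ℤ) : ℝ) * X n - n * |ξ|) * lyap P s r := by ring
  rw [e]
  refine (abs_add_le _ _).trans ?_
  rw [abs_mul]
  nlinarith [mul_le_mul_of_nonneg_right h2 (abs_nonneg (lyap P s r)),
    mul_le_mul_of_nonneg_right h3 hε]

/-- An exponential Markov inequality: on this event the potential is close to `n |ξ| λ(r)`, so the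
mean-one weight is at least `exp (-K)`. -/
lemma quenchedLaw_nearVelocity_le {ξ δ ε C : ℝ} {n : ℕ} (hn : 0 < n) (h : Regular s c ω) (hr : r < c)
    (hs : (s : ℤ) * ξ = |ξ|) (hε : 0 ≤ ε)
    (hC : ∀ x : ℤ, |pot s r ω x - (s : ℤ) * x * lyap P s r| ≤ |(x : ℝ)| * ε + C) :
    quenchedLaw ω 0 (nearVelocity ξ δ n) ≤ ENNReal.ofReal (Real.exp
      (n * (-(r - |ξ| * lyap P s r) + (δ * |lyap P s r| + ε)) + C)) := by
  set K := n * (-(r - |ξ| * lyap P s r) + (δ * |lyap P s r| + ε)) + C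
  calc quenchedLaw ω 0 (nearVelocity ξ δ n)
      = ∫⁻ X in nearVelocity ξ δ n, 1 ∂(quenchedLaw ω 0) := by rw [setLIntegral_one]
    _ ≤ ∫⁻ X in nearVelocity ξ δ n, ENNReal.ofReal (Real.exp K) * tiltWeight s r ω n (X n)
          ∂(quenchedLaw ω 0) := by
        refine setLIntegral_mono_ae' (measurableSet_nearVelocity ξ δ n) ?_
        filter_upwards [ae_quenchedLaw_abs_le ω n] with X hXn hX
        have := abs_le.1 (abs_pot_sub_le_of_mem_nearVelocity hn hs hX hXn hε hC)
        rw [tiltWeight, ← ENNReal.ofReal_mul (Real.exp_pos _).le, ← Real.exp_add,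
          ← ENNReal.ofReal_one]
        refine ENNReal.ofReal_le_ofReal (Real.one_le_exp ?_)
        simp only [K]
        nlinarith [this.2]
    _ ≤ ∫⁻ X, ENNReal.ofReal (Real.exp K) * tiltWeight s r ω n (X n) ∂(quenchedLaw ω 0) :=
        setLIntegral_le_lintegral _ _
    _ = ENNReal.ofReal (Real.exp K) := by
        rw [lintegral_const_mul _ (measurable_tiltWeight s r ω n), h.lintegral_tiltWeight hr, mul_one]

/-- The tilted path measure gives exponentially small mass to the velocities on one side. -/
lemma setLIntegral_tiltWeight_le {r' y D ε C C' : ℝ} {n : ℕ} (h : Regular s c ω) (hr' : r' < c)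
    (hε : 0 ≤ ε)
    (hC : ∀ x : ℤ, |pot s r ω x - (s : ℤ) * x * lyap P s r| ≤ |(x : ℝ)| * ε + C)
    (hC' : ∀ x : ℤ, |pot s r' ω x - (s : ℤ) * x * lyap P s r'| ≤ |(x : ℝ)| * ε + C')
    (hD : D = (r' - r) - y * (lyap P s r' - lyap P s r)) {A : Set ℤ}
    (hA : ∀ x ∈ A, ((s : ℤ) : ℝ) * x * (lyap P s r' - lyap P s r) ≤
      n * y * (lyap P s r' - lyap P s r)) :
    ∫⁻ X in {X | X n ∈ A}, tiltWeight s r ω n (X n) ∂(quenchedLaw ω 0) ≤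
      ENNReal.ofReal (Real.exp (n * (-D + 2 * ε) + (C + C'))) := by
  set K := n * (-D + 2 * ε) + (C + C')
  have hm : MeasurableSet {X : ℕ → ℤ | X n ∈ A} :=
    (measurable_pi_apply n : Measurable fun X : ℕ → ℤ => X n) (MeasurableSet.of_discrete (s := A))
  -- The weight for `r` is compared with the one for `r'`, which has total mass one. With `V ≈ s x
  -- λ`, the exponent of their ratio is about `(r - r') n + s x (λ(r') - λ(r))`, at most `-n D` on
  -- `A`; each potential adds an error of `n ε`.
  calc ∫⁻ X in {X | X n ∈ A}, tiltWeight s r ω n (X n) ∂(quenchedLaw ω 0)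
      ≤ ∫⁻ X in {X | X n ∈ A}, ENNReal.ofReal (Real.exp K) * tiltWeight s r' ω n (X n)
          ∂(quenchedLaw ω 0) := by
        refine setLIntegral_mono_ae' hm ?_
        filter_upwards [ae_quenchedLaw_abs_le ω n] with X hXn hX
        have h1 := abs_le.1 (hC (X n))
        have h2 := abs_le.1 (hC' (X n))
        have h3 : |(X n : ℝ)| ≤ n := by exact_mod_cast hXn
        rw [tiltWeight, tiltWeight, ← ENNReal.ofReal_mul (Real.exp_pos _).le, ← Real.exp_add]
        refine ENNReal.ofReal_le_ofReal (Real.exp_le_exp.2 ?_)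
        simp only [K, hD]
        nlinarith [hA _ hX, mul_le_mul_of_nonneg_right h3 hε, h1.1, h2.2]
    _ ≤ ∫⁻ X, ENNReal.ofReal (Real.exp K) * tiltWeight s r' ω n (X n) ∂(quenchedLaw ω 0) :=
        setLIntegral_le_lintegral _ _
    _ = ENNReal.ofReal (Real.exp K) := by
        rw [lintegral_const_mul _ (measurable_tiltWeight s r' ω n), h.lintegral_tiltWeight hr', mul_one]

lemma eventually_exp_le_of_neg {a : ℝ} (ha : a < 0) (C : ℝ) {b : ℝ} (hb : 0 < b) :
    ∀ᶠ n : ℕ in atTop, Real.exp (n * a + C) ≤ b := by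
  have h1 : Tendsto (fun n : ℕ => (n : ℝ) * a + C) atTop atBot :=
    tendsto_atBot_add_const_right _ _ (tendsto_natCast_atTop_atTop.atTop_mul_const_of_neg ha)
  exact (Real.tendsto_exp_atBot.comp h1).eventually (eventually_le_nhds hb)

lemma HasDerivAt.exists_gt_of_pos {f : ℝ → ℝ} {d x b : ℝ} (h : HasDerivAt f d x) (hd : 0 < d)
    (hb : x < b) : ∃ y, x < y ∧ y < b ∧ f x < f y := by
  have h1 := ((hasDerivAt_iff_tendsto_slope.1 h).mono_left
    (nhdsWithin_mono x (fun y hy => (ne_of_gt hy : y ≠ x)) : 𝓝[>] x ≤ 𝓝[≠] x)).eventually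
    (lt_mem_nhds hd)
  obtain ⟨y, hy, hyI⟩ := (h1.and (Ioo_mem_nhdsGT hb)).exists
  refine ⟨y, hyI.1, hyI.2, ?_⟩
  rw [slope_def_field] at hy
  have := (div_pos_iff_of_pos_right (sub_pos.2 hyI.1)).1 hy
  linarith

lemma HasDerivAt.exists_lt_of_neg {f : ℝ → ℝ} {d x : ℝ} (h : HasDerivAt f d x) (hd : d < 0) :
    ∃ y, y < x ∧ f x < f y := by
  have h1 : HasDerivAt (fun y => f (-y)) (-d) (-x) := by
    have := (show HasDerivAt f d (-(-x)) by rwa [neg_neg]).comp (-x) (hasDerivAt_neg (-x))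
    simpa using! this
  obtain ⟨y, hy, -, hf⟩ := HasDerivAt.exists_gt_of_pos h1 (neg_pos.2 hd) (b := -x + 1) (by linarith)
  exact ⟨-y, by linarith, by simpa using hf⟩

lemma lyap_mono [IsProbabilityMeasure P] (hP : Ergodic (shift 1) P)
    (hlog : ∀ z : ℤˣ, Integrable (fun ω => Real.log (trans ω 0 z)) P)
    (hreg : ∀ᵐ ω ∂P, Regular s c ω) {r₁ r₂ : ℝ} (h12 : r₁ ≤ r₂) (h2 : r₂ < c) :
    lyap P s r₁ ≤ lyap P s r₂ :=
  integral_mono_ae (integrable_logZeta hP hlog hreg (h12.trans_lt h2))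
    (integrable_logZeta hP hlog hreg h2) (hreg.mono fun _ hω => hω.logZeta_mono h12 h2)

/-- The large deviation lower bound, by a change of measure. -/
lemma eventually_le_quenchedLaw_nearVelocity [IsProbabilityMeasure P] (hP : Ergodic (shift 1) P)
    (hlog : ∀ z : ℤˣ, Integrable (fun ω => Real.log (trans ω 0 z)) P)
    (hreg : ∀ᵐ ω ∂P, Regular s c ω) (hr : r < c) {ξ : ℝ} (hs : (s : ℤ) * ξ = |ξ|) (hξ : ξ ≠ 0)
    (hderiv : HasDerivAt (lyap P s) |ξ|⁻¹ r) {δ ε : ℝ} (hδ : 0 < δ) (hε : 0 < ε) :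
    ∀ᵐ ω ∂P, ∃ C, ∀ᶠ n : ℕ in atTop, ENNReal.ofReal (Real.exp
      (n * (-(r - |ξ| * lyap P s r) - (δ * |lyap P s r| + ε)) - C)) ≤
        quenchedLaw ω 0 (nearVelocity ξ δ n) := by
  have hξ' : 0 < |ξ| := abs_pos.2 hξ
  -- At `r` this derivative vanishes for `y = |ξ|`, is positive for `y = |ξ| - δ` and negative for
  -- `y = |ξ| + δ`. Moving `r` slightly up or down thus yields a positive exponent `D₁` or `D₂`
  -- against velocities that are too small or too large.
  have hφ : ∀ y, HasDerivAt (fun x => x - y * lyap P s x) (1 - y * |ξ|⁻¹) r := fun y =>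
    (hasDerivAt_id r).sub (hderiv.const_mul y)
  obtain ⟨r₁, h1, h1c, hD1⟩ := HasDerivAt.exists_gt_of_pos (hφ (|ξ| - δ))
    (by rw [sub_mul, mul_inv_cancel₀ hξ'.ne']; simpa using mul_pos hδ (inv_pos.2 hξ')) hr
  obtain ⟨r₂, h2, hD2⟩ := HasDerivAt.exists_lt_of_neg (hφ (|ξ| + δ))
    (by rw [add_mul, mul_inv_cancel₀ hξ'.ne']; simpa using mul_pos hδ (inv_pos.2 hξ'))
  have h2c : r₂ < c := h2.trans hr
  have hmono1 := lyap_mono hP hlog hreg h1.le h1c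
  have hmono2 := lyap_mono hP hlog hreg h2.le hr
  set D₁ := (r₁ - r) - (|ξ| - δ) * (lyap P s r₁ - lyap P s r) with hD₁
  set D₂ := (r₂ - r) - (|ξ| + δ) * (lyap P s r₂ - lyap P s r) with hD₂
  have hD₁pos : 0 < D₁ := by rw [hD₁]; linarith
  have hD₂pos : 0 < D₂ := by rw [hD₂]; linarith
  have hi := fun {x : ℝ} (hx : x < c) => integrable_logZeta hP hlog hreg hx
  filter_upwards [hreg, ae_abs_pot_sub_le hP (hi hr), ae_abs_pot_sub_le hP (hi h1c),
    ae_abs_pot_sub_le hP (hi h2c)] with ω hω p0 p1 p2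
  obtain ⟨C, hC⟩ := p0 ε hε
  obtain ⟨C₁, hC₁⟩ := p0 (D₁ / 4) (by linarith)
  obtain ⟨C₁', hC₁'⟩ := p1 (D₁ / 4) (by linarith)
  obtain ⟨C₂, hC₂⟩ := p0 (D₂ / 4) (by linarith)
  obtain ⟨C₂', hC₂'⟩ := p2 (D₂ / 4) (by linarith)
  -- Each side of wrong velocities eventually has tilted mass at most `1 / 4`, so at least half of
  -- the mass stays near `ξ`; `log 2` accounts for that half.
  refine ⟨C + Real.log 2, ?_⟩
  filter_upwards [eventually_gt_atTop 0,
    eventually_exp_le_of_neg (a := -D₁ + 2 * (D₁ / 4)) (by linarith) (C₁ + C₁')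
      (b := 1 / 4) (by norm_num),
    eventually_exp_le_of_neg (a := -D₂ + 2 * (D₂ / 4)) (by linarith) (C₂ + C₂')
      (b := 1 / 4) (by norm_num)] with n hn hE1 hE2
  have hn' : (0 : ℝ) < n := by exact_mod_cast hn
  have b1 := setLIntegral_tiltWeight_le (n := n) hω h1c (by linarith) hC₁ hC₁' hD₁
    (A := {x : ℤ | ((s : ℤ) : ℝ) * x ≤ n * (|ξ| - δ)})
    (fun x hx => mul_le_mul_of_nonneg_right hx (sub_nonneg.2 hmono1))
  have b2 := setLIntegral_tiltWeight_le (n := n) hω h2c (by linarith) hC₂ hC₂' hD₂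
    (A := {x : ℤ | n * (|ξ| + δ) ≤ ((s : ℤ) : ℝ) * x})
    (fun x hx => mul_le_mul_of_nonpos_right hx (sub_nonpos.2 hmono2))
  set K := n * (-(r - |ξ| * lyap P s r) - (δ * |lyap P s r| + ε)) - (C + Real.log 2) with hK
  have b0 : ∫⁻ X in nearVelocity ξ δ n, tiltWeight s r ω n (X n) ∂(quenchedLaw ω 0) ≤
      ENNReal.ofReal (Real.exp (-K - Real.log 2)) * quenchedLaw ω 0 (nearVelocity ξ δ n) := by
    rw [← setLIntegral_const]
    refine setLIntegral_mono_ae' (measurableSet_nearVelocity ξ δ n) ?_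
    filter_upwards [ae_quenchedLaw_abs_le ω n] with X hXn hX
    have := abs_le.1 (abs_pot_sub_le_of_mem_nearVelocity hn hs hX hXn hε.le hC)
    rw [tiltWeight]
    refine ENNReal.ofReal_le_ofReal (Real.exp_le_exp.2 ?_)
    rw [hK]
    nlinarith [this.1]
  have hcover : (univ : Set (ℕ → ℤ)) ⊆ nearVelocity ξ δ n ∪
      ({X | X n ∈ {x : ℤ | ((s : ℤ) : ℝ) * x ≤ n * (|ξ| - δ)}} ∪
        {X | X n ∈ {x : ℤ | n * (|ξ| + δ) ≤ ((s : ℤ) : ℝ) * x}}) := by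
    intro X _
    by_contra hX
    simp only [mem_union, mem_ofPred_eq, not_or, not_le] at hX
    refine hX.1 ?_
    have hss : ((s : ℤ) : ℝ) * ((s : ℤ) : ℝ) = 1 := by exact_mod_cast units_mul_self s
    have e : (X n : ℝ) / n - ξ = (s : ℤ) * ((((s : ℤ) : ℝ) * X n - n * |ξ|) / n) := by
      rw [← hs]; field_simp; linear_combination (-(X n : ℝ) + n * ξ) * hss
    have habs : |((s : ℤ) : ℝ)| = 1 := by rcases Int.units_eq_one_or s with rfl | rfl <;> simp
    change |(X n : ℝ) / n - ξ| < δ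
    rw [e, abs_mul, habs, one_mul, abs_div, abs_of_pos hn', div_lt_iff₀ hn', abs_lt]
    constructor <;> nlinarith [hX.2.1, hX.2.2]
  have htot : (1 : ℝ≥0∞) ≤ ENNReal.ofReal (Real.exp (-K - Real.log 2)) *
      quenchedLaw ω 0 (nearVelocity ξ δ n) + (ENNReal.ofReal (1 / 4) + ENNReal.ofReal (1 / 4)) := by
    calc (1 : ℝ≥0∞) = ∫⁻ X in univ, tiltWeight s r ω n (X n) ∂(quenchedLaw ω 0) := by
          rw [setLIntegral_univ, hω.lintegral_tiltWeight hr]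
      _ ≤ _ := lintegral_mono_set hcover
      _ ≤ _ := lintegral_union_le _ _ _
      _ ≤ _ := add_le_add b0 ((lintegral_union_le _ _ _).trans (add_le_add
          (b1.trans (ENNReal.ofReal_le_ofReal hE1)) (b2.trans (ENNReal.ofReal_le_ofReal hE2))))
  have hq : quenchedLaw ω 0 (nearVelocity ξ δ n) =
      ENNReal.ofReal (quenchedLaw ω 0 (nearVelocity ξ δ n)).toReal :=
    (ENNReal.ofReal_toReal (measure_ne_top _ _)).symm
  rw [hq] at htot ⊢
  rw [← ENNReal.ofReal_mul (Real.exp_pos _).le, ← ENNReal.ofReal_add (by norm_num) (by norm_num),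
    ← ENNReal.ofReal_add (by positivity) (by norm_num), ← ENNReal.ofReal_one,
    ENNReal.ofReal_le_ofReal_iff (by positivity)] at htot
  refine ENNReal.ofReal_le_ofReal ?_
  rw [Real.exp_sub, Real.exp_log two_pos, Real.exp_neg] at htot
  have hKp := Real.exp_pos K
  have h4 : Real.exp K ≤ Real.exp K * ((Real.exp K)⁻¹ / 2 *
      (quenchedLaw ω 0 (nearVelocity ξ δ n)).toReal + (1 / 4 + 1 / 4)) :=
    le_mul_of_one_le_right hKp.le htot
  have h5 : Real.exp K * ((Real.exp K)⁻¹ / 2 *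
      (quenchedLaw ω 0 (nearVelocity ξ δ n)).toReal + (1 / 4 + 1 / 4)) =
      (quenchedLaw ω 0 (nearVelocity ξ δ n)).toReal / 2 + Real.exp K / 2 := by
    field_simp; ring
  linarith

end Ergodic

end

section

/-! ### The value of the quenched rate function -/

variable {s : ℤˣ} {r c : ℝ} {ω : Env}

lemma map_velocity_Ioo (ω : Env) (ξ δ : ℝ) (n : ℕ) :
    (quenchedLaw ω 0).map (fun X : ℕ → ℤ => (X n : ℝ) / (n : ℝ)) (Ioo (ξ - δ) (ξ + δ)) =
      quenchedLaw ω 0 (nearVelocity ξ δ n) := by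
  have hm : Measurable fun X : ℕ → ℤ => (X n : ℝ) / (n : ℝ) :=
    Measurable.comp (g := fun y : ℤ => (y : ℝ) / (n : ℝ)) .of_discrete (measurable_pi_apply n)
  rw [Measure.map_apply hm measurableSet_Ioo]
  congr 1
  ext X
  simp only [mem_preimage, mem_Ioo, nearVelocity, mem_ofPred_eq, abs_lt]
  constructor <;> rintro ⟨h1, h2⟩ <;> constructor <;> linarith

lemma inv_mul_log_le {n : ℕ} (hn : 0 < n) {q : ℝ≥0∞} {a b : ℝ} (hb : n * a ≤ n * b)
    (hq : q ≤ ENNReal.ofReal (Real.exp (n * a))) :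
    (((n : ℝ)⁻¹ : ℝ) : EReal) * ENNReal.log q ≤ (b : ℝ) := by
  have hn' : (0 : ℝ) < n := by exact_mod_cast hn
  have h1 : ENNReal.log q ≤ ((n * b : ℝ) : EReal) := by
    refine (ENNReal.log_monotone hq).trans ?_
    rw [ENNReal.log_ofReal_of_pos (Real.exp_pos _), Real.log_exp]
    exact_mod_cast hb
  refine (mul_le_mul_of_nonneg_left h1 (by exact_mod_cast (inv_pos.2 hn').le)).trans_eq ?_
  rw [← EReal.coe_mul, inv_mul_cancel_left₀ hn'.ne']

lemma le_inv_mul_log {n : ℕ} (hn : 0 < n) {q : ℝ≥0∞} {a b : ℝ} (hb : n * b ≤ n * a)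
    (hq : ENNReal.ofReal (Real.exp (n * a)) ≤ q) :
    ((b : ℝ) : EReal) ≤ (((n : ℝ)⁻¹ : ℝ) : EReal) * ENNReal.log q := by
  have hn' : (0 : ℝ) < n := by exact_mod_cast hn
  have h1 : ((n * b : ℝ) : EReal) ≤ ENNReal.log q := by
    refine le_trans ?_ (ENNReal.log_monotone hq)
    rw [ENNReal.log_ofReal_of_pos (Real.exp_pos _), Real.log_exp]
    exact_mod_cast hb
  refine le_trans (le_of_eq ?_) (mul_le_mul_of_nonneg_left h1 (by exact_mod_cast (inv_pos.2 hn').le))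
  rw [← EReal.coe_mul, inv_mul_cancel_left₀ hn'.ne']

variable {P : Measure Env} [IsProbabilityMeasure P]

/-- The lower bound of the large deviation principle on a small open interval around `ξ` is
confronted with the upper bound `quenchedLaw_nearVelocity_le`, at one typical environment. -/
lemma ofReal_le_of_isQuenchedRateFunction (hP : Ergodic (shift 1) P)
    (hlog : ∀ z : ℤˣ, Integrable (fun ω => Real.log (trans ω 0 z)) P)
    (hreg : ∀ᵐ ω ∂P, Regular s c ω) (hr : r < c) {ξ : ℝ} (hs : (s : ℤ) * ξ = |ξ|)
    {I : ℝ → ℝ≥0∞} (hI : IsQuenchedRateFunction P I) :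
    ((r - |ξ| * lyap P s r : ℝ) : EReal) ≤ I ξ := by
  set J := r - |ξ| * lyap P s r with hJ
  refine EReal.ge_of_forall_gt_iff_ge.1 fun η hη => ?_
  have hη' : η < J := by exact_mod_cast hη
  set κ := J - η with hκ
  have hκ0 : 0 < κ := by linarith
  -- A quarter of the gap `κ` each goes to the width of the window, the ergodic error and the
  -- additive constant; the `1` covers the case `λ(r) = 0`.
  set δ := κ / (4 * (|lyap P s r| + 1)) with hδ
  have hδ0 : 0 < δ := by positivity
  have hδ1 : δ * |lyap P s r| ≤ κ / 4 := by
    rw [hδ, div_mul_eq_mul_div, div_le_div_iff₀ (by positivity) (by norm_num)]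
    nlinarith [abs_nonneg (lyap P s r)]
  obtain ⟨ω, hω, hpot, hldp⟩ := (hreg.and ((ae_abs_pot_sub_le hP
    (integrable_logZeta hP hlog hreg hr)).and hI)).exists
  obtain ⟨C, hC⟩ := hpot (κ / 4) (by linarith)
  have h1 := (hldp.2 (Ioo (ξ - δ) (ξ + δ)) measurableSet_Ioo).1
  rw [isOpen_Ioo.interior_eq] at h1
  have h2 : -(I ξ : EReal) ≤ ((-η : ℝ) : EReal) := by
    refine (EReal.neg_le_neg_iff.2 (iInf₂_le ξ ⟨by linarith, by linarith⟩)).trans (h1.trans ?_)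
    refine (liminf_le_limsup).trans (limsup_le_of_le (h := ?_))
    filter_upwards [eventually_gt_atTop 0, eventually_ge_atTop ⌈4 * |C| / κ⌉₊] with n hn hn2
    have hn' : (0 : ℝ) < n := by exact_mod_cast hn
    have hCn : C ≤ n * (κ / 4) := by
      have h3 : 4 * |C| / κ ≤ n := (Nat.le_ceil _).trans (by exact_mod_cast hn2)
      rw [div_le_iff₀ hκ0] at h3
      linarith [le_abs_self C]
    rw [map_velocity_Ioo]
    refine inv_mul_log_le hn (a := -J + (δ * |lyap P s r| + κ / 4) + κ / 4)
      (mul_le_mul_of_nonneg_left (by linarith) hn'.le)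
      ((quenchedLaw_nearVelocity_le hn hω hr hs (by linarith) hC).trans ?_)
    refine ENNReal.ofReal_le_ofReal (Real.exp_le_exp.2 ?_)
    rw [hJ]
    nlinarith
  rw [EReal.coe_neg, EReal.neg_le_neg_iff] at h2
  exact h2

/-- The upper bound of the large deviation principle concerns the closed interval, where lower
semicontinuity keeps the rate function above a value exceeding the claimed one. The change of
measure makes the probability too large for this. -/
lemma le_ofReal_of_isQuenchedRateFunction (hP : Ergodic (shift 1) P)
    (hlog : ∀ z : ℤˣ, Integrable (fun ω => Real.log (trans ω 0 z)) P)
    (hreg : ∀ᵐ ω ∂P, Regular s c ω) (hr : r < c) {ξ : ℝ} (hs : (s : ℤ) * ξ = |ξ|) (hξ : ξ ≠ 0)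
    (hderiv : HasDerivAt (lyap P s) |ξ|⁻¹ r) (hJ0 : 0 ≤ r - |ξ| * lyap P s r)
    {I : ℝ → ℝ≥0∞} (hI : IsQuenchedRateFunction P I) :
    (I ξ : EReal) ≤ ((r - |ξ| * lyap P s r : ℝ) : EReal) := by
  set J := r - |ξ| * lyap P s r with hJ
  by_contra! hlt
  obtain ⟨η, hη1, hη2⟩ := EReal.lt_iff_exists_real_btwn.1 hlt
  have hη' : J < η := by exact_mod_cast hη1
  set κ := η - J with hκ
  have hκ0 : 0 < κ := by linarith
  obtain ⟨ω₀, hω₀⟩ := hI.exists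
  have hlt' : ENNReal.ofReal η < I ξ := by
    rw [← EReal.coe_ennreal_lt_coe_ennreal_iff, EReal.coe_ennreal_ofReal, max_eq_left (by linarith)]
    exact hη2
  obtain ⟨δ₁, hδ₁, hball⟩ := Metric.eventually_nhds_iff.1 (hω₀.1 ξ _ hlt')
  -- Half of `δ₁` keeps the closed interval inside the open ball given by semicontinuity.
  set δ := min (δ₁ / 2) (κ / (4 * (|lyap P s r| + 1))) with hδ
  have hδ0 : 0 < δ := lt_min (by positivity) (by positivity)
  have hδ1 : δ * |lyap P s r| ≤ κ / 4 := by
    refine (mul_le_mul_of_nonneg_right (min_le_right _ _) (abs_nonneg _)).trans ?_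
    rw [div_mul_eq_mul_div, div_le_div_iff₀ (by positivity) (by norm_num)]
    nlinarith [abs_nonneg (lyap P s r)]
  obtain ⟨ω, hlow, hldp⟩ := ((eventually_le_quenchedLaw_nearVelocity hP hlog hreg hr hs hξ hderiv hδ0
    (ε := κ / 4) (by linarith)).and hI).exists
  obtain ⟨C, hC⟩ := hlow
  have h1 := (hldp.2 (Ioo (ξ - δ) (ξ + δ)) measurableSet_Ioo).2
  have h2 : ((η : ℝ) : EReal) ≤ ⨅ x ∈ closure (Ioo (ξ - δ) (ξ + δ)), (I x : EReal) := by
    refine le_iInf₂ fun x hx => ?_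
    have hx' := closure_minimal Ioo_subset_Icc_self isClosed_Icc hx
    have h3 : ENNReal.ofReal η < I x := by
      refine hball ?_
      rw [Real.dist_eq]
      have h4 : |x - ξ| ≤ δ := abs_le.2 ⟨by linarith [hx'.1], by linarith [hx'.2]⟩
      exact h4.trans_lt ((min_le_left _ _).trans_lt (half_lt_self hδ₁))
    have h4 : ((ENNReal.ofReal η : ℝ≥0∞) : EReal) ≤ I x := by exact_mod_cast h3.le
    refine le_trans ?_ h4
    rw [EReal.coe_ennreal_ofReal]
    exact_mod_cast le_max_left η 0
  have h5 : ((-(J + 3 * κ / 4) : ℝ) : EReal) ≤ ((-η : ℝ) : EReal) := by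
    rw [EReal.coe_neg η]
    refine le_trans ?_ (h1.trans (EReal.neg_le_neg_iff.2 h2))
    refine le_trans (le_liminf_of_le (h := ?_)) liminf_le_limsup
    filter_upwards [hC, eventually_gt_atTop 0, eventually_ge_atTop ⌈4 * |C| / κ⌉₊] with n hn0 hn hn2
    have hn' : (0 : ℝ) < n := by exact_mod_cast hn
    have hCn : C ≤ n * (κ / 4) := by
      have h3 : 4 * |C| / κ ≤ n := (Nat.le_ceil _).trans (by exact_mod_cast hn2)
      rw [div_le_iff₀ hκ0] at h3
      linarith [le_abs_self C]
    rw [map_velocity_Ioo]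
    refine le_inv_mul_log hn (a := -J - (δ * |lyap P s r| + κ / 4) - κ / 4)
      (mul_le_mul_of_nonneg_left (by linarith) hn'.le) (le_trans ?_ hn0)
    refine ENNReal.ofReal_le_ofReal (Real.exp_le_exp.2 ?_)
    rw [hJ]
    nlinarith
  have h6 : -(J + 3 * κ / 4) ≤ -η := by exact_mod_cast h5
  linarith

end

section

/-! ### Pair measures and their components -/

instance units_int_measurableSingletonClass : MeasurableSingletonClass ℤˣ where
  measurableSet_singleton z := by
    have : ({z} : Set ℤˣ) = (fun u : ℤˣ => (u : ℤ)) ⁻¹' {(z : ℤ)} := by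
      ext u; simp [Units.ext_iff]
    rw [this]
    exact (comap_measurable _) (measurableSet_singleton _)

lemma component_apply (μ : Measure (Env × ℤˣ)) (z : ℤˣ) {A : Set Env} (hA : MeasurableSet A) :
    component μ z A = μ (A ×ˢ {z}) := by
  rw [component, Measure.fst_apply hA, Measure.restrict_apply (measurable_fst hA)]
  rfl

/-- The measure on pairs with the components `m z`. -/
def ofComponents (m : ℤˣ → Measure Env) : Measure (Env × ℤˣ) :=
  ∑ z, (m z).map (fun ω => (ω, z))

lemma component_ofComponents (m : ℤˣ → Measure Env) (z : ℤˣ) :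
    component (ofComponents m) z = m z := by
  ext A hA
  rw [component_apply _ _ hA, ofComponents, Measure.coe_finsetSum, Finset.sum_apply]
  rw [Finset.sum_eq_single z]
  · rw [Measure.map_apply measurable_prodMk_right (hA.prod (measurableSet_singleton z))]
    congr 1; ext ω; simp
  · intro z' _ hz'
    rw [Measure.map_apply measurable_prodMk_right (hA.prod (measurableSet_singleton z))]
    have : (fun ω : Env => (ω, z')) ⁻¹' (A ×ˢ {z}) = ∅ := by ext ω; simp [hz']
    rw [this, measure_empty]
  · exact fun h => absurd (Finset.mem_univ z) h

lemma lintegral_eq_sum_component (μ : Measure (Env × ℤˣ)) {f : Env × ℤˣ → ℝ≥0∞}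
    (hf : Measurable f) : ∫⁻ p, f p ∂μ = ∑ z, ∫⁻ ω, f (ω, z) ∂(component μ z) := by
  have hm : ∀ z : ℤˣ, MeasurableSet {p : Env × ℤˣ | p.2 = z} := fun z =>
    measurable_snd (measurableSet_singleton z)
  have h1 : ∀ z : ℤˣ, ∫⁻ ω, f (ω, z) ∂(component μ z) = ∫⁻ p in {p | p.2 = z}, f p ∂μ := by
    intro z
    rw [component, Measure.fst, lintegral_map (f := fun ω => f (ω, z))
      (hf.comp measurable_prodMk_right) measurable_fst]
    refine setLIntegral_congr_fun (hm z) fun p hp => ?_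
    have : p.2 = z := hp
    rw [← this]
  simp_rw [h1]
  rw [sum_units 1, ← lintegral_union (hm _), ← setLIntegral_univ]
  · congr 2
    ext ⟨ω, z⟩
    rcases Int.units_eq_one_or z with rfl | rfl <;> simp
  · refine Set.disjoint_left.2 fun p hp hp' => ?_
    have h2 : p.2 = 1 := hp
    have h3 : p.2 = -1 := hp'
    rw [h2] at h3
    exact absurd h3 (by decide)

lemma measure_ext_component {μ ν : Measure (Env × ℤˣ)} (h : ∀ z, component μ z = component ν z) :
    μ = ν := by
  refine Measure.ext_of_lintegral _ fun f hf => ?_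
  rw [lintegral_eq_sum_component μ hf, lintegral_eq_sum_component ν hf]
  simp_rw [h]

lemma fst_eq_sum_component (μ : Measure (Env × ℤˣ)) : μ.fst = ∑ z, component μ z := by
  refine Measure.ext_of_lintegral _ fun f hf => ?_
  rw [Measure.fst, lintegral_map hf measurable_fst,
    lintegral_eq_sum_component μ (f := fun p => f p.1) (hf.comp measurable_fst), lintegral_finsetSum_measure]

lemma measurable_shift_pair : Measurable fun p : Env × ℤˣ => shift (p.2 : ℤ) p.1 :=
  measurable_from_prod_countable_left fun z => measurable_shift z

lemma sndMarginal_eq_sum (μ : Measure (Env × ℤˣ)) :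
    sndMarginal μ = ∑ z : ℤˣ, (component μ z).map (shift z) := by
  refine Measure.ext_of_lintegral _ fun f hf => ?_
  rw [sndMarginal, lintegral_map hf measurable_shift_pair,
    lintegral_eq_sum_component μ (f := fun p => f (shift (p.2 : ℤ) p.1))
      (hf.comp measurable_shift_pair), lintegral_finsetSum_measure]
  refine Finset.sum_congr rfl fun z _ => ?_
  rw [lintegral_map hf (measurable_shift _)]

lemma component_le_fst (μ : Measure (Env × ℤˣ)) (z : ℤˣ) : component μ z ≤ μ.fst := by
  rw [fst_eq_sum_component, sum_units z]
  exact Measure.le_add_right le_rfl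

instance component_isFiniteMeasure (μ : Measure (Env × ℤˣ)) [IsFiniteMeasure μ] (z : ℤˣ) :
    IsFiniteMeasure (component μ z) := isFiniteMeasure_of_le _ (component_le_fst μ z)

lemma integral_step (μ : Measure (Env × ℤˣ)) [IsFiniteMeasure μ] (s : ℤˣ) :
    ∫ p, (((p.2 : ℤˣ) : ℤ) : ℝ) ∂μ =
      (s : ℤ) * ((component μ s).real univ - (component μ (-s)).real univ) := by
  have hm : ∀ z : ℤˣ, MeasurableSet {p : Env × ℤˣ | p.2 = z} := fun z =>
    measurable_snd (measurableSet_singleton z)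
  have e : (fun p : Env × ℤˣ => (((p.2 : ℤˣ) : ℤ) : ℝ)) = fun p =>
      {p : Env × ℤˣ | p.2 = s}.indicator (fun _ => ((s : ℤ) : ℝ)) p +
      {p : Env × ℤˣ | p.2 = -s}.indicator (fun _ => -((s : ℤ) : ℝ)) p := by
    funext ⟨ω, z⟩
    rcases Int.units_eq_one_or s with rfl | rfl <;> rcases Int.units_eq_one_or z with rfl | rfl <;>
      simp [Set.indicator]
  have hc : ∀ z, (component μ z).real univ = μ.real {p | p.2 = z} := by
    intro z
    rw [Measure.real, Measure.real, component_apply μ z MeasurableSet.univ]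
    congr 2; ext p; simp
  rw [e, integral_add ((integrable_const _).indicator (hm _)) ((integrable_const _).indicator (hm _)),
    integral_indicator_const _ (hm _), integral_indicator_const _ (hm _), hc, hc]
  simp only [smul_eq_mul]
  ring

lemma withDensity_map_shift {P : Measure Env} (hP : MeasurePreserving (shift 1) P P) (y : ℤ)
    {f : Env → ℝ≥0∞} (hf : Measurable f) :
    (P.withDensity f).map (shift y) = P.withDensity (fun ω => f (shift (-y) ω)) := by
  refine Measure.ext_of_lintegral _ fun g hg => ?_
  rw [lintegral_map hg (measurable_shift y), lintegral_withDensity_eq_lintegral_mul (g := fun ω => g (shift y ω)) _ hf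
    (hg.comp (measurable_shift y)), lintegral_withDensity_eq_lintegral_mul
    (f := fun ω => f (shift (-y) ω)) _ (hf.comp (measurable_shift (-y))) hg,
    ← (measurePreserving_shift hP y).lintegral_comp
      (f := (fun ω => f (shift (-y) ω)) * g) ((hf.comp (measurable_shift (-y))).mul hg)]
  refine lintegral_congr fun ω => ?_
  simp [shift_shift, shift_zero]

/-! ### The corrector -/

variable {s : ℤˣ} {r c : ℝ} {ω : Env} {P : Measure Env}

lemma corrector_self (P : Measure Env) (s : ℤˣ) (r : ℝ) (ω : Env) :
    corrector P s r ω s = lyap P s r - logZeta s r ω := if_pos rfl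

lemma corrector_neg (P : Measure Env) (s : ℤˣ) (r : ℝ) (ω : Env) :
    corrector P s r ω (-s) = logZeta s r (shift (-(s : ℤ)) ω) - lyap P s r :=
  if_neg (neg_units_ne s)

lemma eq_or_eq_neg_units (s z : ℤˣ) : z = s ∨ z = -s := by
  rcases Int.units_eq_one_or s with rfl | rfl <;> rcases Int.units_eq_one_or z with rfl | rfl <;> decide

/-- The corrector is a gradient. -/
lemma corrector_eq_sub (P : Measure Env) (s : ℤˣ) (r : ℝ) (ω : Env) (x : ℤ) (z : ℤˣ) :
    corrector P s r (shift x ω) z =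
      ((s : ℤ) * ((x + z : ℤ) : ℝ) * lyap P s r - pot s r ω (x + z)) -
        ((s : ℤ) * (x : ℝ) * lyap P s r - pot s r ω x) := by
  have hss : ((s : ℤ) : ℝ) * ((s : ℤ) : ℝ) = 1 := by exact_mod_cast units_mul_self s
  rcases eq_or_eq_neg_units s z with rfl | rfl
  · rw [corrector_self, pot_add_self]; push_cast; linear_combination (-lyap P z r) * hss
  · rw [corrector_neg, pot_add_neg]; push_cast; linear_combination (lyap P s r) * hss

lemma tilt_eq (P : Measure Env) (s : ℤˣ) (r : ℝ) (ω : Env) (z : ℤˣ) :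
    tilt s r ω z = trans ω 0 z * Real.exp (-(((s : ℤ) : ℝ) * lyap P s r) * ((z : ℤ) : ℝ) +
      corrector P s r ω z + r) := by
  have hss : ((s : ℤ) : ℝ) * ((s : ℤ) : ℝ) = 1 := by exact_mod_cast units_mul_self s
  rcases eq_or_eq_neg_units s z with rfl | rfl
  · rw [tilt_self, corrector_self]; congr 2; linear_combination (lyap P z r) * hss
  · rw [tilt_neg, corrector_neg]; push_cast; congr 2; linear_combination (-lyap P s r) * hss

lemma memLp_log_trans {α : ℝ} (hα : 0 < α) {z : ℤˣ}
    (h : Integrable (fun ω => |Real.log (trans ω 0 z)| ^ (1 + α)) P) :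
    MemLp (fun ω => Real.log (trans ω 0 z)) (ENNReal.ofReal (1 + α)) P := by
  have hm : AEStronglyMeasurable (fun ω => Real.log (trans ω 0 z)) P :=
    (Real.measurable_log.comp (measurable_trans 0 z)).aestronglyMeasurable
  rw [← integrable_norm_rpow_iff hm (by simp; linarith) ENNReal.ofReal_ne_top,
    ENNReal.toReal_ofReal (by linarith)]
  simpa only [Real.norm_eq_abs] using h

/-- The moments come from the bound on `|log ζ|` and the mean zero from stationarity. Closed loops
telescope because the corrector is a gradient, for every environment. -/
lemma inClassK_corrector [IsProbabilityMeasure P] (hP : Ergodic (shift 1) P) {α : ℝ} (hα : 0 < α)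
    (hmoment : ∀ z : ℤˣ, Integrable (fun ω => |Real.log (trans ω 0 z)| ^ (1 + α)) P)
    (hreg : ∀ᵐ ω ∂P, Regular s c ω) (hr : r < c) : InClassK P (corrector P s r) := by
  have hmp := measurePreserving_shift hP.toMeasurePreserving
  have hL := fun z => memLp_log_trans hα (hmoment z)
  have hlog : ∀ z : ℤˣ, Integrable (fun ω => Real.log (trans ω 0 z)) P := fun z =>
    (hL z).integrable (by rw [← ENNReal.ofReal_one]; exact ENNReal.ofReal_le_ofReal (by linarith))
  have hi := integrable_logZeta hP hlog hreg hr
  have hg : MemLp (logZeta s r) (ENNReal.ofReal (1 + α)) P := by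
    have h1 : MemLp (fun ω => |Real.log (trans ω 0 s)|) (ENNReal.ofReal (1 + α)) P := (hL s).abs
    have h2 : MemLp (fun ω => |Real.log (trans ω 0 (-s))|) (ENNReal.ofReal (1 + α)) P := (hL (-s)).abs
    have h3 := h2.comp_measurePreserving (hmp s)
    have hb := ((memLp_const (p := ENNReal.ofReal (1 + α)) (μ := P) |r|).add h1).add h3
    refine hb.mono' (measurable_logZeta s r).aestronglyMeasurable ?_
    filter_upwards [hreg] with ω hω using hω.abs_logZeta_le hr
  have hself : (fun ω => corrector P s r ω s) = fun ω => lyap P s r - logZeta s r ω :=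
    funext fun ω => corrector_self P s r ω
  have hneg : (fun ω => corrector P s r ω (-s)) =
      fun ω => logZeta s r (shift (-(s : ℤ)) ω) - lyap P s r :=
    funext fun ω => corrector_neg P s r ω
  have hint : ∫ ω, logZeta s r (shift (-(s : ℤ)) ω) ∂P = lyap P s r :=
    MeasurePreserving.integral_comp_of_aestronglyMeasurable (hmp _) hi.aestronglyMeasurable
  have hi' : Integrable (fun ω => logZeta s r (shift (-(s : ℤ)) ω)) P :=
    (hmp _).integrable_comp_of_integrable hi
  refine ⟨fun z => ?_, fun z => ⟨α, hα, ?_⟩, fun z => ?_, ae_of_all _ fun ω n x z hx hn => ?_⟩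
  · rcases eq_or_eq_neg_units s z with rfl | rfl
    · rw [hself]; exact (measurable_logZeta _ r).const_sub _
    · rw [hneg]; exact ((measurable_logZeta s r).comp (measurable_shift _)).sub_const _
  · rcases eq_or_eq_neg_units s z with rfl | rfl
    · rw [hself]; exact (memLp_const _).sub hg
    · rw [hneg]; exact (hg.comp_measurePreserving (hmp _)).sub (memLp_const _)
  · rcases eq_or_eq_neg_units s z with rfl | rfl
    · rw [hself, integral_sub (integrable_const _) hi]; simp [lyap]
    · rw [hneg, integral_sub hi' (integrable_const _), hint]; simp
  · have : ∀ k ∈ Finset.range n, corrector P s r (shift (x k) ω) (z k) =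
        ((s : ℤ) * (x (k + 1) : ℝ) * lyap P s r - pot s r ω (x (k + 1))) -
        ((s : ℤ) * (x k : ℝ) * lyap P s r - pot s r ω (x k)) := by
      intro k hk
      rw [corrector_eq_sub, hx k (Finset.mem_range.1 hk)]
    rw [Finset.sum_congr rfl this,
      Finset.sum_range_sub (fun k => (s : ℤ) * (x k : ℝ) * lyap P s r - pot s r ω (x k)), hn, sub_self]

end

section

/-! ### The invariant density of the tilted environment process -/

variable {s : ℤˣ} {r c : ℝ} {ω : Env} {P : Measure Env}

lemma measurable_tilt (s : ℤˣ) (r : ℝ) (z : ℤˣ) : Measurable fun ω => tilt s r ω z := by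
  rcases eq_or_eq_neg_units s z with rfl | rfl
  · simp only [tilt_self]
    exact (measurable_trans 0 _).mul (Real.measurable_exp.comp ((measurable_logZeta _ r).const_sub _))
  · simp only [tilt_neg]
    exact (measurable_trans 0 _).mul (Real.measurable_exp.comp
      (((measurable_logZeta s r).comp (measurable_shift _)).const_add _))

/-- The operator `u ↦ (b u) ∘ T / a`, where `a` and `b` are the tilted probabilities of a step in the
direction `s` and `-s`. -/
def forwardOp (s : ℤˣ) (r : ℝ) (u : Env → ℝ≥0∞) (ω : Env) : ℝ≥0∞ :=
  ENNReal.ofReal (tilt s r ω s)⁻¹ * (ENNReal.ofReal (tilt s r (shift s ω) (-s)) * u (shift s ω))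

/-- The operator `u ↦ b (u ∘ T⁻¹) / a`, where `a` and `b` are the tilted probabilities of a step in
the direction `s` and `-s`. -/
def backwardOp (s : ℤˣ) (r : ℝ) (u : Env → ℝ≥0∞) (ω : Env) : ℝ≥0∞ :=
  ENNReal.ofReal (tilt s r ω s)⁻¹ * (ENNReal.ofReal (tilt s r ω (-s)) * u (shift (-(s : ℤ)) ω))

/-- The inverse of the tilted probability of a step in the direction `s`. -/
def invTilt (s : ℤˣ) (r : ℝ) (ω : Env) : ℝ≥0∞ := ENNReal.ofReal (tilt s r ω s)⁻¹

lemma measurable_invTilt (s : ℤˣ) (r : ℝ) : Measurable (invTilt s r) :=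
  (measurable_tilt s r s).inv.ennreal_ofReal

lemma measurable_forwardOp {u : Env → ℝ≥0∞} (hu : Measurable u) : Measurable (forwardOp s r u) :=
  (measurable_invTilt s r).mul (((measurable_tilt s r (-s)).comp
    (measurable_shift s)).ennreal_ofReal.mul (hu.comp (measurable_shift s)))

lemma measurable_backwardOp {u : Env → ℝ≥0∞} (hu : Measurable u) : Measurable (backwardOp s r u) :=
  (measurable_invTilt s r).mul ((measurable_tilt s r (-s)).ennreal_ofReal.mul
    (hu.comp (measurable_shift _)))

lemma measurable_iterate {A : (Env → ℝ≥0∞) → Env → ℝ≥0∞}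
    (hA : ∀ u, Measurable u → Measurable (A u)) {u : Env → ℝ≥0∞} (hu : Measurable u) (k : ℕ) :
    Measurable (A^[k] u) := by
  induction k with
  | zero => exact hu
  | succ k ih => rw [Function.iterate_succ']; exact hA _ ih

lemma Regular.ofReal_tilt_mul_invTilt (h : Regular s c ω) (r : ℝ) :
    ENNReal.ofReal (tilt s r ω s) * invTilt s r ω = 1 := by
  rw [invTilt, ← ENNReal.ofReal_mul (h.tilt_pos r s).le, mul_inv_cancel₀ (h.tilt_pos r s).ne',
    ENNReal.ofReal_one]

/-- The two operators are adjoint for the weight `a`. -/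
lemma lintegral_forwardOp_mul (hP : Ergodic (shift 1) P) (hreg : ∀ᵐ ω ∂P, Regular s c ω)
    {u w : Env → ℝ≥0∞} (hu : Measurable u) (hw : Measurable w) :
    ∫⁻ ω, forwardOp s r u ω * (ENNReal.ofReal (tilt s r ω s) * w ω) ∂P =
      ∫⁻ ω, u ω * (ENNReal.ofReal (tilt s r ω s) * backwardOp s r w ω) ∂P := by
  set f : Env → ℝ≥0∞ := fun ω => u ω * (ENNReal.ofReal (tilt s r ω (-s)) * w (shift (-(s : ℤ)) ω))
    with hf
  have hfm : Measurable f := hu.mul ((measurable_tilt s r (-s)).ennreal_ofReal.mul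
    (hw.comp (measurable_shift _)))
  have h1 : ∫⁻ ω, forwardOp s r u ω * (ENNReal.ofReal (tilt s r ω s) * w ω) ∂P =
      ∫⁻ ω, f (shift s ω) ∂P := by
    refine lintegral_congr_ae (hreg.mono fun ω hω => ?_)
    have := hω.ofReal_tilt_mul_invTilt r
    simp only [hf, forwardOp, shift_shift, neg_add_cancel, shift_zero]
    calc _ = (ENNReal.ofReal (tilt s r ω s) * invTilt s r ω) * (u (shift s ω) *
        (ENNReal.ofReal (tilt s r (shift s ω) (-s)) * w ω)) := by rw [invTilt]; ring
      _ = _ := by rw [this, one_mul]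
  have h2 : ∫⁻ ω, u ω * (ENNReal.ofReal (tilt s r ω s) * backwardOp s r w ω) ∂P = ∫⁻ ω, f ω ∂P := by
    refine lintegral_congr_ae (hreg.mono fun ω hω => ?_)
    have := hω.ofReal_tilt_mul_invTilt r
    simp only [hf, backwardOp]
    calc _ = (ENNReal.ofReal (tilt s r ω s) * invTilt s r ω) * (u ω *
        (ENNReal.ofReal (tilt s r ω (-s)) * w (shift (-(s : ℤ)) ω))) := by rw [invTilt]; ring
      _ = _ := by rw [this, one_mul]
  rw [h1, h2]
  exact (measurePreserving_shift hP.toMeasurePreserving s).lintegral_comp hfm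

/-- Powers of adjoint operators are adjoint for the weight `a`; applied to `1 / a` on both sides,
the weight cancels. This transfers the bound by `τ` to the series of the invariant density. -/
lemma lintegral_iterate_forwardOp (hP : Ergodic (shift 1) P) (hreg : ∀ᵐ ω ∂P, Regular s c ω)
    (k : ℕ) : ∫⁻ ω, (forwardOp s r)^[k] (invTilt s r) ω ∂P =
      ∫⁻ ω, (backwardOp s r)^[k] (invTilt s r) ω ∂P := by
  have key : ∀ (k : ℕ) (u w : Env → ℝ≥0∞), Measurable u → Measurable w →
      ∫⁻ ω, (forwardOp s r)^[k] u ω * (ENNReal.ofReal (tilt s r ω s) * w ω) ∂P =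
      ∫⁻ ω, u ω * (ENNReal.ofReal (tilt s r ω s) * (backwardOp s r)^[k] w ω) ∂P := by
    intro k
    induction k with
    | zero => intro u w _ _; rfl
    | succ k ih =>
      intro u w hu hw
      rw [Function.iterate_succ', Function.comp_apply, lintegral_forwardOp_mul hP hreg
        (measurable_iterate (fun _ => measurable_forwardOp) hu k) hw,
        ih u _ hu (measurable_backwardOp hw), Function.iterate_succ, Function.comp_apply]
  have hm := measurable_invTilt s r
  have := key k _ _ hm hm
  rw [lintegral_congr_ae (hreg.mono fun ω hω => by
    rw [hω.ofReal_tilt_mul_invTilt r, mul_one])] at this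
  rw [this]
  refine lintegral_congr_ae (hreg.mono fun ω hω => ?_)
  dsimp only
  rw [← mul_assoc, mul_comm (invTilt s r ω), hω.ofReal_tilt_mul_invTilt r, one_mul]

/-- The first-step equation reads `τ = 1 / a + backwardOp τ`; since `τ` is nonnegative, it dominates
the partial sums of the Neumann series of this equation. -/
lemma Regular.sum_backwardOp_le (h : Regular s c ω) (hr : r < c) (n : ℕ) :
    ∑ k ∈ Finset.range n, (backwardOp s r)^[k] (invTilt s r) ω ≤
      ENNReal.ofReal (meanPassage s r ω) := by
  induction n generalizing ω with
  | zero => simp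
  | succ n ih =>
    have hs := h.comp_shift (-(s : ℤ))
    have h1 : ∑ k ∈ Finset.range n, (backwardOp s r)^[k + 1] (invTilt s r) ω =
        backwardOp s r (fun ω => ∑ k ∈ Finset.range n, (backwardOp s r)^[k] (invTilt s r) ω) ω := by
      simp only [backwardOp, Finset.mul_sum, Function.iterate_succ', Function.comp_apply]
    rw [Finset.sum_range_succ', h1]
    have h2 := h.meanPassage_eq hr
    have ht := h.tilt_pos r s
    have h3 : meanPassage s r ω = (tilt s r ω s)⁻¹ * (tilt s r ω (-s) *
        meanPassage s r (shift (-(s : ℤ)) ω)) + (tilt s r ω s)⁻¹ := by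
      field_simp; linarith
    have hn := hs.meanPassage_nonneg hr
    have ht' := h.tilt_pos r (-s)
    have hi := (inv_pos.2 ht).le
    rw [h3, ENNReal.ofReal_add (mul_nonneg hi (mul_nonneg ht'.le hn)) hi,
      ENNReal.ofReal_mul hi, ENNReal.ofReal_mul ht'.le]
    refine add_le_add ?_ le_rfl
    unfold backwardOp
    gcongr
    exact ih hs

/-- The unnormalized invariant density of the tilted environment process. -/
def invariantDensity (s : ℤˣ) (r : ℝ) (ω : Env) : ℝ≥0∞ :=
  ∑' k, (forwardOp s r)^[k] (invTilt s r) ω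

lemma measurable_invariantDensity (s : ℤˣ) (r : ℝ) : Measurable (invariantDensity s r) :=
  Measurable.tsum fun k =>
    measurable_iterate (fun _ => measurable_forwardOp) (measurable_invTilt s r) k

lemma invariantDensity_eq (s : ℤˣ) (r : ℝ) (ω : Env) :
    invariantDensity s r ω = invTilt s r ω + forwardOp s r (invariantDensity s r) ω := by
  unfold invariantDensity
  rw [tsum_eq_zero_add' ENNReal.summable]
  simp only [Function.iterate_succ', Function.comp_apply, forwardOp, ENNReal.tsum_mul_left]
  rfl

/-- The recursion says that `φ` has flux one across every bond. Its mass is finite because the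
adjoint series is dominated by `τ`, and equals `∫ τ` because `φ - τ` is an integrable coboundary. -/
lemma exists_invariantDensity [IsProbabilityMeasure P] (hP : Ergodic (shift 1) P)
    (hreg : ∀ᵐ ω ∂P, Regular s c ω) (hr : r < c) (hτ : Integrable (meanPassage s r) P) :
    ∃ φ : Env → ℝ, Measurable φ ∧ Integrable φ P ∧ (∀ᵐ ω ∂P, 0 < φ ω) ∧
      (∀ᵐ ω ∂P, tilt s r ω s * φ ω = 1 + tilt s r (shift s ω) (-s) * φ (shift s ω)) ∧
      ∫ ω, φ ω ∂P = ∫ ω, meanPassage s r ω ∂P := by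
  have hmp := measurePreserving_shift hP.toMeasurePreserving
  have hfin : ∫⁻ ω, invariantDensity s r ω ∂P < ∞ := by
    calc ∫⁻ ω, invariantDensity s r ω ∂P
        = ∑' k, ∫⁻ ω, (forwardOp s r)^[k] (invTilt s r) ω ∂P :=
          lintegral_tsum fun k => (measurable_iterate (fun _ => measurable_forwardOp)
            (measurable_invTilt s r) k).aemeasurable
      _ = ∑' k, ∫⁻ ω, (backwardOp s r)^[k] (invTilt s r) ω ∂P := by
          simp_rw [lintegral_iterate_forwardOp hP hreg]
      _ = ∫⁻ ω, ∑' k, (backwardOp s r)^[k] (invTilt s r) ω ∂P :=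
          (lintegral_tsum fun k => (measurable_iterate (fun _ => measurable_backwardOp)
            (measurable_invTilt s r) k).aemeasurable).symm
      _ ≤ ∫⁻ ω, ENNReal.ofReal (meanPassage s r ω) ∂P := by
          refine lintegral_mono_ae (hreg.mono fun ω hω => ?_)
          rw [ENNReal.tsum_eq_iSup_nat]
          exact iSup_le fun n => hω.sum_backwardOp_le hr n
      _ < ∞ := hτ.lintegral_lt_top
  have hm := measurable_invariantDensity s r
  have hlt : ∀ᵐ ω ∂P, invariantDensity s r ω < ∞ := ae_lt_top hm hfin.ne
  have hltT := (hmp s).quasiMeasurePreserving.tendsto_ae.eventually hlt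
  set φ : Env → ℝ := fun ω => (invariantDensity s r ω).toReal with hφ
  have hφm : Measurable φ := hm.ennreal_toReal
  have hφi : Integrable φ P := integrable_toReal_of_lintegral_ne_top hm.aemeasurable hfin.ne
  have hrec : ∀ᵐ ω ∂P,
      tilt s r ω s * φ ω = 1 + tilt s r (shift s ω) (-s) * φ (shift s ω) := by
    filter_upwards [hreg, hltT] with ω hω h2
    have ht := hω.tilt_pos r s
    have ht' := (hω.comp_shift s).tilt_pos r (-s)
    have h3 : forwardOp s r (invariantDensity s r) ω ≠ ∞ :=
      ENNReal.mul_ne_top ENNReal.ofReal_ne_top (ENNReal.mul_ne_top ENNReal.ofReal_ne_top h2.ne)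
    simp only [hφ]
    conv_lhs => rw [invariantDensity_eq]
    rw [ENNReal.toReal_add (show invTilt s r ω ≠ ∞ from ENNReal.ofReal_ne_top) h3, forwardOp, invTilt, ENNReal.toReal_mul,
      ENNReal.toReal_mul, ENNReal.toReal_ofReal (by positivity), ENNReal.toReal_ofReal ht'.le]
    field_simp
  have hpos : ∀ᵐ ω ∂P, 0 < φ ω := by
    filter_upwards [hreg, hrec] with ω hω h
    have h1 := (hω.comp_shift s).tilt_pos r (-s)
    have h2 : 0 ≤ φ (shift s ω) := ENNReal.toReal_nonneg
    have h3 : 0 < tilt s r ω s * φ ω := by rw [h]; positivity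
    exact (pos_iff_pos_of_mul_pos h3).1 (hω.tilt_pos r s)
  refine ⟨φ, hφm, hφi, hpos, hrec, ?_⟩
  -- Multiplying the equation of `φ` by `τ` and that of `τ` by `φ` and subtracting leaves `φ - τ = u
  -- ∘ T_s - u`. The function `u` itself need not be integrable.
  set u : Env → ℝ := fun ω => tilt s r ω (-s) * φ ω * meanPassage s r (shift (-(s : ℤ)) ω) with hu
  have hum : AEMeasurable u P := ((measurable_tilt s r (-s)).mul hφm).aemeasurable.mul
    (hτ.aemeasurable.comp_quasiMeasurePreserving (hmp _).quasiMeasurePreserving)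
  have hco : ∀ᵐ ω ∂P, φ ω - meanPassage s r ω = u (shift s ω) - u ω := by
    filter_upwards [hreg, hrec] with ω hω h
    have h1 := hω.meanPassage_eq hr
    simp only [hu, shift_shift, neg_add_cancel, shift_zero]
    linear_combination (meanPassage s r ω) * h - φ ω * h1
  have hint := (hφi.sub hτ).congr hco
  have h0 := integral_coboundary_eq_zero (hmp s) hum hint
  rw [← integral_congr_ae hco, integral_sub hφi hτ] at h0
  linarith

/-- There is no invariant density of the tilted environment process without flux. -/
lemma ae_eq_zero_of_flux_eq_zero [IsProbabilityMeasure P] (hP : Ergodic (shift 1) P)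
    (hreg : ∀ᵐ ω ∂P, Regular s c ω) (hr : r < c) (hτ : Integrable (meanPassage s r) P)
    {D : Env → ℝ} (hD : Integrable D P)
    (hflux : ∀ᵐ ω ∂P, tilt s r ω s * D ω = tilt s r (shift s ω) (-s) * D (shift s ω)) :
    ∀ᵐ ω ∂P, D ω = 0 := by
  have hmp := measurePreserving_shift hP.toMeasurePreserving
  -- By positivity of the tilted probabilities, the equation without flux passes to `|D|`. Combined
  -- with the equation of `τ`, it exhibits `|D|` as a coboundary, so its mean is zero.
  set u : Env → ℝ := fun ω => tilt s r ω (-s) * |D ω| * meanPassage s r (shift (-(s : ℤ)) ω) with hu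
  have hum : AEMeasurable u P := ((measurable_tilt s r (-s)).aemeasurable.mul hD.abs.aemeasurable).mul
    (hτ.aemeasurable.comp_quasiMeasurePreserving (hmp _).quasiMeasurePreserving)
  have hco : ∀ᵐ ω ∂P, |D ω| = u (shift s ω) - u ω := by
    filter_upwards [hreg, hflux] with ω hω h
    have h1 := hω.meanPassage_eq hr
    have h2 : tilt s r ω s * |D ω| = tilt s r (shift s ω) (-s) * |D (shift s ω)| := by
      have := congrArg abs h
      rwa [abs_mul, abs_mul, abs_of_pos (hω.tilt_pos r s),
        abs_of_pos ((hω.comp_shift s).tilt_pos r (-s))] at this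
    simp only [hu, shift_shift, neg_add_cancel, shift_zero]
    linear_combination (meanPassage s r ω) * h2 - |D ω| * h1
  have h0 := integral_coboundary_eq_zero (hmp s) hum (hD.abs.congr hco)
  rw [← integral_congr_ae hco, integral_eq_zero_iff_of_nonneg (fun ω => abs_nonneg _) hD.abs] at h0
  filter_upwards [h0] with ω hω using abs_eq_zero.1 hω

/-! ### Relative entropies -/

/-- The relative entropy of the probability vectors `q` and `p` on the steps. -/
def relEntropy (q p : ℤˣ → ℝ) : ℝ := ∑ z, q z * Real.log (q z / p z)

lemma relEntropy_eq_sum_klFun {q p : ℤˣ → ℝ} (hp : ∀ z, 0 < p z) (s : ℤˣ)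
    (hqs : q s + q (-s) = 1) (hps : p s + p (-s) = 1) :
    relEntropy q p = ∑ z, p z * InformationTheory.klFun (q z / p z) := by
  have : ∀ z, p z * InformationTheory.klFun (q z / p z) =
      q z * Real.log (q z / p z) + p z - q z := by
    intro z
    have := (hp z).ne'
    rw [InformationTheory.klFun]
    field_simp
  simp_rw [this, relEntropy]
  rw [sum_units s, sum_units s]
  linarith

lemma relEntropy_nonneg {q p : ℤˣ → ℝ} (hq : ∀ z, 0 ≤ q z) (hp : ∀ z, 0 < p z) (s : ℤˣ)
    (hqs : q s + q (-s) = 1) (hps : p s + p (-s) = 1) : 0 ≤ relEntropy q p := by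
  rw [relEntropy_eq_sum_klFun hp s hqs hps]
  exact Finset.sum_nonneg fun z _ => mul_nonneg (hp z).le
    (InformationTheory.klFun_nonneg (div_nonneg (hq z) (hp z).le))

lemma eq_of_relEntropy_eq_zero {q p : ℤˣ → ℝ} (hq : ∀ z, 0 ≤ q z) (hp : ∀ z, 0 < p z) (s : ℤˣ)
    (hqs : q s + q (-s) = 1) (hps : p s + p (-s) = 1) (h : relEntropy q p = 0) (z : ℤˣ) :
    q z = p z := by
  rw [relEntropy_eq_sum_klFun hp s hqs hps, Finset.sum_eq_zero_iff_of_nonneg fun z _ =>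
    mul_nonneg (hp z).le (InformationTheory.klFun_nonneg (div_nonneg (hq z) (hp z).le))] at h
  have h1 := (mul_eq_zero.1 (h z (Finset.mem_univ z))).resolve_left (hp z).ne'
  rw [InformationTheory.klFun_eq_zero_iff (div_nonneg (hq z) (hp z).le)] at h1
  exact (div_eq_one_iff_eq (hp z).ne').1 h1

lemma relEntropy_self (p : ℤˣ → ℝ) : relEntropy p p = 0 := by
  refine Finset.sum_eq_zero fun z _ => ?_
  by_cases h : p z = 0
  · simp [h]
  · simp [div_self h]

/-- The chain rule `log (q / π) = log (q / tilt) + log (tilt / π)`, where the last logarithm is `r`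
plus or minus a value of `log ζ`. -/
lemma Regular.relEntropy_trans (h : Regular s c ω) {q : ℤˣ → ℝ} (hqs : q s + q (-s) = 1) :
    relEntropy q (trans ω 0) = relEntropy q (tilt s r ω) + r +
      (-(q s * logZeta s r ω) + q (-s) * logZeta s r (shift (-(s : ℤ)) ω)) := by
  have key : ∀ z, q z * Real.log (q z / trans ω 0 z) = q z * Real.log (q z / tilt s r ω z) +
      q z * (r + if z = s then -logZeta s r ω else logZeta s r (shift (-(s : ℤ)) ω)) := by
    intro z
    by_cases hz : q z = 0
    · simp [hz]
    have ht := (h.trans_pos z).ne'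
    rw [← mul_add, tilt, Real.log_div hz ht, Real.log_div hz (mul_ne_zero ht (Real.exp_pos _).ne'),
      Real.log_mul ht (Real.exp_pos _).ne', Real.log_exp]
    ring
  rw [relEntropy, relEntropy, Finset.sum_congr rfl fun z _ => key z, Finset.sum_add_distrib,
    sum_units s (fun z => q z * (r + _)), if_pos rfl, if_neg (neg_units_ne s)]
  linear_combination r * hqs

/-- The energy exchanged along a stationary flow with the flux `v`: the term that is not controlled
by the flux is a coboundary. -/
lemma integral_flux [IsProbabilityMeasure P] (hP : Ergodic (shift 1) P) {g a b B : Env → ℝ} {v : ℝ}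
    (hg : Integrable g P) (hb : Measurable b) (hgm : Measurable g) (hB : Integrable B P)
    (hflux : ∀ᵐ ω ∂P, a ω - b (shift s ω) = v)
    (hle : (∀ᵐ ω ∂P, -(a ω * g ω) + b ω * g (shift (-(s : ℤ)) ω) ≤ B ω) ∨
      ∀ᵐ ω ∂P, -B ω ≤ -(a ω * g ω) + b ω * g (shift (-(s : ℤ)) ω)) :
    Integrable (fun ω => -(a ω * g ω) + b ω * g (shift (-(s : ℤ)) ω)) P ∧
      ∫ ω, (-(a ω * g ω) + b ω * g (shift (-(s : ℤ)) ω)) ∂P = -(v * ∫ ω, g ω ∂P) := by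
  have hmp := measurePreserving_shift hP.toMeasurePreserving
  -- Substituting `a = v + b ∘ T_s` leaves the controlled term `-v g` and the coboundary of `u`
  -- along `T_{-s}`.
  set u : Env → ℝ := fun ω => g ω * b (shift s ω) with hu
  have hum : Measurable u := hgm.mul (hb.comp (measurable_shift s))
  have hco : ∀ᵐ ω ∂P, -(a ω * g ω) + b ω * g (shift (-(s : ℤ)) ω) =
      -(v * g ω) + (u (shift (-(s : ℤ)) ω) - u ω) := by
    filter_upwards [hflux] with ω h
    simp only [hu, shift_shift, add_neg_cancel, shift_zero]
    linear_combination (-g ω) * h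
  -- The separate products of `b` with `g` may fail to be integrable. A one-sided integrable bound
  -- on the coboundary, or on its negative, is enough.
  have hmain : Integrable (fun ω => u (shift (-(s : ℤ)) ω) - u ω) P ∧
      ∫ ω, (u (shift (-(s : ℤ)) ω) - u ω) ∂P = 0 := by
    have hbound : Integrable (fun ω => |B ω| + |v * g ω|) P := hB.abs.add (hg.const_mul v).abs
    rcases hle with h | h
    · refine integrable_coboundary_of_posPart (hmp _) hum.aemeasurable (hbound.mono'
        (((hum.comp (measurable_shift _)).sub hum).max measurable_const).aestronglyMeasurable ?_)
      filter_upwards [h, hco] with ω h1 h2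
      rw [Real.norm_of_nonneg (le_max_right _ _)]
      refine max_le ?_ (by positivity)
      linarith [le_abs_self (B ω), le_abs_self (v * g ω)]
    · have hneg := integrable_coboundary_of_posPart (u := fun ω => -u ω) (hmp (-(s : ℤ)))
        hum.neg.aemeasurable (hbound.mono'
        (((hum.neg.comp (measurable_shift _)).sub hum.neg).max measurable_const).aestronglyMeasurable ?_)
      · have e : ∀ ω, -u (shift (-(s : ℤ)) ω) - -u ω = -(u (shift (-(s : ℤ)) ω) - u ω) :=
          fun ω => by ring
        simp only [e, integral_neg, neg_eq_zero] at hneg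
        exact ⟨hneg.1.neg.congr (ae_of_all _ fun ω => neg_neg _), hneg.2⟩
      · filter_upwards [h, hco] with ω h1 h2
        rw [Real.norm_of_nonneg (le_max_right _ _)]
        refine max_le ?_ (by positivity)
        linarith [le_abs_self (B ω), neg_abs_le (v * g ω)]
  have hvg : Integrable (fun ω => -(v * g ω)) P := (hg.const_mul v).neg
  have hi : Integrable (fun ω => -(v * g ω) + (u (shift (-(s : ℤ)) ω) - u ω)) P :=
    hvg.add hmain.1
  refine ⟨hi.congr (hco.mono fun ω h => h.symm), ?_⟩
  rw [integral_congr_ae hco, integral_add hvg hmain.1, hmain.2, integral_neg,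
    integral_const_mul, add_zero]

end

section

/-! ### Densities of stationary pair measures -/

variable {s : ℤˣ} {r c : ℝ} {ω : Env} {P : Measure Env} {ν : Measure (Env × ℤˣ)}

/-- The density of the first marginal of `ν` with respect to `P`. -/
def fstDensity (P : Measure Env) (ν : Measure (Env × ℤˣ)) (ω : Env) : ℝ := (ν.fst.rnDeriv P ω).toReal

/-- The step probabilities of a pair measure, as real numbers. -/
def stepProb (ν : Measure (Env × ℤˣ)) (ω : Env) (z : ℤˣ) : ℝ := (stepDensity ν z ω).toReal

lemma measurable_fstDensity (P : Measure Env) (ν : Measure (Env × ℤˣ)) :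
    Measurable (fstDensity P ν) := (Measure.measurable_rnDeriv _ _).ennreal_toReal

lemma measurable_stepProb (ν : Measure (Env × ℤˣ)) (z : ℤˣ) :
    Measurable fun ω => stepProb ν ω z := (Measure.measurable_rnDeriv _ _).ennreal_toReal

lemma fstDensity_nonneg (P : Measure Env) (ν : Measure (Env × ℤˣ)) (ω : Env) :
    0 ≤ fstDensity P ν ω := ENNReal.toReal_nonneg

lemma stepProb_nonneg (ν : Measure (Env × ℤˣ)) (ω : Env) (z : ℤˣ) : 0 ≤ stepProb ν ω z :=
  ENNReal.toReal_nonneg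

lemma withDensity_ofReal_toReal_rnDeriv {Ω : Type*} [MeasurableSpace Ω] {m n : Measure Ω}
    [IsFiniteMeasure m] [IsFiniteMeasure n] (h : m ≪ n) :
    n.withDensity (fun ω => ENNReal.ofReal (m.rnDeriv n ω).toReal) = m := by
  conv_rhs => rw [← Measure.withDensity_rnDeriv_eq m n h]
  refine withDensity_congr_ae ?_
  filter_upwards [Measure.rnDeriv_lt_top m n] with ω hω using ENNReal.ofReal_toReal hω.ne

lemma IsStationaryPair.withDensity_fstDensity [IsProbabilityMeasure P] (h : IsStationaryPair P ν) :
    P.withDensity (fun ω => ENNReal.ofReal (fstDensity P ν ω)) = ν.fst := by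
  have := h.prob
  exact withDensity_ofReal_toReal_rnDeriv h.ac

lemma IsStationaryPair.withDensity_stepProb (h : IsStationaryPair P ν) (z : ℤˣ) :
    ν.fst.withDensity (fun ω => ENNReal.ofReal (stepProb ν ω z)) = component ν z := by
  have := h.prob
  exact withDensity_ofReal_toReal_rnDeriv (component_le_fst ν z).absolutelyContinuous

/-- The density of the component of `ν` for the step `z` with respect to `P`. -/
def compDensity (P : Measure Env) (ν : Measure (Env × ℤˣ)) (z : ℤˣ) (ω : Env) : ℝ :=
  fstDensity P ν ω * stepProb ν ω z

lemma measurable_compDensity (P : Measure Env) (ν : Measure (Env × ℤˣ)) (z : ℤˣ) :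
    Measurable (compDensity P ν z) := (measurable_fstDensity P ν).mul (measurable_stepProb ν z)

lemma compDensity_nonneg (P : Measure Env) (ν : Measure (Env × ℤˣ)) (z : ℤˣ) (ω : Env) :
    0 ≤ compDensity P ν z ω := mul_nonneg (fstDensity_nonneg _ _ _) (stepProb_nonneg _ _ _)

lemma IsStationaryPair.withDensity_compDensity [IsProbabilityMeasure P] (h : IsStationaryPair P ν)
    (z : ℤˣ) : P.withDensity (fun ω => ENNReal.ofReal (compDensity P ν z ω)) = component ν z := by
  rw [← h.withDensity_stepProb z, ← h.withDensity_fstDensity,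
    ← withDensity_mul _ (measurable_fstDensity P ν).ennreal_ofReal
      (measurable_stepProb ν z).ennreal_ofReal]
  congr 1; funext ω
  exact ENNReal.ofReal_mul (fstDensity_nonneg _ _ _)

lemma integrable_of_withDensity_ofReal {Ω : Type*} [MeasurableSpace Ω] {m n : Measure Ω}
    [IsFiniteMeasure m] {f : Ω → ℝ} (hf : Measurable f) (hf0 : ∀ ω, 0 ≤ f ω)
    (h : n.withDensity (fun ω => ENNReal.ofReal (f ω)) = m) :
    Integrable f n ∧ ∫ ω, f ω ∂n = m.real univ := by
  have h1 : ∫⁻ ω, ENNReal.ofReal (f ω) ∂n = m univ := by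
    rw [← h, withDensity_apply _ MeasurableSet.univ, setLIntegral_univ]
  refine ⟨⟨hf.aestronglyMeasurable, ?_⟩, ?_⟩
  · rw [hasFiniteIntegral_iff_ofReal (ae_of_all _ hf0), h1]
    exact measure_lt_top m univ
  · rw [integral_eq_lintegral_of_nonneg_ae (ae_of_all _ hf0) hf.aestronglyMeasurable, h1]; rfl

lemma IsStationaryPair.integrable_fstDensity [IsProbabilityMeasure P] (h : IsStationaryPair P ν) :
    Integrable (fstDensity P ν) P ∧ ∫ ω, fstDensity P ν ω ∂P = 1 := by
  have := h.prob
  have h1 := integrable_of_withDensity_ofReal (measurable_fstDensity P ν) (fstDensity_nonneg P ν)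
    h.withDensity_fstDensity
  refine ⟨h1.1, h1.2.trans ?_⟩
  rw [probReal_univ]

lemma IsStationaryPair.integrable_compDensity [IsProbabilityMeasure P] (h : IsStationaryPair P ν)
    (z : ℤˣ) : Integrable (compDensity P ν z) P ∧
      ∫ ω, compDensity P ν z ω ∂P = (component ν z).real univ := by
  have := h.prob
  exact integrable_of_withDensity_ofReal (measurable_compDensity P ν z) (compDensity_nonneg P ν z)
    (h.withDensity_compDensity z)

lemma ae_eq_of_withDensity_ofReal_eq {Ω : Type*} [MeasurableSpace Ω] {n : Measure Ω}
    [IsFiniteMeasure n] {f g : Ω → ℝ} (hf : Measurable f) (hg : Measurable g) (hf0 : ∀ ω, 0 ≤ f ω)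
    (hg0 : ∀ ω, 0 ≤ g ω) (h : n.withDensity (fun ω => ENNReal.ofReal (f ω)) =
      n.withDensity (fun ω => ENNReal.ofReal (g ω))) : ∀ᵐ ω ∂n, f ω = g ω := by
  have h1 := (withDensity_eq_iff_of_sigmaFinite hf.ennreal_ofReal.aemeasurable
    hg.ennreal_ofReal.aemeasurable).1 h
  filter_upwards [h1] with ω hω
  exact (ENNReal.ofReal_eq_ofReal_iff (hf0 ω) (hg0 ω)).1 hω

lemma withDensity_ofReal_add {Ω : Type*} [MeasurableSpace Ω] {n : Measure Ω} {f g : Ω → ℝ}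
    (hf : Measurable f) (hf0 : ∀ ω, 0 ≤ f ω) (hg0 : ∀ ω, 0 ≤ g ω) :
    n.withDensity (fun ω => ENNReal.ofReal (f ω + g ω)) =
      n.withDensity (fun ω => ENNReal.ofReal (f ω)) + n.withDensity (fun ω => ENNReal.ofReal (g ω)) := by
  rw [← withDensity_add_left hf.ennreal_ofReal]
  congr 1; funext ω
  exact ENNReal.ofReal_add (hf0 ω) (hg0 ω)

lemma IsStationaryPair.ae_fstDensity_eq_add [IsProbabilityMeasure P] (h : IsStationaryPair P ν)
    (s : ℤˣ) : ∀ᵐ ω ∂P, fstDensity P ν ω = compDensity P ν s ω + compDensity P ν (-s) ω := by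
  refine ae_eq_of_withDensity_ofReal_eq (measurable_fstDensity P ν)
    ((measurable_compDensity P ν s).add (measurable_compDensity P ν (-s))) (fstDensity_nonneg P ν)
    (fun ω => add_nonneg (compDensity_nonneg P ν s ω) (compDensity_nonneg P ν (-s) ω)) ?_
  rw [withDensity_ofReal_add (measurable_compDensity P ν s) (compDensity_nonneg P ν s)
    (compDensity_nonneg P ν (-s)), h.withDensity_fstDensity, h.withDensity_compDensity,
    h.withDensity_compDensity, fst_eq_sum_component, sum_units s]

lemma sndMarginal_eq_withDensity (hP : MeasurePreserving (shift 1) P P) {a : ℤˣ → Env → ℝ}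
    (ha : ∀ z, Measurable (a z)) (ha0 : ∀ z ω, 0 ≤ a z ω)
    (hν : ∀ z, component ν z = P.withDensity (fun ω => ENNReal.ofReal (a z ω))) (s : ℤˣ) :
    sndMarginal ν = P.withDensity (fun ω => ENNReal.ofReal
      (a s (shift (-(s : ℤ)) ω) + a (-s) (shift s ω))) := by
  rw [withDensity_ofReal_add (f := fun ω => a s (shift (-(s : ℤ)) ω))
    (g := fun ω => a (-s) (shift s ω)) ((ha s).comp (measurable_shift _))
    (fun ω => ha0 s _) (fun ω => ha0 (-s) _), sndMarginal_eq_sum, sum_units s, hν, hν,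
    withDensity_map_shift hP _ (ha s).ennreal_ofReal,
    withDensity_map_shift hP _ (ha (-s)).ennreal_ofReal]
  simp only [Units.val_neg, neg_neg]

lemma IsStationaryPair.ae_fstDensity_eq_shift [IsProbabilityMeasure P] (hP : Ergodic (shift 1) P)
    (h : IsStationaryPair P ν) (s : ℤˣ) : ∀ᵐ ω ∂P, fstDensity P ν ω =
      compDensity P ν s (shift (-(s : ℤ)) ω) + compDensity P ν (-s) (shift s ω) := by
  refine ae_eq_of_withDensity_ofReal_eq (measurable_fstDensity P ν)
    (((measurable_compDensity P ν s).comp (measurable_shift _)).add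
      ((measurable_compDensity P ν (-s)).comp (measurable_shift _))) (fstDensity_nonneg P ν)
    (fun ω => add_nonneg (compDensity_nonneg P ν s _) (compDensity_nonneg P ν (-s) _)) ?_
  rw [h.withDensity_fstDensity, h.stationary]
  exact sndMarginal_eq_withDensity hP.toMeasurePreserving (measurable_compDensity P ν)
    (compDensity_nonneg P ν) (fun z => (h.withDensity_compDensity z).symm) s

/-- The flux of a stationary pair measure is its velocity. -/
lemma IsStationaryPair.ae_flux_eq [IsProbabilityMeasure P] (hP : Ergodic (shift 1) P)
    (h : IsStationaryPair P ν) {ξ : ℝ} (hs : (s : ℤ) * ξ = |ξ|) (hv : ν ∈ velocitySet ξ) :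
    ∀ᵐ ω ∂P, compDensity P ν s ω - compDensity P ν (-s) (shift s ω) = |ξ| := by
  have := h.prob
  have hmp := measurePreserving_shift hP.toMeasurePreserving
  set f : Env → ℝ := fun ω => compDensity P ν s ω - compDensity P ν (-s) (shift s ω) with hf
  have hfm : Measurable f := (measurable_compDensity P ν s).sub
    ((measurable_compDensity P ν (-s)).comp (measurable_shift s))
  -- The density at a site is both the mass leaving it and the mass entering it. Equating the two
  -- shows that the flux across consecutive bonds is the same; ergodicity then makes it constant.
  have hinv : f ∘ shift s =ᵐ[P] f := by
    have h1 := (hmp s).quasiMeasurePreserving.tendsto_ae.eventually (h.ae_fstDensity_eq_add s)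
    have h2 := (hmp s).quasiMeasurePreserving.tendsto_ae.eventually (h.ae_fstDensity_eq_shift hP s)
    filter_upwards [h1, h2] with ω h1 h2
    simp only [shift_shift, neg_add_cancel, shift_zero] at h2
    simp only [hf, Function.comp_apply, shift_shift]
    linarith
  obtain ⟨v, hvv⟩ := (ergodic_shift hP s).ae_eq_const_of_ae_eq_comp_ae hfm.aestronglyMeasurable hinv
  have hi1 := h.integrable_compDensity s
  have hi2 := h.integrable_compDensity (-s)
  have hi2' : Integrable (fun ω => compDensity P ν (-s) (shift s ω)) P :=
    (hmp s).integrable_comp_of_integrable hi2.1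
  have hint : ∫ ω, f ω ∂P = |ξ| := by
    have hss : ((s : ℤ) : ℝ) * ((s : ℤ) : ℝ) = 1 := by exact_mod_cast units_mul_self s
    have h3 := integral_step ν s
    rw [hv.2] at h3
    rw [integral_sub hi1.1 hi2', MeasurePreserving.integral_comp_of_aestronglyMeasurable (hmp s)
      hi2.1.aestronglyMeasurable, hi1.2, hi2.2, ← hs, h3, ← mul_assoc, hss, one_mul]
  rw [integral_congr_ae hvv] at hint
  simp only [Function.const_apply, integral_const, probReal_univ, one_smul] at hint
  filter_upwards [hvv] with ω hω
  exact hω.trans hint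

/-! ### The rate of a stationary pair measure -/

lemma measurable_relEntropy {q p : Env → ℤˣ → ℝ} (hq : ∀ z, Measurable fun ω => q ω z)
    (hp : ∀ z, Measurable fun ω => p ω z) : Measurable fun ω => relEntropy (q ω) (p ω) :=
  Finset.measurable_fun_sum _ fun z _ =>
    (hq z).mul (Real.measurable_log.comp ((hq z).div (hp z)))

lemma IsStationaryPair.pairRate_eq [IsProbabilityMeasure P] (h : IsStationaryPair P ν) :
    pairRate P ν = ∫⁻ ω, ENNReal.ofReal (fstDensity P ν ω * relEntropy (stepProb ν ω) (trans ω 0)) ∂P := by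
  rw [pairRate, if_pos h, ← h.withDensity_fstDensity]
  rw [lintegral_withDensity_eq_lintegral_mul _ (measurable_fstDensity P ν).ennreal_ofReal]
  · refine lintegral_congr fun ω => ?_
    rw [ENNReal.ofReal_mul (fstDensity_nonneg P ν ω)]
    have e : P.withDensity (fun ω => ENNReal.ofReal (fstDensity P ν ω)) = ν.fst :=
      h.withDensity_fstDensity
    simp only [Pi.mul_apply]
    rfl
  · exact (measurable_relEntropy (measurable_stepProb ν) (measurable_trans 0)).ennreal_ofReal

lemma IsStationaryPair.ae_stepProb_add [IsProbabilityMeasure P] (h : IsStationaryPair P ν) (s : ℤˣ) :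
    ∀ᵐ ω ∂P, fstDensity P ν ω = 0 ∨ stepProb ν ω s + stepProb ν ω (-s) = 1 := by
  filter_upwards [h.ae_fstDensity_eq_add s] with ω hω
  simp only [compDensity] at hω
  rw [← mul_add] at hω
  by_cases h0 : fstDensity P ν ω = 0
  · exact Or.inl h0
  · exact Or.inr (mul_left_cancel₀ h0 (by rw [← hω, mul_one]))

lemma IsStationaryPair.ae_entropy_nonneg [IsProbabilityMeasure P] (h : IsStationaryPair P ν)
    (hreg : ∀ᵐ ω ∂P, Regular s c ω) :
    ∀ᵐ ω ∂P, 0 ≤ fstDensity P ν ω * relEntropy (stepProb ν ω) (trans ω 0) := by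
  filter_upwards [hreg, h.ae_stepProb_add s] with ω hω h1
  rcases h1 with h1 | h1
  · simp [h1]
  · exact mul_nonneg (fstDensity_nonneg P ν ω) (relEntropy_nonneg (stepProb_nonneg ν ω) hω.trans_pos s
      h1 (trans_add_trans_neg ω 0 s))

lemma IsStationaryPair.ae_tiltEntropy_nonneg [IsProbabilityMeasure P] (h : IsStationaryPair P ν)
    (hreg : ∀ᵐ ω ∂P, Regular s c ω) (hr : r < c) :
    ∀ᵐ ω ∂P, 0 ≤ fstDensity P ν ω * relEntropy (stepProb ν ω) (tilt s r ω) := by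
  filter_upwards [hreg, h.ae_stepProb_add s] with ω hω h1
  rcases h1 with h1 | h1
  · simp [h1]
  · exact mul_nonneg (fstDensity_nonneg P ν ω) (relEntropy_nonneg (stepProb_nonneg ν ω)
      (hω.tilt_pos r) s h1 (hω.tilt_add hr))

/-- The rate of a stationary pair measure differs from its entropy relative to the tilted walk by
a quantity that depends on the velocity alone. -/
lemma IsStationaryPair.integral_entropy [IsProbabilityMeasure P] (hP : Ergodic (shift 1) P)
    (hreg : ∀ᵐ ω ∂P, Regular s c ω) (hr : r < c) (hi : Integrable (logZeta s r) P)
    (h : IsStationaryPair P ν) {ξ : ℝ} (hs : (s : ℤ) * ξ = |ξ|) (hv : ν ∈ velocitySet ξ)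
    (hint : Integrable (fun ω => fstDensity P ν ω * relEntropy (stepProb ν ω) (trans ω 0)) P ∨
      Integrable (fun ω => fstDensity P ν ω * relEntropy (stepProb ν ω) (tilt s r ω)) P) :
    Integrable (fun ω => fstDensity P ν ω * relEntropy (stepProb ν ω) (trans ω 0)) P ∧
    Integrable (fun ω => fstDensity P ν ω * relEntropy (stepProb ν ω) (tilt s r ω)) P ∧
    ∫ ω, fstDensity P ν ω * relEntropy (stepProb ν ω) (trans ω 0) ∂P =
      ∫ ω, fstDensity P ν ω * relEntropy (stepProb ν ω) (tilt s r ω) ∂P +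
        (r - |ξ| * lyap P s r) := by
  set E : Env → ℝ := fun ω => fstDensity P ν ω * relEntropy (stepProb ν ω) (trans ω 0)
  set D : Env → ℝ := fun ω => fstDensity P ν ω * relEntropy (stepProb ν ω) (tilt s r ω)
  set W : Env → ℝ := fun ω => -(compDensity P ν s ω * logZeta s r ω) +
    compDensity P ν (-s) ω * logZeta s r (shift (-(s : ℤ)) ω)
  obtain ⟨hψ, hψ1⟩ := h.integrable_fstDensity
  have hED : ∀ᵐ ω ∂P, E ω = D ω + r * fstDensity P ν ω + W ω := by
    filter_upwards [hreg, h.ae_stepProb_add s] with ω hω h1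
    simp only [E, D, W, compDensity]
    rcases h1 with h1 | h1
    · simp [h1]
    · rw [hω.relEntropy_trans (r := r) h1]; ring
  have hE0 : ∀ᵐ ω ∂P, 0 ≤ E ω := h.ae_entropy_nonneg hreg
  have hD0 : ∀ᵐ ω ∂P, 0 ≤ D ω := h.ae_tiltEntropy_nonneg hreg hr
  -- In `E = D + r ψ + W`, with `ψ` the density of the first marginal, both entropies are
  -- nonnegative. Integrability of `E` bounds `W` from above and integrability of `D` bounds it from
  -- below; either suffices for `integral_flux`.
  have hW : Integrable W P ∧ ∫ ω, W ω ∂P = -(|ξ| * lyap P s r) := by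
    have hflux := h.ae_flux_eq hP hs hv
    have hbm := measurable_compDensity P ν (-s)
    rcases hint with hint | hint
    · refine integral_flux hP hi hbm (measurable_logZeta s r)
        (hint.add (hψ.const_mul |r|)) hflux (Or.inl ?_)
      filter_upwards [hED, hD0] with ω h1 h2
      change W ω ≤ E ω + |r| * fstDensity P ν ω
      nlinarith [neg_abs_le r, fstDensity_nonneg P ν ω]
    · refine integral_flux hP hi hbm (measurable_logZeta s r)
        (hint.add (hψ.const_mul |r|)) hflux (Or.inr ?_)
      filter_upwards [hED, hE0] with ω h1 h2
      change -(D ω + |r| * fstDensity P ν ω) ≤ W ω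
      nlinarith [le_abs_self r, fstDensity_nonneg P ν ω]
  have hDi : Integrable D P := by
    rcases hint with hint | hint
    · exact ((hint.sub (hψ.const_mul r)).sub hW.1).congr (hED.mono fun ω h => by
        simp only [Pi.sub_apply]; linarith)
    · exact hint
  have hDr : Integrable (fun ω => D ω + r * fstDensity P ν ω) P := hDi.add (hψ.const_mul r)
  refine ⟨(hDr.add hW.1).congr (hED.mono fun ω h => h.symm), hDi, ?_⟩
  rw [integral_congr_ae hED, integral_add hDr hW.1, integral_add hDi (hψ.const_mul r),
    integral_const_mul, hψ1, hW.2]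
  ring

lemma measurable_entropy (P : Measure Env) (ν : Measure (Env × ℤˣ)) :
    Measurable fun ω => fstDensity P ν ω * relEntropy (stepProb ν ω) (trans ω 0) :=
  (measurable_fstDensity P ν).mul (measurable_relEntropy (measurable_stepProb ν) (measurable_trans 0))

/-- The lower bound on the rate of the measures with a given velocity. -/
lemma ofReal_le_pairRate [IsProbabilityMeasure P] (hP : Ergodic (shift 1) P)
    (hreg : ∀ᵐ ω ∂P, Regular s c ω) (hr : r < c) (hi : Integrable (logZeta s r) P)
    {ξ : ℝ} (hs : (s : ℤ) * ξ = |ξ|) (hv : ν ∈ velocitySet ξ) :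
    ENNReal.ofReal (r - |ξ| * lyap P s r) ≤ pairRate P ν ∧
      (pairRate P ν = ENNReal.ofReal (r - |ξ| * lyap P s r) → 0 ≤ r - |ξ| * lyap P s r →
        IsStationaryPair P ν ∧ ∀ᵐ ω ∂P, ∀ z, compDensity P ν z ω = fstDensity P ν ω * tilt s r ω z) := by
  by_cases h : IsStationaryPair P ν
  swap
  · rw [pairRate, if_neg h]
    exact ⟨le_top, fun h' => absurd h'.symm ENNReal.ofReal_ne_top⟩
  by_cases hfin : pairRate P ν = ∞
  · rw [hfin]
    exact ⟨le_top, fun h' => absurd h'.symm ENNReal.ofReal_ne_top⟩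
  have hE0 := h.ae_entropy_nonneg hreg
  have hD0 := h.ae_tiltEntropy_nonneg hreg hr
  have hEi : Integrable (fun ω => fstDensity P ν ω * relEntropy (stepProb ν ω) (trans ω 0)) P := by
    refine ⟨(measurable_entropy P ν).aestronglyMeasurable, ?_⟩
    rw [hasFiniteIntegral_iff_ofReal hE0, ← h.pairRate_eq]
    exact lt_top_iff_ne_top.2 hfin
  obtain ⟨-, hDi, heq⟩ := h.integral_entropy hP hreg hr hi hs hv (Or.inl hEi)
  have hD : 0 ≤ ∫ ω, fstDensity P ν ω * relEntropy (stepProb ν ω) (tilt s r ω) ∂P :=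
    integral_nonneg_of_ae hD0
  rw [h.pairRate_eq, ← ofReal_integral_eq_lintegral_ofReal hEi hE0, heq]
  refine ⟨ENNReal.ofReal_le_ofReal (by linarith), fun h1 h2 => ⟨h, ?_⟩⟩
  rw [ENNReal.ofReal_eq_ofReal_iff (by linarith) h2] at h1
  -- Equality leaves no entropy relative to the tilted walk, so the step probabilities are the
  -- tilted ones wherever the density is positive.
  have h3 : ∫ ω, fstDensity P ν ω * relEntropy (stepProb ν ω) (tilt s r ω) ∂P = 0 := by linarith
  rw [integral_eq_zero_iff_of_nonneg_ae hD0 hDi] at h3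
  filter_upwards [h3, hreg, h.ae_stepProb_add s] with ω h4 hω h5 z
  rw [compDensity]
  by_cases h0 : fstDensity P ν ω = 0
  · simp [h0]
  · rw [eq_of_relEntropy_eq_zero (stepProb_nonneg ν ω) (hω.tilt_pos r) s (h5.resolve_left h0)
      (hω.tilt_add hr) ((mul_eq_zero.1 h4).resolve_left h0) z]

end

/-! ### Existence and uniqueness of the minimizer -/

section

variable {P : Measure Env} {s : ℤˣ} {r c : ℝ}

lemma tilt_nonneg (s : ℤˣ) (r : ℝ) (ω : Env) (z : ℤˣ) : 0 ≤ tilt s r ω z :=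
  mul_nonneg (trans_nonneg _ _ _) (Real.exp_pos _).le

/-- Constancy of the flux across neighbouring bonds is exactly the balance of mass at a site, so it
gives stationarity; the constant is the velocity in the direction `s`. -/
lemma isStationaryPair_of_component [IsProbabilityMeasure P] (hP : Ergodic (shift 1) P)
    (hreg : ∀ᵐ ω ∂P, Regular s c ω) (hr : r < c) {ψ : Env → ℝ} {v : ℝ} (hψm : Measurable ψ)
    (hψ0 : ∀ ω, 0 ≤ ψ ω) (hψi : Integrable ψ P) (hψ1 : ∫ ω, ψ ω ∂P = 1) (hψ : ∀ᵐ ω ∂P, 0 < ψ ω)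
    (hflux : ∀ᵐ ω ∂P, ψ ω * tilt s r ω s = v + ψ (shift s ω) * tilt s r (shift s ω) (-s))
    {μ : Measure (Env × ℤˣ)}
    (hμ : ∀ z, component μ z = P.withDensity (fun ω => ENNReal.ofReal (ψ ω * tilt s r ω z))) :
    IsStationaryPair P μ ∧ (∀ z, component μ z =
        μ.fst.withDensity (fun ω => ENNReal.ofReal (tilt s r ω z))) ∧
      ∫ p, (((p.2 : ℤˣ) : ℤ) : ℝ) ∂μ = (s : ℤ) * v := by
  have hmp := measurePreserving_shift hP.toMeasurePreserving
  set a : ℤˣ → Env → ℝ := fun z ω => ψ ω * tilt s r ω z with ha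
  have ham : ∀ z, Measurable (a z) := fun z => hψm.mul (measurable_tilt s r z)
  have ha0 : ∀ z ω, 0 ≤ a z ω := fun z ω => mul_nonneg (hψ0 ω) (tilt_nonneg s r ω z)
  have hadd : ∀ᵐ ω ∂P, a s ω + a (-s) ω = ψ ω := by
    filter_upwards [hreg] with ω hω
    simp only [ha]
    rw [← mul_add, hω.tilt_add hr, mul_one]
  have hfst : μ.fst = P.withDensity (fun ω => ENNReal.ofReal (ψ ω)) := by
    rw [fst_eq_sum_component, sum_units s, hμ, hμ,
      ← withDensity_ofReal_add (ham s) (ha0 s) (ha0 (-s))]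
    refine withDensity_congr_ae ?_
    filter_upwards [hadd] with ω hω
    rw [hω]
  have hprob : IsProbabilityMeasure μ := by
    refine ⟨?_⟩
    rw [← Measure.fst_univ, hfst, withDensity_apply _ MeasurableSet.univ, setLIntegral_univ,
      ← ofReal_integral_eq_lintegral_ofReal hψi (ae_of_all _ hψ0), hψ1, ENNReal.ofReal_one]
  have hform : ∀ z, component μ z =
      μ.fst.withDensity (fun ω => ENNReal.ofReal (tilt s r ω z)) := by
    intro z
    rw [hμ, hfst, ← withDensity_mul _ hψm.ennreal_ofReal (measurable_tilt s r z).ennreal_ofReal]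
    congr 1; funext ω
    exact ENNReal.ofReal_mul (hψ0 ω)
  -- The step density is determined only almost everywhere for the first marginal; positivity of `ψ`
  -- transfers its positivity to `P`.
  have hac : P ≪ μ.fst := by
    rw [hfst]
    refine withDensity_absolutelyContinuous' hψm.ennreal_ofReal.aemeasurable ?_
    filter_upwards [hψ] with ω hω
    simpa using hω
  refine ⟨⟨hprob, ?_, ?_, fun z => ?_⟩, hform, ?_⟩
  · rw [sndMarginal_eq_withDensity hP.toMeasurePreserving ham ha0 hμ s, hfst]
    refine withDensity_congr_ae ?_
    filter_upwards [hadd, hflux,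
      (hmp (-(s : ℤ))).quasiMeasurePreserving.tendsto_ae.eventually hflux] with ω h1 h2 h3
    simp only [shift_shift, add_neg_cancel, shift_zero] at h3
    simp only [ha] at h1 ⊢
    congr 1
    linarith
  · rw [hfst]
    exact withDensity_absolutelyContinuous _ _
  · have h1 := Measure.rnDeriv_withDensity μ.fst (measurable_tilt s r z).ennreal_ofReal
    rw [← hform z] at h1
    filter_upwards [hac h1, hreg] with ω h1 h2
    rw [stepDensity, h1]
    exact ENNReal.ofReal_pos.2 (h2.tilt_pos r z)
  · have hi := fun z => integrable_of_withDensity_ofReal (ham z) (ha0 z) (hμ z).symm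
    rw [integral_step μ s, ← (hi s).2, ← (hi (-s)).2]
    have h1 := MeasurePreserving.integral_comp_of_aestronglyMeasurable (hmp (s : ℤ)) (hi (-s)).1.1
    have h2 : ∀ᵐ ω ∂P, a s ω = v + a (-s) (shift s ω) := hflux
    have h3 : Integrable (fun ω => a (-s) (shift s ω)) P :=
      (hmp (s : ℤ)).integrable_comp_of_integrable (hi (-s)).1
    rw [integral_congr_ae h2, integral_add (integrable_const v) h3, h1]
    simp

/-- The density `φ` has flux one and mass `∫ τ = 1 / |ξ|`, so `|ξ| φ` has mass one and flux `|ξ|`.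
-/
lemma exists_fitsAnsatz [IsProbabilityMeasure P] (hP : Ergodic (shift 1) P)
    (hreg : ∀ᵐ ω ∂P, Regular s c ω) (hr : r < c) (hK : InClassK P (corrector P s r)) {ξ : ℝ}
    (hs : (s : ℤ) * ξ = |ξ|) (hξ : ξ ≠ 0) (hτ : Integrable (meanPassage s r) P)
    (hτ1 : ∫ ω, meanPassage s r ω ∂P = |ξ|⁻¹) :
    ∃ μ, FitsAnsatz P ξ (-(((s : ℤ) : ℝ) * lyap P s r)) (corrector P s r) r μ := by
  have hmp := measurePreserving_shift hP.toMeasurePreserving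
  obtain ⟨φ, hφm, hφi, hφ0, hφ, hφτ⟩ := exists_invariantDensity hP hreg hr hτ
  have hξ0 : 0 < |ξ| := abs_pos.2 hξ
  have habs : ∀ᵐ ω ∂P, |φ ω| = φ ω := hφ0.mono fun ω h => abs_of_pos h
  -- The modulus of `φ`, which agrees with `φ` almost surely, makes the density nonnegative
  -- everywhere.
  set μ := ofComponents fun z =>
    P.withDensity (fun ω => ENNReal.ofReal (|ξ| * |φ ω| * tilt s r ω z))
  obtain ⟨h1, h2, h3⟩ := isStationaryPair_of_component (μ := μ) (ψ := fun ω => |ξ| * |φ ω|) (v := |ξ|)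
    hP hreg hr (hφm.abs.const_mul _) (fun ω => by positivity) (hφi.abs.const_mul _)
    (by rw [integral_const_mul, integral_congr_ae habs, hφτ, hτ1, mul_inv_cancel₀ hξ0.ne'])
    (hφ0.mono fun ω h => mul_pos hξ0 (abs_pos.2 h.ne'))
    (by
      filter_upwards [habs, (hmp (s : ℤ)).quasiMeasurePreserving.tendsto_ae.eventually habs, hφ]
        with ω h1 h2 h3
      rw [h1, h2]
      linear_combination |ξ| * h3)
    (component_ofComponents _)
  have hss : ((s : ℤ) : ℝ) * ((s : ℤ) : ℝ) = 1 := by exact_mod_cast units_mul_self s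
  refine ⟨μ, ⟨h1.prob, ?_⟩, h1, hK, fun z => ?_⟩
  · rw [h3, ← hs, ← mul_assoc, hss, one_mul]
  · rw [h2 z]
    congr 1; funext ω
    rw [tilt_eq P]

/-- The Ansatz fixes the step probabilities only almost everywhere for the first marginal, hence the
alternative of a vanishing density. -/
lemma FitsAnsatz.ae_stepProb_eq [IsProbabilityMeasure P] {ξ : ℝ} {μ : Measure (Env × ℤˣ)}
    (h : FitsAnsatz P ξ (-(((s : ℤ) : ℝ) * lyap P s r)) (corrector P s r) r μ) :
    ∀ᵐ ω ∂P, fstDensity P μ ω = 0 ∨ stepProb μ ω = tilt s r ω := by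
  have := h.stationaryPair.prob
  have h1 : ∀ z, ∀ᵐ ω ∂μ.fst, stepProb μ ω z = tilt s r ω z := by
    intro z
    refine ae_eq_of_withDensity_ofReal_eq (measurable_stepProb μ z) (measurable_tilt s r z)
      (fun ω => stepProb_nonneg μ ω z) (fun ω => tilt_nonneg s r ω z) ?_
    rw [h.stationaryPair.withDensity_stepProb, h.form z]
    congr 1; funext ω
    rw [tilt_eq P]
  have h2 := ae_all_iff.2 h1
  rw [← h.stationaryPair.withDensity_fstDensity,
    ae_withDensity_iff (measurable_fstDensity P μ).ennreal_ofReal] at h2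
  filter_upwards [h2] with ω hω
  by_cases h0 : fstDensity P μ ω = 0
  · exact Or.inl h0
  · refine Or.inr (funext (hω ?_))
    have := (fstDensity_nonneg P μ ω).lt_of_ne' h0
    simpa using this

/-- The rate of a measure that fits the Ansatz. -/
lemma FitsAnsatz.pairRate_eq [IsProbabilityMeasure P] (hP : Ergodic (shift 1) P)
    (hreg : ∀ᵐ ω ∂P, Regular s c ω) (hr : r < c) (hi : Integrable (logZeta s r) P)
    {ξ : ℝ} (hs : (s : ℤ) * ξ = |ξ|) {μ : Measure (Env × ℤˣ)}
    (h : FitsAnsatz P ξ (-(((s : ℤ) : ℝ) * lyap P s r)) (corrector P s r) r μ) :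
    0 ≤ r - |ξ| * lyap P s r ∧ pairRate P μ = ENNReal.ofReal (r - |ξ| * lyap P s r) := by
  have hD : (fun ω => fstDensity P μ ω * relEntropy (stepProb μ ω) (tilt s r ω)) =ᵐ[P]
      fun _ => (0 : ℝ) := by
    filter_upwards [h.ae_stepProb_eq] with ω hω
    rcases hω with hω | hω
    · rw [hω, zero_mul]
    · rw [hω, relEntropy_self, mul_zero]
  obtain ⟨h1, -, h2⟩ := h.stationaryPair.integral_entropy hP hreg hr hi hs h.mem
    (Or.inr ((integrable_zero _ _ _).congr hD.symm))
  rw [integral_congr_ae hD, integral_zero, zero_add] at h2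
  have h0 := h.stationaryPair.ae_entropy_nonneg hreg
  -- The value is an integral of nonnegative relative entropies, so truncating it to a nonnegative
  -- number loses nothing.
  refine ⟨h2 ▸ integral_nonneg_of_ae h0, ?_⟩
  rw [h.stationaryPair.pairRate_eq, ← ofReal_integral_eq_lintegral_ofReal h1 h0, h2]

/-- A stationary pair measure with the step probabilities of the tilted walk is determined by its
velocity. -/
lemma eq_of_compDensity_eq [IsProbabilityMeasure P] (hP : Ergodic (shift 1) P)
    (hreg : ∀ᵐ ω ∂P, Regular s c ω) (hr : r < c) (hτ : Integrable (meanPassage s r) P)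
    {ξ : ℝ} (hs : (s : ℤ) * ξ = |ξ|) {μ ν : Measure (Env × ℤˣ)}
    (hμ : IsStationaryPair P μ) (hν : IsStationaryPair P ν)
    (hμv : μ ∈ velocitySet ξ) (hνv : ν ∈ velocitySet ξ)
    (hμt : ∀ᵐ ω ∂P, ∀ z, compDensity P μ z ω = fstDensity P μ ω * tilt s r ω z)
    (hνt : ∀ᵐ ω ∂P, ∀ z, compDensity P ν z ω = fstDensity P ν ω * tilt s r ω z) : ν = μ := by
  have hmp := measurePreserving_shift hP.toMeasurePreserving (s : ℤ)
  -- Both densities have the flux `|ξ|`, so their difference solves the invariance equation without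
  -- flux.
  have h0 := ae_eq_zero_of_flux_eq_zero hP hreg hr hτ
    (hν.integrable_fstDensity.1.sub hμ.integrable_fstDensity.1) (by
      filter_upwards [hμt, hνt, hmp.quasiMeasurePreserving.tendsto_ae.eventually hμt,
        hmp.quasiMeasurePreserving.tendsto_ae.eventually hνt, hμ.ae_flux_eq hP hs hμv,
        hν.ae_flux_eq hP hs hνv] with ω h1 h2 h3 h4 h5 h6
      rw [h1, h3] at h5
      rw [h2, h4] at h6
      simp only [Pi.sub_apply]
      linear_combination h6 - h5)
  refine measure_ext_component fun z => ?_
  rw [← hμ.withDensity_compDensity z, ← hν.withDensity_compDensity z]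
  refine withDensity_congr_ae ?_
  filter_upwards [h0, hμt, hνt] with ω h1 h2 h3
  rw [h2, h3, sub_eq_zero.1 h1]

/-- The minimizer of the rate at a velocity `ξ` with the parameter `r`. -/
lemma exists_minimizer [IsProbabilityMeasure P] (hP : Ergodic (shift 1) P)
    (hlog : ∀ z : ℤˣ, Integrable (fun ω => Real.log (trans ω 0 z)) P)
    (hreg : ∀ᵐ ω ∂P, Regular s c ω) (hr : r < c) (hK : InClassK P (corrector P s r)) {ξ : ℝ}
    (hs : (s : ℤ) * ξ = |ξ|) (hξ : ξ ≠ 0) (hderiv : HasDerivAt (lyap P s) |ξ|⁻¹ r) :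
    0 ≤ r - |ξ| * lyap P s r ∧ ∃ μ,
      FitsAnsatz P ξ (-(((s : ℤ) : ℝ) * lyap P s r)) (corrector P s r) r μ ∧
      pairRate P μ = ENNReal.ofReal (r - |ξ| * lyap P s r) ∧
      variationalRate P ξ = ENNReal.ofReal (r - |ξ| * lyap P s r) ∧
      ∀ ν ∈ velocitySet ξ, pairRate P ν = variationalRate P ξ → ν = μ := by
  have hi := integrable_logZeta hP hlog hreg hr
  obtain ⟨hτ, hd⟩ := hasDerivAt_lyap hP hlog hreg hr
  obtain ⟨μ, hμ⟩ := exists_fitsAnsatz hP hreg hr hK hs hξ hτ (hd.unique hderiv)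
  obtain ⟨h0, hrate⟩ := hμ.pairRate_eq hP hreg hr hi hs
  have hvar : variationalRate P ξ = ENNReal.ofReal (r - |ξ| * lyap P s r) :=
    le_antisymm ((iInf₂_le μ hμ.mem).trans hrate.le)
      (le_iInf₂ fun ν hν => (ofReal_le_pairRate hP hreg hr hi hs hν).1)
  refine ⟨h0, μ, hμ, hrate, hvar, fun ν hν h => ?_⟩
  obtain ⟨h1, h2⟩ := (ofReal_le_pairRate hP hreg hr hi hs hν).2 (h.trans hvar) h0
  obtain ⟨h3, h4⟩ := (ofReal_le_pairRate hP hreg hr hi hs hμ.mem).2 hrate h0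
  exact eq_of_compDensity_eq hP hreg hr hτ hs h3 h1 hμ.mem hν h4 h2

end

end RWRE

end

theorem theorem1p7
    (P : Measure RWRE.Env) [IsProbabilityMeasure P]
    -- `P` is stationary and ergodic under the shifts
    (hergodic : Ergodic (RWRE.shift 1) P)
    -- `log π(0, ±1)` is finite almost surely and has a finite moment of order `1 + α`
    (helliptic : ∀ z : ℤˣ, ∀ᵐ ω ∂P, 0 < RWRE.trans ω 0 z)
    (α : ℝ) (hα : 0 < α)
    (hmoment : ∀ z : ℤˣ, Integrable (fun ω => |Real.log (RWRE.trans ω 0 z)| ^ (1 + α)) P) :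
    ∃ (ξc ξc' : ℝ) (rc : ℤˣ → ℝ),
      -1 < ξc' ∧ ξc' ≤ 0 ∧ 0 ≤ ξc ∧ ξc < 1 ∧
      (∀ s, 0 ≤ rc s ∧ RWRE.IsCriticalExponent P s (rc s)) ∧
      -- `λ` is well defined and differentiable below the critical exponent
      (∀ s, ∀ r < rc s, Integrable (RWRE.logZeta s r) P ∧
        DifferentiableAt ℝ (RWRE.lyap P s) r) ∧
      -- `ξ_c = 1 / λ'(r_c-)`, and `-ξ_c'` is its analogue for the other direction
      Tendsto (fun r => (deriv (RWRE.lyap P 1) r)⁻¹) (𝓝[<] rc 1) (𝓝 ξc) ∧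
      Tendsto (fun r => -(deriv (RWRE.lyap P (-1)) r)⁻¹) (𝓝[<] rc (-1)) (𝓝 ξc') ∧
      ∀ (ξ : ℝ) (s : ℤˣ),
        ((s = 1 ∧ ξ ∈ Ioo ξc 1) ∨ (s = -1 ∧ ξ ∈ Ioo (-1) ξc')) →
        ∃ r : ℝ,
          -- `r = r(ξ)` is the unique solution of `λ'(r) = 1 / |ξ|` below `r_c`
          (r < rc s ∧ HasDerivAt (RWRE.lyap P s) |ξ|⁻¹ r) ∧
          (∀ r' < rc s, HasDerivAt (RWRE.lyap P s) |ξ|⁻¹ r' → r' = r) ∧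
          ∃ μ : Measure (RWRE.Env × ℤˣ),
            RWRE.FitsAnsatz P ξ (-(((s : ℤ) : ℝ) * RWRE.lyap P s r))
              (RWRE.corrector P s r) r μ ∧
            -- `μ` is the unique minimizer, and the minimum is `r(ξ) - |ξ| λ(r(ξ))`
            (RWRE.pairRate P μ : EReal) = ((r - |ξ| * RWRE.lyap P s r : ℝ) : EReal) ∧
            (RWRE.variationalRate P ξ : EReal) = ((r - |ξ| * RWRE.lyap P s r : ℝ) : EReal) ∧
            (∀ ν ∈ RWRE.velocitySet ξ,
              RWRE.pairRate P ν = RWRE.variationalRate P ξ → ν = μ) ∧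
            -- the value of the quenched rate function
            (∀ I : ℝ → ℝ≥0∞, RWRE.IsQuenchedRateFunction P I →
              (I ξ : EReal) = ((r - |ξ| * RWRE.lyap P s r : ℝ) : EReal)) := by
  have hlog : ∀ z : ℤˣ, Integrable (fun ω => Real.log (RWRE.trans ω 0 z)) P := fun z =>
    (RWRE.memLp_log_trans hα (hmoment z)).integrable
      (by rw [← ENNReal.ofReal_one]; exact ENNReal.ofReal_le_ofReal (by linarith))
  have hcrit := RWRE.isCriticalExponent_critExp hergodic helliptic hlog
  have hreg : ∀ s, ∀ᵐ ω ∂P, RWRE.Regular s (RWRE.critExp P s) ω := fun s =>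
    RWRE.ae_regular hergodic helliptic (hcrit s).2.finite_below
  choose L hL0 hL1 hL using fun s => RWRE.exists_tendsto_inv_deriv_lyap hergodic hlog (hreg s)
  refine ⟨L 1, -L (-1), RWRE.critExp P, by linarith [hL1 (-1)], by linarith [hL0 (-1)], hL0 1, hL1 1,
    hcrit, fun s r hr => ⟨RWRE.integrable_logZeta hergodic hlog (hreg s) hr,
      (RWRE.hasDerivAt_lyap hergodic hlog (hreg s) hr).2.differentiableAt⟩, hL 1, (hL (-1)).neg,
    fun ξ s hξs => ?_⟩
  -- Both signs of `ξ` reduce to the speed `|ξ|` in the direction `s`; `ξ_c' = -L(-1)` turns the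
  -- second interval into `|ξ| > L(-1)`.
  obtain ⟨hs, hx, hξ⟩ : ((s : ℤ) : ℝ) * ξ = |ξ| ∧ |ξ| ∈ Ioo (L s) 1 ∧ ξ ≠ 0 := by
    rcases hξs with ⟨rfl, h1, h2⟩ | ⟨rfl, h1, h2⟩
    · have h3 : 0 < ξ := (hL0 1).trans_lt h1
      rw [abs_of_pos h3]
      exact ⟨by simp, ⟨h1, h2⟩, h3.ne'⟩
    · have h3 : ξ < 0 := by linarith [hL0 (-1)]
      rw [abs_of_neg h3]
      exact ⟨by simp, ⟨by linarith, by linarith⟩, h3.ne⟩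
  obtain ⟨r, ⟨hr, hderiv⟩, huniq⟩ :=
    RWRE.existsUnique_hasDerivAt_lyap hergodic hlog (hreg s) (hL0 s) (hL s) hx
  obtain ⟨h0, μ, hμ, hrate, hvar, hmin⟩ := RWRE.exists_minimizer hergodic hlog (hreg s) hr
    (RWRE.inClassK_corrector hergodic hα hmoment (hreg s) hr) hs hξ hderiv
  refine ⟨r, ⟨hr, hderiv⟩, huniq, μ, hμ, ?_, ?_, hmin, fun I hI => le_antisymm
    (RWRE.le_ofReal_of_isQuenchedRateFunction hergodic hlog (hreg s) hr hs hξ hderiv h0 hI)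
    (RWRE.ofReal_le_of_isQuenchedRateFunction hergodic hlog (hreg s) hr hs hI)⟩
  · rw [hrate, EReal.coe_ennreal_ofReal, max_eq_left h0]
  · rw [hvar, EReal.coe_ennreal_ofReal, max_eq_left h0]
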